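/- For an integer $n \ge 0$ let $\mathcal U_{nc}(n)$ be the universal unital $C^*$-algebra generated by $n^2$ elements $u_{ij}$ ($1\le i,j\le n$) subject to the condition that the matrix $(u_{ij})$ is unitary (so $\mathcal U_{nc}(0)=\mathbb C$). For a unital $C^*$-algebra $\mathcal A$, the positive elements of $M_p(\mathcal A)$ are those of the form $Y^*Y$. A linear map between unital $C^*$-algebras, or from an operator subsystem (a $*$-closed subspace containing $1$, with the inherited matrix order) to a unital $C^*$-algebra, is ucp if it is unital and its entrywise application to $p\times p$ matrices preserves positivity for every $p$. For unital $C^*$-algebras $\mathcal A,\mathcal B$ and $p\in\mathbb N$, define cones of self-adjoint elements $X \in M_p(\mathcal A\otimes\mathcal B)$ over the algebraic tensor product as follows. * $X\in C_p^{\min}(\mathcal A,\mathcal B)$ iff $(\varphi\otimes\psi)^{(p)}(X)\ge 0$ for all $k,m$ and all ucp maps $\varphi:\mathcal A\to M_k(\mathbb C)$ and $\psi:\mathcal B\to M_m(\mathbb C)$. * $X\in C_p^{\max}(\mathcal A,\mathcal B)$ iff for every $\varepsilon>0$ there are $k,m$, positive $S\in M_k(\mathcal A)$ and $T\in M_m(\mathcal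 B)$, and a scalar $p\times km$ matrix $\alpha$ with $X+\varepsilon 1=\alpha(S\otimes T)\alpha^*$. We write $\mathcal A\otimes_{\min}\mathcal B=\mathcal A\otimes_{\max}\mathcal B$ if $C_p^{\min}(\mathcal A,\mathcal B)=C_p^{\max}(\mathcal A,\mathcal B)$ for every $p$. A unital $C^*$-algebra $\mathcal A$ has the local lifting property (LLP) if, for every unital $C^*$-algebra $\mathcal B$, every closed two-sided ideal $\mathcal I\subseteq\mathcal B$ with quotient map $q:\mathcal B\to\mathcal B/\mathcal I$, every ucp map $\varphi:\mathcal A\to\mathcal B/\mathcal I$ and every finite-dimensional operator subsystem $\mathcal T\subseteq\mathcal A$, there is a ucp map $\psi:\mathcal T\to\mathcal B$ with $q\circ\psi=\varphi|_{\mathcal T}$. **Theorem.** For every $n$, the $C^*$-algebra $\mathcal U_{nc}(n)$ has the LLP, and $$\mathcal U_{nc}(n)\otimes_{\min}\mathcal B(\mathcal H)=\mathcal U_{nc}(n)\otimes_{\max}\mathcal B(\mathcal H)$$ for every Hilbert space $\mathcal H$. -/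

import Mathlib

open scoped TensorProduct Matrix

universe u v w

noncomputable section

/-! ## The universal C⋆-algebra generated by the entries of an `n × n` unitary matrix -/

/-- The free unital complex ⋆-algebra on the letters `u i j` (`i, j : Fin n`), realised as the
algebra of noncommutative polynomials: the letter `((i, j), false)` stands for `u i j`, and the
letter `((i, j), true)` stands for `(u i j)⋆`. -/
def FreeStarAlg (n : ℕ) : Type :=
  MonoidAlgebra ℂ (FreeMonoid ((Fin n × Fin n) × Bool))

namespace FreeStarAlg

variable {n : ℕ}

instance : Ring (FreeStarAlg n) :=
  inferInstanceAs (Ring (MonoidAlgebra ℂ (FreeMonoid ((Fin n × Fin n) × Bool))))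

instance : Algebra ℂ (FreeStarAlg n) :=
  inferInstanceAs (Algebra ℂ (MonoidAlgebra ℂ (FreeMonoid ((Fin n × Fin n) × Bool))))

/-- The word `w`, as an element of the free ⋆-algebra. -/
def word (w : FreeMonoid ((Fin n × Fin n) × Bool)) : FreeStarAlg n :=
  MonoidAlgebra.of ℂ _ w

theorem word_one : word (1 : FreeMonoid ((Fin n × Fin n) × Bool)) = 1 :=
  map_one (MonoidAlgebra.of ℂ _)

theorem word_mul (v w : FreeMonoid ((Fin n × Fin n) × Bool)) :
    word (v * w) = word v * word w :=
  map_mul (MonoidAlgebra.of ℂ _) v w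

theorem induction {motive : FreeStarAlg n → Prop} (x : FreeStarAlg n)
    (hword : ∀ w, motive (word w)) (hadd : ∀ x y, motive x → motive y → motive (x + y))
    (hsmul : ∀ (c : ℂ) x, motive x → motive (c • x)) : motive x :=
  MonoidAlgebra.induction_on (motive := motive) x hword hadd hsmul

/-- The adjoint of a single letter. -/
def flipLetter (a : (Fin n × Fin n) × Bool) : (Fin n × Fin n) × Bool := (a.1, !a.2)

/-- The adjoint on words. -/
def starWord : FreeMonoid ((Fin n × Fin n) × Bool) →* (FreeStarAlg n)ᵐᵒᵖ :=
  FreeMonoid.lift fun a => MulOpposite.op (word (FreeMonoid.of (flipLetter a)))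

/-- The adjoint, as a ring homomorphism to the opposite ring: it conjugates the scalars, reverses
the words and exchanges `u i j` with `(u i j)⋆`. -/
def starHom : FreeStarAlg n →+* (FreeStarAlg n)ᵐᵒᵖ :=
  MonoidAlgebra.liftNCRingHom (k := ℂ) (R := (FreeStarAlg n)ᵐᵒᵖ)
    ((algebraMap ℂ (FreeStarAlg n)ᵐᵒᵖ).comp (starRingEnd ℂ)) starWord
    (fun c w => Algebra.commutes (A := (FreeStarAlg n)ᵐᵒᵖ) (starRingEnd ℂ c) (starWord w))

instance : Star (FreeStarAlg n) := ⟨fun x => (starHom x).unop⟩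

theorem star_def (x : FreeStarAlg n) : star x = (starHom x).unop := rfl

theorem starHom_word (w : FreeMonoid ((Fin n × Fin n) × Bool)) :
    starHom (word w) = starWord w := by
  refine (MonoidAlgebra.liftNCRingHom_single _ _ _ _ _).trans ?_
  simp

theorem starHom_algebraMap (c : ℂ) :
    starHom (algebraMap ℂ (FreeStarAlg n) c) = algebraMap ℂ _ (starRingEnd ℂ c) := by
  refine (MonoidAlgebra.liftNCRingHom_single _ _ _ _ _).trans ?_
  simp

theorem star_mul' (x y : FreeStarAlg n) : star (x * y) = star y * star x := by
  simp [star_def]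

theorem star_add' (x y : FreeStarAlg n) : star (x + y) = star x + star y := by
  simp [star_def]

theorem star_smul' (c : ℂ) (x : FreeStarAlg n) : star (c • x) = star c • star x := by
  rw [Algebra.smul_def, star_mul', Algebra.smul_def, Algebra.commutes]
  congr 1
  rw [star_def, starHom_algebraMap]
  rfl

theorem star_word_of (a : (Fin n × Fin n) × Bool) :
    star (word (FreeMonoid.of a)) = word (FreeMonoid.of (flipLetter a)) := by
  simp [star_def, starHom_word, starWord]

theorem star_star' (x : FreeStarAlg n) : star (star x) = x := by
  induction x using induction with
  | hword w =>
    induction w using FreeMonoid.inductionOn' with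
    | one => simp [word_one, star_def]
    | of_mul a w ih =>
      rw [word_mul, star_mul', star_mul', ih, star_word_of, star_word_of]
      simp [flipLetter]
  | hadd x y hx hy => rw [star_add', star_add', hx, hy]
  | hsmul c x hx => rw [star_smul', star_smul', hx, star_star]

instance : StarRing (FreeStarAlg n) where
  star_involutive := star_star'
  star_mul := star_mul'
  star_add := star_add'

instance : StarModule ℂ (FreeStarAlg n) where
  star_smul := star_smul'

/-- The free generator `u i j`. -/
def gen (i j : Fin n) : FreeStarAlg n := word (FreeMonoid.of ((i, j), false))

/-- The C⋆-seminorms on the free ⋆-algebra for which the matrix `(u i j)` is unitary, that is,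
which vanish on the entries of `u⋆u - 1` and of `uu⋆ - 1`. The entries of a unitary matrix over a
C⋆-algebra have norm at most one; this is recorded as the last condition. -/
structure IsUnitarySeminorm (p : Seminorm ℂ (FreeStarAlg n)) : Prop where
  mul_le : ∀ x y, p (x * y) ≤ p x * p y
  star_mul_self : ∀ x, p (star x * x) = p x ^ 2
  star_mul_gen : ∀ i j, p (∑ k, star (gen k i) * gen k j - if i = j then 1 else 0) = 0
  gen_mul_star : ∀ i j, p (∑ k, gen i k * star (gen j k) - if i = j then 1 else 0) = 0
  gen_le : ∀ i j, p (gen i j) ≤ 1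

namespace IsUnitarySeminorm

variable {p : Seminorm ℂ (FreeStarAlg n)}

theorem map_star (hp : IsUnitarySeminorm p) (x : FreeStarAlg n) : p (star x) = p x := by
  have key : ∀ y, p y ≤ p (star y) := fun y => by
    rcases (apply_nonneg p y).eq_or_lt with h | h
    · rw [← h]; exact apply_nonneg p _
    · have := hp.mul_le (star y) y
      rw [hp.star_mul_self, sq] at this
      exact le_of_mul_le_mul_right this h
  refine le_antisymm ?_ (key x)
  simpa using key (star x)

theorem map_one_le (hp : IsUnitarySeminorm p) : p 1 ≤ 1 := by
  have h := hp.star_mul_self 1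
  rw [star_one, one_mul] at h
  nlinarith

theorem map_word_le (hp : IsUnitarySeminorm p) (w : FreeMonoid ((Fin n × Fin n) × Bool)) :
    p (word w) ≤ 1 := by
  induction w using FreeMonoid.inductionOn' with
  | one => rw [word_one]; exact hp.map_one_le
  | of_mul a w ih =>
    rw [word_mul]
    refine (hp.mul_le _ _).trans (mul_le_one₀ ?_ (apply_nonneg p _) ih)
    obtain ⟨⟨i, j⟩, b⟩ := a
    cases b
    · exact hp.gen_le i j
    · rw [← hp.map_star, star_word_of]
      exact hp.gen_le i j

end IsUnitarySeminorm

theorem isUnitarySeminorm_zero : IsUnitarySeminorm (0 : Seminorm ℂ (FreeStarAlg n)) := by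
  constructor <;> simp

instance : Nonempty {p : Seminorm ℂ (FreeStarAlg n) // IsUnitarySeminorm p} :=
  ⟨⟨0, isUnitarySeminorm_zero⟩⟩

theorem bddAbove_seminorm (x : FreeStarAlg n) :
    BddAbove (Set.range fun p : {p : Seminorm ℂ (FreeStarAlg n) // IsUnitarySeminorm p} =>
      p.1 x) := by
  induction x using induction with
  | hword w => exact ⟨1, by rintro _ ⟨p, rfl⟩; exact p.2.map_word_le w⟩
  | hadd x y hx hy =>
    obtain ⟨a, ha⟩ := hx
    obtain ⟨b, hb⟩ := hy
    refine ⟨a + b, ?_⟩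
    rintro _ ⟨p, rfl⟩
    exact (map_add_le_add p.1 x y).trans (add_le_add (ha ⟨p, rfl⟩) (hb ⟨p, rfl⟩))
  | hsmul c x hx =>
    obtain ⟨a, ha⟩ := hx
    refine ⟨‖c‖ * a, ?_⟩
    rintro _ ⟨p, rfl⟩
    exact (map_smul_eq_mul p.1 c x).le.trans
      (mul_le_mul_of_nonneg_left (ha ⟨p, rfl⟩) (norm_nonneg c))

/-- The universal C⋆-seminorm: the supremum of all C⋆-seminorms for which `(u i j)` is unitary. -/
instance : Norm (FreeStarAlg n) :=
  ⟨fun x => ⨆ p : {p : Seminorm ℂ (FreeStarAlg n) // IsUnitarySeminorm p}, p.1 x⟩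

theorem norm_def (x : FreeStarAlg n) :
    ‖x‖ = ⨆ p : {p : Seminorm ℂ (FreeStarAlg n) // IsUnitarySeminorm p}, p.1 x := rfl

theorem le_norm {p : Seminorm ℂ (FreeStarAlg n)} (hp : IsUnitarySeminorm p)
    (x : FreeStarAlg n) : p x ≤ ‖x‖ :=
  le_ciSup (bddAbove_seminorm x) ⟨p, hp⟩

theorem norm_le {x : FreeStarAlg n} {c : ℝ}
    (h : ∀ p : Seminorm ℂ (FreeStarAlg n), IsUnitarySeminorm p → p x ≤ c) : ‖x‖ ≤ c :=
  ciSup_le fun p => h p.1 p.2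

theorem norm_nonneg' (x : FreeStarAlg n) : 0 ≤ ‖x‖ :=
  (apply_nonneg (0 : Seminorm ℂ (FreeStarAlg n)) x).trans (le_norm isUnitarySeminorm_zero x)

theorem norm_mul_le' (x y : FreeStarAlg n) : ‖x * y‖ ≤ ‖x‖ * ‖y‖ :=
  norm_le fun p hp => (hp.mul_le x y).trans
    (mul_le_mul (le_norm hp x) (le_norm hp y) (apply_nonneg p y) (norm_nonneg' x))

theorem norm_smul_le' (c : ℂ) (x : FreeStarAlg n) : ‖c • x‖ ≤ ‖c‖ * ‖x‖ :=
  norm_le fun p hp => (map_smul_eq_mul p c x).le.trans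
    (mul_le_mul_of_nonneg_left (le_norm hp x) (norm_nonneg c))

theorem norm_star' (x : FreeStarAlg n) : ‖star x‖ = ‖x‖ := by
  simp only [norm_def]
  exact iSup_congr fun p => p.2.map_star x

theorem norm_mul_self_le' (x : FreeStarAlg n) : ‖x‖ * ‖x‖ ≤ ‖star x * x‖ := by
  have h : ‖x‖ ≤ √‖star x * x‖ := norm_le fun p hp =>
    Real.le_sqrt_of_sq_le ((hp.star_mul_self x).symm.le.trans (le_norm hp _))
  exact (mul_self_le_mul_self (norm_nonneg' x) h).trans
    (Real.mul_self_sqrt (norm_nonneg' _)).le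

instance : SeminormedRing (FreeStarAlg n) where
  __ := (inferInstance : Ring (FreeStarAlg n))
  __ := (inferInstance : Norm (FreeStarAlg n))
  dist x y := ‖-x + y‖
  dist_self x := by
    refine le_antisymm (norm_le fun p _ => ?_) (norm_nonneg' _)
    simp
  dist_comm x y := by
    simp only [norm_def]
    refine iSup_congr fun p => ?_
    rw [← map_neg_eq_map]
    congr 1
    abel
  dist_triangle x y z := norm_le fun p hp => by
    have h : -x + z = (-x + y) + (-y + z) := by abel
    rw [h]
    exact (map_add_le_add p _ _).trans (add_le_add (le_norm hp _) (le_norm hp _))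
  dist_eq _ _ := rfl
  norm_mul_le := norm_mul_le'

instance : NormedAlgebra ℂ (FreeStarAlg n) where
  norm_smul_le := norm_smul_le'

instance : NormedStarGroup (FreeStarAlg n) where
  norm_star_le x := (norm_star' x).le

end FreeStarAlg

/-- `U_nc(n)`: the universal unital C⋆-algebra generated by `n²` elements `u i j` subject to the
condition that the matrix `(u i j)` is unitary, that is, the separated completion of the free
⋆-algebra with respect to the universal C⋆-seminorm. -/
def Unc (n : ℕ) : Type := UniformSpace.Completion (FreeStarAlg n)

namespace Unc

open UniformSpace

variable {n : ℕ}

instance : NormedRing (Unc n) := inferInstanceAs (NormedRing (Completion (FreeStarAlg n)))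

instance : CompleteSpace (Unc n) := inferInstanceAs (CompleteSpace (Completion (FreeStarAlg n)))

instance : NormedAlgebra ℂ (Unc n) where
  __ := (inferInstanceAs (Algebra ℂ (Completion (FreeStarAlg n))) : Algebra ℂ (Unc n))
  norm_smul_le := norm_smul_le (α := ℂ) (β := Completion (FreeStarAlg n))

/-- The canonical ring homomorphism from the free ⋆-algebra, with dense range. -/
def ofFree : FreeStarAlg n →+* Unc n := Completion.coeRingHom

theorem continuous_ofFree : Continuous (ofFree : FreeStarAlg n → Unc n) :=
  Completion.continuous_coe _

theorem norm_ofFree (x : FreeStarAlg n) : ‖ofFree x‖ = ‖x‖ := Completion.norm_coe x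

theorem ofFree_smul (c : ℂ) (x : FreeStarAlg n) : ofFree (c • x) = c • ofFree x :=
  Completion.coe_smul c x

theorem induction {motive : Unc n → Prop} (x : Unc n) (hc : IsClosed {x | motive x})
    (h : ∀ a, motive (ofFree a)) : motive x :=
  Completion.induction_on x hc h

/-- The adjoint is extended from the free ⋆-algebra by continuity. -/
instance : Star (Unc n) := ⟨Completion.map (star : FreeStarAlg n → FreeStarAlg n)⟩

theorem continuous_star' : Continuous (star : Unc n → Unc n) := Completion.continuous_map

theorem star_ofFree (a : FreeStarAlg n) : star (ofFree a) = ofFree (star a) :=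
  Completion.map_coe (starNormedAddGroupHom (E := FreeStarAlg n)).uniformContinuous a

theorem star_star' (x : Unc n) : star (star x) = x := by
  induction x using induction with
  | hc => exact isClosed_eq (continuous_star'.comp continuous_star') continuous_id
  | h a => rw [star_ofFree, star_ofFree, star_star]

theorem star_add' (x y : Unc n) : star (x + y) = star x + star y := by
  induction x using induction with
  | hc =>
    exact isClosed_eq (continuous_star'.comp (continuous_id.add continuous_const))
      (continuous_star'.add continuous_const)
  | h a =>
    induction y using induction with
    | hc =>
      exact isClosed_eq (continuous_star'.comp (continuous_const.add continuous_id))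
        (continuous_const.add continuous_star')
    | h b => rw [← map_add, star_ofFree, star_ofFree, star_ofFree, star_add, map_add]

theorem star_mul' (x y : Unc n) : star (x * y) = star y * star x := by
  induction x using induction with
  | hc =>
    exact isClosed_eq (continuous_star'.comp (continuous_id.mul continuous_const))
      (continuous_const.mul continuous_star')
  | h a =>
    induction y using induction with
    | hc =>
      exact isClosed_eq (continuous_star'.comp (continuous_const.mul continuous_id))
        (continuous_star'.mul continuous_const)
    | h b => rw [← map_mul, star_ofFree, star_ofFree, star_ofFree, star_mul, map_mul]

theorem star_smul' (c : ℂ) (x : Unc n) : star (c • x) = star c • star x := by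
  induction x using induction with
  | hc =>
    exact isClosed_eq (continuous_star'.comp (continuous_const_smul c))
      (continuous_star'.const_smul (star c))
  | h a => rw [← ofFree_smul, star_ofFree, star_ofFree, star_smul, ofFree_smul]

theorem norm_mul_self_le' (x : Unc n) : ‖x‖ * ‖x‖ ≤ ‖star x * x‖ := by
  induction x using induction with
  | hc =>
    exact isClosed_le (continuous_norm.mul continuous_norm)
      (continuous_norm.comp (continuous_star'.mul continuous_id))
  | h a =>
    rw [star_ofFree, ← map_mul, norm_ofFree, norm_ofFree]
    exact FreeStarAlg.norm_mul_self_le' a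

instance : StarRing (Unc n) where
  star_involutive := star_star'
  star_mul := star_mul'
  star_add := star_add'

instance : StarModule ℂ (Unc n) where
  star_smul := star_smul'

instance : CStarRing (Unc n) where
  norm_mul_self_le := norm_mul_self_le'

instance : CStarAlgebra (Unc n) where

/-- The canonical generator `u i j` of `U_nc(n)`. -/
def u (i j : Fin n) : Unc n := ofFree (FreeStarAlg.gen i j)

end Unc

/-! ## Positivity of matrices and unital completely positive maps -/

/-- A square matrix over a C⋆-algebra `A` (or over matrices over `ℂ`) is positive if it is of the
form `Y⋆Y`; these are the positive elements of the C⋆-algebra `M_ι(A)`. -/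
def MatPos {ι A : Type*} [Fintype ι] [NonUnitalSemiring A] [StarRing A] (X : Matrix ι ι A) :
    Prop :=
  ∃ Y : Matrix ι ι A, X = Yᴴ * Y

/-- An operator subsystem of a unital C⋆-algebra: a ⋆-closed subspace containing the unit, with
the order on its matrices inherited from the C⋆-algebra. -/
structure IsOperatorSubsystem {A : Type*} [CStarAlgebra A] (T : Submodule ℂ A) : Prop where
  one_mem : (1 : A) ∈ T
  star_mem : ∀ {a : A}, a ∈ T → star a ∈ T

/-- Unital completely positive maps from (the operator system) `A` to `B`. -/
structure IsUCP {A B : Type*} [Ring A] [StarRing A] [Algebra ℂ A] [Ring B] [StarRing B]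
    [Algebra ℂ B] (φ : A →ₗ[ℂ] B) : Prop where
  map_one : φ 1 = 1
  map_matPos : ∀ (r : ℕ) (X : Matrix (Fin r) (Fin r) A), MatPos X → MatPos (X.map φ)

/-- Unital completely positive maps from an operator subsystem `T` of `A` to `B`. -/
structure IsUCPOn {A B : Type*} [CStarAlgebra A] [CStarAlgebra B] {T : Submodule ℂ A}
    (hT : IsOperatorSubsystem T) (ψ : T →ₗ[ℂ] B) : Prop where
  map_one : ψ ⟨1, hT.one_mem⟩ = 1
  map_matPos : ∀ (r : ℕ) (X : Matrix (Fin r) (Fin r) T),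
    MatPos (X.map (fun t : T => (t : A))) → MatPos (X.map ψ)

/-- The local lifting property of a unital C⋆-algebra `A`: every ucp map `φ` from `A` into a
quotient of a unital C⋆-algebra `B` by a closed two-sided ideal lifts to a ucp map into `B` on
every finite-dimensional operator subsystem `T` of `A`. The quotient map is given as a surjective
unital ⋆-homomorphism `q : B → C` of C⋆-algebras (so that `C` is `B` modulo the kernel of `q`, and
every quotient of `B` arises in this way). -/
def HasLLP (A : Type u) [CStarAlgebra A] : Prop :=
  ∀ (B : Type v) (C : Type w) [CStarAlgebra B] [CStarAlgebra C] (q : B →⋆ₐ[ℂ] C),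
    Function.Surjective q →
    ∀ φ : A →ₗ[ℂ] C, IsUCP φ →
    ∀ (T : Submodule ℂ A) (hT : IsOperatorSubsystem T), FiniteDimensional ℂ T →
    ∃ ψ : T →ₗ[ℂ] B, IsUCPOn hT ψ ∧ ∀ t : T, q (ψ t) = φ t

/-! ## The minimal and the maximal tensor product -/

section Tensor

variable (A B : Type*) [CStarAlgebra A] [CStarAlgebra B]

/-- For `φ : A → M_k` and `ψ : B → M_m`, the map `φ ⊗ ψ : A ⊗ B → M_k ⊗ M_m = M_{km}`. -/
def tensorToMatrix {A B : Type*} [CStarAlgebra A] [CStarAlgebra B] {k m : ℕ}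
    (φ : A →ₗ[ℂ] Matrix (Fin k) (Fin k) ℂ) (ψ : B →ₗ[ℂ] Matrix (Fin m) (Fin m) ℂ) :
    A ⊗[ℂ] B →ₗ[ℂ] Matrix (Fin k × Fin m) (Fin k × Fin m) ℂ :=
  TensorProduct.lift ((Matrix.kroneckerBilinear (R := ℂ) (α := ℂ)).compl₁₂ φ ψ)

/-- `C_p^min(A, B)`: the positive cone of `M_p(A ⊗_min B)`. It consists of the self-adjoint
matrices `X` over the algebraic tensor product with `(φ ⊗ ψ)^{(p)}(X) ≥ 0` for all matrix
states (ucp maps into matrix algebras) `φ` of `A` and `ψ` of `B`. -/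
def minCone (p : ℕ) : Set (Matrix (Fin p) (Fin p) (A ⊗[ℂ] B)) :=
  {X | Xᴴ = X ∧
    ∀ (k m : ℕ) (φ : A →ₗ[ℂ] Matrix (Fin k) (Fin k) ℂ) (ψ : B →ₗ[ℂ] Matrix (Fin m) (Fin m) ℂ),
      IsUCP φ → IsUCP ψ → MatPos (X.map (tensorToMatrix φ ψ))}

/-- `D_p^max(A, B)`: the matrices `α (S ⊗ T) α⋆` with `S ∈ M_k(A)` and `T ∈ M_m(B)` positive and
`α` a scalar `p × km` matrix. -/
def preMaxCone (p : ℕ) : Set (Matrix (Fin p) (Fin p) (A ⊗[ℂ] B)) :=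
  {X | ∃ (k m : ℕ) (S : Matrix (Fin k) (Fin k) A) (T : Matrix (Fin m) (Fin m) B)
      (α : Matrix (Fin p) (Fin k × Fin m) ℂ), MatPos S ∧ MatPos T ∧
      X = Matrix.of fun a b => ∑ s : Fin k × Fin m, ∑ t : Fin k × Fin m,
        (α a s * star (α b t)) • (S s.1 t.1 ⊗ₜ[ℂ] T s.2 t.2)}

/-- `C_p^max(A, B)`: the positive cone of `M_p(A ⊗_max B)`, the Archimedeanization of
`D_p^max(A, B)` with respect to the order unit `1 ⊗ 1`. -/
def maxCone (p : ℕ) : Set (Matrix (Fin p) (Fin p) (A ⊗[ℂ] B)) :=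
  {X | Xᴴ = X ∧ ∀ ε : ℝ, 0 < ε →
    X + (ε : ℂ) • (1 : Matrix (Fin p) (Fin p) (A ⊗[ℂ] B)) ∈ preMaxCone A B p}

/-- `A ⊗_min B = A ⊗_max B`: the two operator system structures on the algebraic tensor product
(with the same unit `1 ⊗ 1`) have the same positive cones at every matrix level. -/
def MinTensorEqMaxTensor : Prop := ∀ p : ℕ, minCone A B p = maxCone A B p

end Tensor

end

/-!
Both assertions rest on one construction, a truncated Stinespring dilation that lifts through
quotients (`exists_lifted_dilation`). Let `q : B → C` be a surjective ⋆-homomorphism and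
`L : U_nc(n) → C` a linear map that is positive on hermitian squares of polynomials of degree at
most `d + 1` in the generators and their adjoints, with invertible Gram matrix in degree `d`. The
inverse square root of the Gram matrix maps polynomials of degree at most `d` into a free module
`C^N`, isometrically for the inner product `⟨x, y⟩ = L (x⋆ y)`. The self-adjoint unitary
`[[0, u], [u⋆, 0]]` acts on polynomials by left multiplication; its compression `S` to degree `d` is
a self-adjoint contraction, so it lifts to a self-adjoint contraction `S'` over `B`, and
`S' + i √(1 - S'²)` is a unitary over `B`. This unitary defines a representation of `U_nc(n)`.
Modulo the kernel of `q` it still acts as left multiplication on polynomials of degree below `d`,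
because there `S` is isometric and the defect `√(1 - S²)` vanishes. Hence `L` agrees in degree at
most `d` with a vector form of a representation that lifts to `B`.

*Local lifting property.* Applied to a slight perturbation of a ucp map `φ : U_nc(n) → C` by a state
that is faithful in low degrees, the dilation gives ucp maps into `B` that lift `φ` up to a small
error on a given finite set (`exists_approx_lift_of_isUCP`). Approximate lifts are turned into exact
ones on finite-dimensional operator subsystems (`hasLLP_of_approx`): two approximate lifts are
patched along a quasicentral positive contraction of the kernel of `q` (`exists_isUCP_patch`), and
the resulting sequence converges in norm.

*Tensor products with `B(H)`.* The inclusion of the maximal in the minimal cone holds for all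
C⋆-algebras, since Kronecker products of positive matrices are positive (`maxCone_subset_minCone`).
For the converse, take `q` to be the identity of a matrix algebra. The dilations are then
finite-dimensional representations, and a Hahn-Banach argument yields a noncommutative
Positivstellensatz: a matrix of polynomials that is positive in all finite-dimensional
representations is a limit of sums of hermitian squares, with a degree bound
(`exists_squareSum_near`). If `X` lies in the minimal cone and its left-hand factors are
polynomials, this applies to the compressions of `X` to finite-dimensional subspaces of `H`. The
coefficients of the sums of squares form positive matrices of sesquilinear forms, bounded
independently of the subspace because some state is faithful in the degrees involved
(`exists_isPositiveForm_near`). A limit along an ultrafilter is a positive matrix `T` of operators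
on `H` with `X = ∑ vᵢ⋆ vⱼ ⊗ Tᵢⱼ`, which lies in the maximal cone (`mem_preMaxCone_of_mem_minCone`).
General `X` are approximated by such matrices in the order unit seminorm
(`exists_selfAdjoint_polyTensor_approx`), and the maximal cone is Archimedean.
-/

noncomputable section

open scoped ComplexOrder

/-! ### Positive matrices over C⋆-algebras -/

/-- The instances are taken from `CStarAlgebra A`, whereas the functional calculus in the library
statement has to be found separately for each algebra. -/
theorem CStarAlgebra.nonneg_iff_exists_star_mul_self {A : Type*} [CStarAlgebra A]
    [PartialOrder A] [StarOrderedRing A] {a : A} : 0 ≤ a ↔ ∃ b, a = star b * b :=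
  CStarAlgebra.nonneg_iff_eq_star_mul_self

section MatPos

variable {ι κ A : Type*} [Fintype ι] [Fintype κ]

section Order

variable [CStarAlgebra A] [PartialOrder A] [StarOrderedRing A] [DecidableEq ι]

/-- Positivity of a matrix over `A` is the order of the C⋆-algebra `CStarMatrix ι ι A`. -/
theorem matPos_iff_nonneg {X : Matrix ι ι A} : MatPos X ↔ 0 ≤ CStarMatrix.ofMatrix X :=
  (CStarAlgebra.nonneg_iff_exists_star_mul_self (a := CStarMatrix.ofMatrix X)).symm

omit [PartialOrder A] [StarOrderedRing A] in
/-- `Z⋆Z` is positive also for a rectangular `Z`: it is the sum of the hermitian squares of the rows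
of `Z`, each padded to a square matrix. -/
theorem matPos_conjTranspose_mul_self (Z : Matrix κ ι A) : MatPos (Zᴴ * Z) := by
  let _ := CStarAlgebra.spectralOrder A
  have := CStarAlgebra.spectralOrderedRing A
  rcases isEmpty_or_nonempty ι with h | ⟨⟨i₀⟩⟩
  · exact ⟨0, Subsingleton.elim _ _⟩
  rw [matPos_iff_nonneg]
  have h : CStarMatrix.ofMatrix (Zᴴ * Z) = ∑ k, star (CStarMatrix.ofMatrix
      (Matrix.of fun i j => if i = i₀ then Z k j else 0)) * CStarMatrix.ofMatrix
      (Matrix.of fun i j => if i = i₀ then Z k j else 0) := by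
    have h2 : Zᴴ * Z = ∑ k, (Matrix.of fun i j => if i = i₀ then Z k j else 0)ᴴ *
        (Matrix.of fun i j => if i = i₀ then Z k j else 0) := by
      ext i j
      rw [Matrix.sum_apply]
      simp [Matrix.mul_apply, apply_ite]
    rw [h2]
    exact map_sum (CStarMatrix.ofMatrixStarAlgEquiv (n := ι) (A := A)) _ _
  rw [h]
  exact Finset.sum_nonneg fun k _ => star_mul_self_nonneg _

end Order

section Algebra

variable [CStarAlgebra A]

theorem MatPos.conjTranspose_mul_mul {X : Matrix κ κ A} (hX : MatPos X) (Z : Matrix κ ι A) :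
    MatPos (Zᴴ * X * Z) := by
  classical
  obtain ⟨Y, rfl⟩ := hX
  have : Zᴴ * (Yᴴ * Y) * Z = (Y * Z)ᴴ * (Y * Z) := by
    simp only [Matrix.conjTranspose_mul, Matrix.mul_assoc]
  rw [this]
  exact matPos_conjTranspose_mul_self _

theorem MatPos.submatrix {X : Matrix κ κ A} (hX : MatPos X) (f : ι → κ) :
    MatPos (X.submatrix f f) := by
  classical
  obtain ⟨Y, rfl⟩ := hX
  exact matPos_conjTranspose_mul_self (Y.submatrix id f)

theorem MatPos.conjTranspose_eq {X : Matrix κ κ A} (hX : MatPos X) : Xᴴ = X := by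
  obtain ⟨Y, rfl⟩ := hX
  simp [Matrix.conjTranspose_mul]

theorem matPos_zero : MatPos (0 : Matrix κ κ A) := ⟨0, by simp⟩

theorem MatPos.add {X Y : Matrix κ κ A} (hX : MatPos X) (hY : MatPos Y) : MatPos (X + Y) := by
  classical
  let _ := CStarAlgebra.spectralOrder A
  have := CStarAlgebra.spectralOrderedRing A
  rw [matPos_iff_nonneg] at *
  exact add_nonneg hX hY

theorem matPos_sum {l : Type*} (s : Finset l) (X : l → Matrix κ κ A)
    (h : ∀ i ∈ s, MatPos (X i)) : MatPos (∑ i ∈ s, X i) := by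
  classical
  induction s using Finset.induction_on with
  | empty => simpa using matPos_zero
  | insert a s ha ih =>
    rw [Finset.sum_insert ha]
    exact (h _ (by simp)).add (ih fun i hi => h i (by simp [hi]))

theorem MatPos.smul {X : Matrix κ κ A} (hX : MatPos X) {c : ℝ} (hc : 0 ≤ c) :
    MatPos ((c : ℂ) • X) := by
  obtain ⟨Y, rfl⟩ := hX
  refine ⟨((√c : ℝ) : ℂ) • Y, ?_⟩
  rw [Matrix.conjTranspose_smul, Matrix.smul_mul, Matrix.mul_smul, smul_smul]
  congr 1
  simp [← Complex.ofReal_mul, Real.mul_self_sqrt hc]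

/-- The order of `CStarMatrix κ κ A` is closed in norm, and this topology is that of entrywise
convergence. -/
theorem isClosed_matPos : IsClosed {X : Matrix κ κ A | MatPos X} := by
  classical
  let _ := CStarAlgebra.spectralOrder A
  have := CStarAlgebra.spectralOrderedRing A
  have : {X : Matrix κ κ A | MatPos X} =
      CStarMatrix.ofMatrixL ⁻¹' {X : CStarMatrix κ κ A | 0 ≤ X} := by
    ext X
    exact matPos_iff_nonneg
  rw [this]
  exact CStarAlgebra.isClosed_nonneg.preimage CStarMatrix.ofMatrixL.continuous

theorem matPos_of_forall_add_smul [DecidableEq κ] {X : Matrix κ κ A}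
    (h : ∀ ε : ℝ, 0 < ε → MatPos (X + (ε : ℂ) • (1 : Matrix κ κ A))) : MatPos X := by
  have hc : Continuous fun ε : ℝ => X + (ε : ℂ) • (1 : Matrix κ κ A) := by fun_prop
  have ht := (hc.tendsto 0).mono_left (nhdsWithin_le_nhds (s := Set.Ioi 0))
  simp only [Complex.ofReal_zero, zero_smul, add_zero] at ht
  exact isClosed_matPos.mem_of_tendsto ht
    (Filter.eventually_of_mem self_mem_nhdsWithin fun ε hε => h ε hε)

theorem matPos_one_iff {X : Matrix (Fin 1) (Fin 1) A} [PartialOrder A] [StarOrderedRing A] :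
    MatPos X ↔ 0 ≤ X 0 0 := by
  rw [CStarAlgebra.nonneg_iff_eq_star_mul_self]
  constructor
  · rintro ⟨Y, rfl⟩
    exact ⟨Y 0 0, by simp [Matrix.mul_apply]⟩
  · rintro ⟨b, hb⟩
    refine ⟨Matrix.of fun _ _ => b, ?_⟩
    ext i j
    fin_cases i; fin_cases j
    simp [Matrix.mul_apply, hb]

/-- The Gram matrix of a finite family is positive. -/
theorem matPos_gram (y : κ → A) : MatPos (Matrix.of fun i j => star (y i) * y j) := by
  classical
  have : (Matrix.of fun i j => star (y i) * y j) =
      (Matrix.of fun (_ : Unit) j => y j)ᴴ * (Matrix.of fun (_ : Unit) j => y j) := by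
    ext i j
    simp [Matrix.mul_apply]
  rw [this]
  exact matPos_conjTranspose_mul_self _

end Algebra

theorem MatPos.of_fin {A B : Type*} [NonUnitalSemiring A] [StarRing A] [NonUnitalSemiring B]
    [StarRing B] {f : A → B}
    (h : ∀ (r : ℕ) (X : Matrix (Fin r) (Fin r) A), MatPos X → MatPos (X.map f))
    {X : Matrix κ κ A} (hX : MatPos X) : MatPos (X.map f) := by
  let e := Fintype.equivFin κ
  obtain ⟨Y, rfl⟩ := hX
  obtain ⟨Z, hZ⟩ := h _ ((Yᴴ * Y).submatrix e.symm e.symm) ⟨Y.submatrix e.symm e.symm, by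
    rw [Matrix.conjTranspose_submatrix, Matrix.submatrix_mul_equiv]⟩
  refine ⟨Z.submatrix e e, ?_⟩
  rw [Matrix.conjTranspose_submatrix, Matrix.submatrix_mul_equiv, ← hZ]
  ext i j
  simp

theorem IsUCP.matPos_map_of_fintype {A B : Type*} [Ring A] [StarRing A] [Algebra ℂ A] [Ring B]
    [StarRing B] [Algebra ℂ B] {φ : A →ₗ[ℂ] B} (hφ : IsUCP φ) {X : Matrix κ κ A} (hX : MatPos X) :
    MatPos (X.map φ) :=
  MatPos.of_fin hφ.map_matPos hX

/-- Positivity of a block matrix with complex matrix blocks is positive semidefiniteness of the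
flattened matrix. -/
theorem matPos_iff_posSemidef_comp [DecidableEq ι] [DecidableEq κ]
    {X : Matrix ι ι (Matrix κ κ ℂ)} :
    MatPos X ↔ (Matrix.comp ι ι κ κ ℂ X).PosSemidef := by
  constructor
  · rintro ⟨Y, rfl⟩
    have : Matrix.comp ι ι κ κ ℂ (Yᴴ * Y) =
        (Matrix.comp ι ι κ κ ℂ Y)ᴴ * Matrix.comp ι ι κ κ ℂ Y := by
      ext ⟨i, k⟩ ⟨j, l⟩
      simp [Matrix.mul_apply, Matrix.sum_apply, Fintype.sum_prod_type, Matrix.star_apply]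
    rw [this]
    exact Matrix.posSemidef_conjTranspose_mul_self _
  · intro h
    open scoped MatrixOrder in
    obtain ⟨Z, hZ⟩ := CStarAlgebra.nonneg_iff_eq_star_mul_self.1 h.nonneg
    refine ⟨(Matrix.comp ι ι κ κ ℂ).symm Z, ?_⟩
    apply (Matrix.comp ι ι κ κ ℂ).injective
    rw [hZ]
    ext ⟨i, k⟩ ⟨j, l⟩
    simp [Matrix.mul_apply, Matrix.sum_apply, Fintype.sum_prod_type, Matrix.star_apply]

theorem matPos_conjTranspose_mul_self_matrix {m : Type*} [Fintype m] [DecidableEq m] [DecidableEq ι]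
    (Z : Matrix κ ι (Matrix m m ℂ)) : MatPos (Zᴴ * Z) :=
  matPos_conjTranspose_mul_self (A := CStarMatrix m m ℂ) Z

/-- A unital ⋆-homomorphism is ucp. -/
theorem StarAlgHom.isUCP {A B : Type*} [Ring A] [StarRing A] [Algebra ℂ A] [Ring B]
    [StarRing B] [Algebra ℂ B] (π : A →⋆ₐ[ℂ] B) : IsUCP (π : A →ₗ[ℂ] B) where
  map_one := map_one π
  map_matPos r X hX := by
    obtain ⟨Y, rfl⟩ := hX
    refine ⟨Y.map π, ?_⟩
    ext i j
    simp [Matrix.mul_apply, map_star]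

end MatPos

/-! ### The universal property and polynomials of `U_nc(n)` -/

namespace FreeStarAlg

variable {n : ℕ} {D : Type*} [CStarAlgebra D]

/-- Evaluation of noncommutative ⋆-polynomials at a matrix `U` of elements of `D`. -/
def eval (U : Matrix (Fin n) (Fin n) D) : FreeStarAlg n →ₐ[ℂ] D :=
  MonoidAlgebra.lift ℂ D (FreeMonoid ((Fin n × Fin n) × Bool))
    (FreeMonoid.lift fun a => if a.2 then star (U a.1.1 a.1.2) else U a.1.1 a.1.2)

theorem eval_word_of (U : Matrix (Fin n) (Fin n) D) (a : (Fin n × Fin n) × Bool) :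
    eval U (word (FreeMonoid.of a)) = if a.2 then star (U a.1.1 a.1.2) else U a.1.1 a.1.2 := by
  exact (MonoidAlgebra.lift_of _ _).trans (FreeMonoid.lift_eval_of _ _)

theorem eval_gen (U : Matrix (Fin n) (Fin n) D) (i j : Fin n) : eval U (gen i j) = U i j := by
  rw [gen, eval_word_of]
  simp

theorem eval_star (U : Matrix (Fin n) (Fin n) D) (x : FreeStarAlg n) :
    eval U (star x) = star (eval U x) := by
  induction x using induction with
  | hword w =>
    induction w using FreeMonoid.inductionOn' with
    | one => simp [word_one]
    | of_mul a w ih =>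
      rw [word_mul, star_mul, map_mul, map_mul, star_mul, ih, star_word_of, eval_word_of,
        eval_word_of]
      obtain ⟨a, b⟩ := a
      cases b <;> simp [flipLetter]
  | hadd x y hx hy => rw [star_add, map_add, map_add, hx, hy, star_add]
  | hsmul c x hx => rw [star_smul, map_smul, map_smul, hx, star_smul]

/-- The C⋆-seminorm induced by evaluation at `U`. -/
def evalSeminorm (U : Matrix (Fin n) (Fin n) D) : Seminorm ℂ (FreeStarAlg n) :=
  (normSeminorm ℂ D).comp (eval U).toLinearMap

theorem evalSeminorm_apply (U : Matrix (Fin n) (Fin n) D) (x : FreeStarAlg n) :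
    evalSeminorm U x = ‖eval U x‖ := rfl

theorem norm_entry_le_one {U : Matrix (Fin n) (Fin n) D} (h : Uᴴ * U = 1) (i j : Fin n) :
    ‖U i j‖ ≤ 1 := by
  let _ := CStarAlgebra.spectralOrder D
  have := CStarAlgebra.spectralOrderedRing D
  have h1 : star (U i j) * U i j ≤ 1 := by
    have h2 := congrFun (congrFun h j) j
    rw [Matrix.one_apply_eq, Matrix.mul_apply] at h2
    rw [← h2]
    exact Finset.single_le_sum (f := fun k => Uᴴ j k * U k j)
      (fun k _ => star_mul_self_nonneg (U k j)) (Finset.mem_univ i)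
  have h3 := (CStarAlgebra.norm_le_one_iff_of_nonneg _ (star_mul_self_nonneg (U i j))).2 h1
  rw [CStarRing.norm_star_mul_self] at h3
  nlinarith [norm_nonneg (U i j)]

theorem isUnitarySeminorm_evalSeminorm {U : Matrix (Fin n) (Fin n) D} (h₁ : Uᴴ * U = 1)
    (h₂ : U * Uᴴ = 1) : IsUnitarySeminorm (evalSeminorm U) where
  mul_le x y := by
    simp only [evalSeminorm_apply, map_mul]
    exact norm_mul_le _ _
  star_mul_self x := by
    simp only [evalSeminorm_apply, map_mul, eval_star, CStarRing.norm_star_mul_self, sq]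
  star_mul_gen i j := by
    rw [evalSeminorm_apply, norm_eq_zero, map_sub, sub_eq_zero, map_sum]
    have h := congrFun (congrFun h₁ i) j
    rw [Matrix.mul_apply, Matrix.one_apply] at h
    simp only [map_mul, eval_star, eval_gen, apply_ite (eval U), map_one, map_zero]
    exact h
  gen_mul_star i j := by
    rw [evalSeminorm_apply, norm_eq_zero, map_sub, sub_eq_zero, map_sum]
    have h := congrFun (congrFun h₂ i) j
    rw [Matrix.mul_apply, Matrix.one_apply] at h
    simp only [map_mul, eval_star, eval_gen, apply_ite (eval U), map_one, map_zero]
    exact h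
  gen_le i j := by
    rw [evalSeminorm_apply, eval_gen]
    exact norm_entry_le_one h₁ i j

end FreeStarAlg

namespace Unc

open UniformSpace FreeStarAlg

variable {n : ℕ} {D : Type*} [CStarAlgebra D]

theorem sum_star_u_mul_u (i j : Fin n) :
    ∑ k, star (u k i) * u k j = if i = j then (1 : Unc n) else 0 := by
  have h : ‖(∑ k, star (gen k i) * gen k j - if i = j then 1 else 0 : FreeStarAlg n)‖ ≤ 0 :=
    FreeStarAlg.norm_le fun p hp => (hp.star_mul_gen i j).le
  rw [← norm_ofFree, norm_le_zero_iff, map_sub, sub_eq_zero, map_sum] at h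
  simpa only [map_mul, ← star_ofFree, apply_ite (ofFree (n := n)), map_one, map_zero, u] using h

theorem sum_u_mul_star_u (i j : Fin n) :
    ∑ k, u i k * star (u j k) = if i = j then (1 : Unc n) else 0 := by
  have h : ‖(∑ k, gen i k * star (gen j k) - if i = j then 1 else 0 : FreeStarAlg n)‖ ≤ 0 :=
    FreeStarAlg.norm_le fun p hp => (hp.gen_mul_star i j).le
  rw [← norm_ofFree, norm_le_zero_iff, map_sub, sub_eq_zero, map_sum] at h
  simpa only [map_mul, ← star_ofFree, apply_ite (ofFree (n := n)), map_one, map_zero, u] using h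

/-- The universal property of `U_nc(n)`. -/
theorem exists_starAlgHom (U : Matrix (Fin n) (Fin n) D) (h₁ : Uᴴ * U = 1) (h₂ : U * Uᴴ = 1) :
    ∃ π : Unc n →⋆ₐ[ℂ] D, ∀ i j, π (u i j) = U i j := by
  have hb : ∀ x, ‖eval U x‖ ≤ ‖x‖ := fun x =>
    le_norm (isUnitarySeminorm_evalSeminorm h₁ h₂) x
  have hc : Continuous (eval U) :=
    AddMonoidHomClass.continuous_of_bound (eval U) 1 (by simpa using hb)
  let f : Unc n →+* D := Completion.extensionHom (eval U : FreeStarAlg n →+* D) hc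
  have hf : ∀ a, f (ofFree a) = eval U a := fun a => Completion.extensionHom_coe _ hc a
  have hfc : Continuous f := Completion.continuous_extension
  let g : Unc n →ₐ[ℂ] D := AlgHom.mk' f fun c x => by
    induction x using induction with
    | hc => exact isClosed_eq (hfc.comp (continuous_const_smul c)) (hfc.const_smul c)
    | h a => rw [← ofFree_smul, hf, hf, map_smul]
  have hg : ∀ x, g x = f x := fun x => rfl
  refine ⟨{ g with map_star' := fun x => ?_ }, fun i j => ?_⟩
  · change f (star x) = star (f x)
    induction x using induction with
    | hc => exact isClosed_eq (hfc.comp continuous_star') (continuous_star.comp hfc)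
    | h a => rw [star_ofFree, hf, hf, eval_star]
  · change f (u i j) = U i j
    rw [u, hf, eval_gen]

/-- The character of `U_nc(n)` that sends `(u i j)` to the identity matrix. -/
theorem exists_character (n : ℕ) : Nonempty (Unc n →⋆ₐ[ℂ] ℂ) := by
  obtain ⟨π, -⟩ := exists_starAlgHom (D := ℂ) (1 : Matrix (Fin n) (Fin n) ℂ) (by simp) (by simp)
  exact ⟨π⟩

/-- The letter `u i j` or `(u i j)⋆` of `U_nc(n)`. -/
def letter (a : (Fin n × Fin n) × Bool) : Unc n := ofFree (word (FreeMonoid.of a))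

theorem letter_false (i j : Fin n) : letter ((i, j), false) = u i j := rfl

theorem letter_true (i j : Fin n) : letter ((i, j), true) = star (u i j) := by
  rw [letter, u, star_ofFree, gen, star_word_of]
  rfl

/-- The image in `U_nc(n)` of the noncommutative ⋆-polynomials of degree at most `d`. -/
def polys (n d : ℕ) : Submodule ℂ (Unc n) :=
  Submodule.span ℂ ((fun w => ofFree (word w)) ''
    {w : FreeMonoid ((Fin n × Fin n) × Bool) | w.length ≤ d})

theorem one_mem_polys (d : ℕ) : (1 : Unc n) ∈ polys n d :=
  Submodule.subset_span ⟨1, by simp, by simp [word_one]⟩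

theorem polys_mono {d e : ℕ} (h : d ≤ e) : polys n d ≤ polys n e :=
  Submodule.span_mono (Set.image_mono fun _ hw => le_trans hw h)

theorem letter_mul_mem_polys {d : ℕ} {y : Unc n} (hy : y ∈ polys n d)
    (a : (Fin n × Fin n) × Bool) : letter a * y ∈ polys n (d + 1) := by
  induction hy using Submodule.span_induction with
  | mem x hx =>
    obtain ⟨w, hw, rfl⟩ := hx
    refine Submodule.subset_span ⟨FreeMonoid.of a * w, ?_, by simp [word_mul, letter]⟩
    have : w.length ≤ d := hw
    change (FreeMonoid.of a * w).length ≤ d + 1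
    rw [FreeMonoid.length_mul, FreeMonoid.length_of]
    omega
  | zero => simp
  | add x y _ _ hx hy => rw [mul_add]; exact add_mem hx hy
  | smul c x _ hx => rw [mul_smul_comm]; exact Submodule.smul_mem _ c hx

theorem u_mul_mem_polys {d : ℕ} {y : Unc n} (hy : y ∈ polys n d) (i j : Fin n) :
    u i j * y ∈ polys n (d + 1) := letter_mul_mem_polys hy ((i, j), false)

theorem star_u_mul_mem_polys {d : ℕ} {y : Unc n} (hy : y ∈ polys n d) (i j : Fin n) :
    star (u i j) * y ∈ polys n (d + 1) := by
  rw [← letter_true]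
  exact letter_mul_mem_polys hy ((i, j), true)

instance (d : ℕ) : FiniteDimensional ℂ (polys n d) :=
  FiniteDimensional.span_of_finite ℂ ((List.finite_length_le _ d).image _)

/-- Induction on polynomials of degree at most `d` by left multiplication with letters. -/
theorem polys_induction {d : ℕ} {motive : Unc n → Prop}
    (hadd : ∀ x y, motive x → motive y → motive (x + y)) (hsmul : ∀ (c : ℂ) x, motive x →
      motive (c • x)) (hone : motive 1)
    (hletter : ∀ e < d, ∀ y ∈ polys n e, motive y → ∀ a, motive (letter a * y))
    {x : Unc n} (hx : x ∈ polys n d) : motive x := by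
  have key : ∀ w : FreeMonoid ((Fin n × Fin n) × Bool), w.length ≤ d →
      motive (ofFree (word w)) := by
    intro w
    induction w using FreeMonoid.inductionOn' with
    | one => intro _; simpa [word_one] using hone
    | of_mul a w ih =>
      intro h
      rw [FreeMonoid.length_mul, FreeMonoid.length_of] at h
      rw [word_mul, map_mul]
      exact hletter w.length (by omega) _ (Submodule.subset_span ⟨w, le_refl w.length, rfl⟩)
        (ih (by omega)) a
  induction hx using Submodule.span_induction with
  | mem x hx =>
    obtain ⟨w, hw, rfl⟩ := hx
    exact key w hw
  | zero => simpa using hsmul 0 1 hone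
  | add x y _ _ hx hy => exact hadd _ _ hx hy
  | smul c x _ hx => exact hsmul c x hx

theorem ofFree_mem_polys (x : FreeStarAlg n) : ∃ d, ofFree x ∈ polys n d := by
  induction x using FreeStarAlg.induction with
  | hword w => exact ⟨w.length, Submodule.subset_span ⟨w, le_refl w.length, rfl⟩⟩
  | hadd x y hx hy =>
    obtain ⟨d, hd⟩ := hx
    obtain ⟨e, he⟩ := hy
    exact ⟨max d e, by
      rw [map_add]
      exact add_mem (polys_mono (le_max_left _ _) hd) (polys_mono (le_max_right _ _) he)⟩
  | hsmul c x hx =>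
    obtain ⟨d, hd⟩ := hx
    exact ⟨d, by rw [ofFree_smul]; exact Submodule.smul_mem _ c hd⟩

theorem star_mem_polys {d : ℕ} {x : Unc n} (hx : x ∈ polys n d) :
    ∃ e, star x ∈ polys n e := by
  have h : ∃ a, ofFree a = x := by
    induction hx using Submodule.span_induction with
    | mem x hx => obtain ⟨w, _, rfl⟩ := hx; exact ⟨_, rfl⟩
    | zero => exact ⟨0, map_zero _⟩
    | add x y _ _ hx hy =>
      obtain ⟨a, rfl⟩ := hx
      obtain ⟨b, rfl⟩ := hy
      exact ⟨a + b, map_add _ _ _⟩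
    | smul c x _ hx => obtain ⟨a, rfl⟩ := hx; exact ⟨c • a, ofFree_smul c a⟩
  obtain ⟨a, rfl⟩ := h
  rw [star_ofFree]
  exact ofFree_mem_polys _

theorem exists_polys_norm_sub_lt (x : Unc n) {ε : ℝ} (hε : 0 < ε) :
    ∃ d, ∃ y ∈ polys n d, ‖x - y‖ < ε := by
  obtain ⟨a, ha⟩ := (Completion.denseRange_coe (α := FreeStarAlg n)).exists_dist_lt x hε
  obtain ⟨d, hd⟩ := ofFree_mem_polys a
  exact ⟨d, _, hd, by rw [← dist_eq_norm]; exact ha⟩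

/-- Finitely many elements are approximated by polynomials of a common degree. -/
theorem exists_polys_forall_norm_sub_lt {κ : Type*} [Finite κ] (x : κ → Unc n) {ε : ℝ}
    (hε : 0 < ε) : ∃ d, ∀ k, ∃ y ∈ polys n d, ‖x k - y‖ < ε := by
  have := Fintype.ofFinite κ
  choose d y hy hxy using fun k => exists_polys_norm_sub_lt (x k) hε
  exact ⟨Finset.univ.sup d, fun k =>
    ⟨y k, polys_mono (Finset.le_sup (Finset.mem_univ k)) (hy k), hxy k⟩⟩

end Unc

/-! ### States and separation from cones -/

section States

variable {A : Type*} [CStarAlgebra A]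

/-- A positive linear functional on a C⋆-algebra: it is nonnegative on hermitian squares. -/
structure IsPositiveFunctional (τ : A →ₗ[ℂ] ℂ) : Prop where
  nonneg : ∀ x, 0 ≤ τ (star x * x)

/-- Hahn-Banach separation of a self-adjoint element from a convex cone of self-adjoint elements,
by a functional that respects adjoints. -/
theorem exists_hermitian_functional_neg {K : Set A} (h0 : (0 : A) ∈ K)
    (hadd : ∀ x ∈ K, ∀ y ∈ K, x + y ∈ K) (hsmul : ∀ c : ℝ, 0 ≤ c → ∀ x ∈ K, (c : ℂ) • x ∈ K)
    (hstar : ∀ x ∈ K, star x = x) {x₀ : A} (hx₀ : star x₀ = x₀) (hK : x₀ ∉ closure K) :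
    ∃ τ : A →ₗ[ℂ] ℂ, Continuous τ ∧ (∀ a, τ (star a) = star (τ a)) ∧ (∀ x ∈ K, 0 ≤ τ x) ∧
      τ x₀ < 0 := by
  let C₀ : PointedCone ℝ A :=
    { carrier := K
      add_mem' := fun {a b} ha hb => hadd a ha b hb
      zero_mem' := h0
      smul_mem' := fun c a ha => hsmul c c.2 a ha }
  let C : ProperCone ℝ A := Submodule.closure C₀
  have hnot : x₀ ∉ C := hK
  obtain ⟨f, hf, hfx⟩ := C.hyperplane_separation_point hnot
  -- the hermitian part of the separating real functional, complexified
  let g : StrongDual ℝ A := (2⁻¹ : ℝ) • (f + f ∘L (starL' ℝ : A ≃L[ℝ] A))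
  have hg : ∀ a, g a = 2⁻¹ * (f a + f (star a)) := fun a => rfl
  let τ : StrongDual ℂ A := g.extendRCLike
  have hτ : ∀ a, τ a = (g a : ℂ) - Complex.I * (g (Complex.I • a) : ℂ) := fun a =>
    StrongDual.extendRCLike_apply g a
  have hI : ∀ a : A, star (Complex.I • a) = -(Complex.I • star a) := fun a => by
    rw [star_smul, Complex.star_def, Complex.conj_I, neg_smul]
  have hsa : ∀ a, star a = a → τ a = (f a : ℂ) := fun a ha => by
    rw [hτ, hg, hg, hI, ha, map_neg]
    push_cast
    ring
  refine ⟨τ.toLinearMap, τ.continuous, fun a => ?_, fun a ha => ?_, ?_⟩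
  · change τ (star a) = star (τ a)
    rw [hτ, hτ, hg, hg, hg, hg, star_star, hI, star_smul, star_star, Complex.star_def,
      Complex.conj_I, neg_smul]
    simp only [map_neg, map_sub, map_mul, Complex.conj_ofReal, Complex.conj_I]
    push_cast
    ring
  · change 0 ≤ τ a
    rw [hsa a (hstar a ha)]
    exact_mod_cast hf a (subset_closure ha)
  · change τ x₀ < 0
    rw [hsa x₀ hx₀]
    exact_mod_cast hfx

/-- Positive functionals separate points: separate `-x⋆x` from the closed cone of positive elements.
-/
theorem exists_positiveFunctional_pos {x : A} (hx : x ≠ 0) :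
    ∃ τ : A →ₗ[ℂ] ℂ, Continuous τ ∧ (∀ a, τ (star a) = star (τ a)) ∧ IsPositiveFunctional τ ∧
      0 < τ (star x * x) := by
  let _ := CStarAlgebra.spectralOrder A
  have := CStarAlgebra.spectralOrderedRing A
  have hnot : -(star x * x) ∉ closure {a : A | 0 ≤ a} := by
    rw [CStarAlgebra.isClosed_nonneg.closure_eq]
    intro (h : 0 ≤ -(star x * x))
    have h0 : star x * x = 0 := le_antisymm (by simpa using h) (star_mul_self_nonneg x)
    exact hx ((CStarRing.star_mul_self_eq_zero_iff x).1 h0)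
  obtain ⟨τ, hc, hs, hp, hneg⟩ := exists_hermitian_functional_neg (K := {a : A | 0 ≤ a})
    (le_refl (0 : A)) (fun a ha b hb => add_nonneg (a := a) (b := b) ha hb)
    (fun c hc a (ha : 0 ≤ a) => by
      change 0 ≤ (c : ℂ) • a
      rw [Complex.coe_smul]
      exact smul_nonneg hc ha)
    (fun a ha => (IsSelfAdjoint.of_nonneg (x := a) ha).star_eq) (by simp) hnot
  refine ⟨τ, hc, hs, ⟨fun a => hp _ (star_mul_self_nonneg a)⟩, ?_⟩
  rwa [map_neg, neg_lt_zero] at hneg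

/-- On a finite-dimensional subspace some state is faithful, by compactness of the unit sphere. -/
theorem exists_state_posOn [Nontrivial A] (E : Submodule ℂ A) [FiniteDimensional ℂ E] :
    ∃ τ : A →ₗ[ℂ] ℂ, (∀ a, τ (star a) = star (τ a)) ∧ IsPositiveFunctional τ ∧ τ 1 = 1 ∧
      Continuous τ ∧ ∀ x ∈ E, x ≠ 0 → 0 < τ (star x * x) := by
  classical
  choose! τ hc hs hp hx using fun x : A => exists_positiveFunctional_pos (x := x)
  let K : Set A := Subtype.val '' Metric.sphere (0 : E) 1
  have hK : IsCompact K := (isCompact_sphere _ _).image continuous_subtype_val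
  have hK0 : ∀ x ∈ K, x ≠ 0 := by
    rintro _ ⟨x, hx, rfl⟩ h
    have : x = 0 := Subtype.ext h
    simp [this] at hx
  obtain ⟨t, htK⟩ := hK.elim_nhds_subcover' (fun x _ => {y | τ x (star y * y) ≠ 0})
    fun x hxK => IsOpen.mem_nhds
      (isOpen_ne_fun ((hc x (hK0 x hxK)).comp (by fun_prop)) continuous_const)
      (hx x (hK0 x hxK)).ne'
  -- the summand `τ 1` makes `σ 1` positive even if the sphere of `E` is empty
  let σ : A →ₗ[ℂ] ℂ := τ 1 + ∑ x ∈ t, τ x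
  have hσ : ∀ a, σ a = τ 1 a + ∑ x ∈ t, τ x a := fun a => by simp [σ]
  have hσs : ∀ a, σ (star a) = star (σ a) := fun a => by
    rw [hσ, hσ, star_add, star_sum, hs 1 one_ne_zero]
    congr 1
    exact Finset.sum_congr rfl fun x _ => hs _ (hK0 _ x.2) a
  have hsum : ∀ a, 0 ≤ ∑ x ∈ t, τ x (star a * a) := fun a =>
    Finset.sum_nonneg fun x _ => (hp _ (hK0 _ x.2)).nonneg a
  have hσ1 : 0 < σ 1 := by
    rw [hσ]
    have h1 := hx 1 one_ne_zero
    have h2 := hsum 1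
    simp only [star_one, mul_one] at h1 h2
    exact add_pos_of_pos_of_nonneg h1 h2
  have hσc : Continuous σ := by
    have : (σ : A → ℂ) = fun a => τ 1 a + ∑ x ∈ t, τ x a := funext hσ
    rw [this]
    exact (hc 1 one_ne_zero).add (continuous_finsetSum _ fun x _ => hc _ (hK0 _ x.2))
  have hinv : 0 < (σ 1)⁻¹ := inv_pos_of_pos hσ1
  have hσn : ∀ a, 0 ≤ σ (star a * a) := fun a => by
    rw [hσ]; exact add_nonneg ((hp 1 one_ne_zero).nonneg a) (hsum a)
  have hσp : ∀ x ∈ K, σ (star x * x) ≠ 0 := fun x hxK h0 => by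
    obtain ⟨y, hy, hxy⟩ := Set.mem_iUnion₂.1 (htK hxK)
    rw [hσ, add_eq_zero_iff_of_nonneg ((hp 1 one_ne_zero).nonneg x) (hsum x)] at h0
    exact hxy ((Finset.sum_eq_zero_iff_of_nonneg
      fun z _ => (hp _ (hK0 _ z.2)).nonneg x).1 h0.2 y hy)
  refine ⟨(σ 1)⁻¹ • σ, fun a => ?_, ⟨fun a => ?_⟩, ?_, ?_, fun x hxE hx0 => ?_⟩
  · simp only [LinearMap.smul_apply, smul_eq_mul, hσs, star_mul']
    congr 1
    rw [star_inv₀, ← hσs, star_one]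
  · exact mul_nonneg hinv.le (hσn a)
  · simp [hσ1.ne']
  · exact hσc.const_smul _
  · refine mul_pos hinv (lt_of_le_of_ne (hσn x) (Ne.symm fun h0 => ?_))
    have hxn : (‖x‖ : ℂ) ≠ 0 := by exact_mod_cast norm_ne_zero_iff.2 hx0
    refine hσp ((‖x‖ : ℂ)⁻¹ • x) ⟨⟨(‖x‖ : ℂ)⁻¹ • x, E.smul_mem _ hxE⟩, ?_, rfl⟩ ?_
    · rw [mem_sphere_zero_iff_norm]
      change ‖(‖x‖ : ℂ)⁻¹ • x‖ = 1
      rw [norm_smul, norm_inv, Complex.norm_real, norm_norm,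
        inv_mul_cancel₀ (norm_ne_zero_iff.2 hx0)]
    · rw [star_smul, smul_mul_smul_comm, map_smul, h0, smul_zero]

variable {ι κ : Type*} [Fintype ι] [Fintype κ]

/-- The quadratic form of a Gram matrix is the functional on hermitian squares of linear
combinations. -/
theorem gram_quadratic (τ : A →ₗ[ℂ] ℂ) (v : ι → A) (z : ι → ℂ) :
    star z ⬝ᵥ ((Matrix.of fun i j => τ (star (v i) * v j)) *ᵥ z) =
      τ (star (∑ i, z i • v i) * ∑ i, z i • v i) := by
  simp only [dotProduct, Matrix.mulVec, star_sum, Finset.sum_mul, Finset.mul_sum, map_sum,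
    Matrix.of_apply, star_smul, smul_mul_smul_comm, map_smul, smul_eq_mul, Pi.star_apply]
  rw [Finset.sum_comm]
  refine Finset.sum_congr rfl fun i _ => Finset.sum_congr rfl fun j _ => ?_
  ring

theorem gram_posSemidef {τ : A →ₗ[ℂ] ℂ} (hs : ∀ a, τ (star a) = star (τ a))
    (hp : IsPositiveFunctional τ) (v : ι → A) :
    (Matrix.of fun i j => τ (star (v i) * v j)).PosSemidef := by
  refine Matrix.PosSemidef.of_dotProduct_mulVec_nonneg ?_ fun z => ?_
  · ext i j
    simp [← hs]
  · rw [gram_quadratic]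
    exact hp.nonneg _

theorem gram_posDef {τ : A →ₗ[ℂ] ℂ} (hs : ∀ a, τ (star a) = star (τ a))
    {E : Submodule ℂ A} (hE : ∀ x ∈ E, x ≠ 0 → 0 < τ (star x * x)) {v : ι → A}
    (hv : ∀ i, v i ∈ E) (hli : LinearIndependent ℂ v) :
    (Matrix.of fun i j => τ (star (v i) * v j)).PosDef := by
  refine Matrix.posDef_iff_dotProduct_mulVec.2 ⟨?_, fun z hz => ?_⟩
  · ext i j
    simp [← hs]
  · rw [gram_quadratic]
    refine hE _ (sum_mem fun i _ => E.smul_mem _ (hv i)) fun h => hz ?_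
    exact funext (Fintype.linearIndependent_iff.1 hli z h)

/-- A positive definite scalar matrix dominates a positive multiple of the identity. -/
theorem Matrix.PosDef.exists_smul_one_le [DecidableEq ι] {G : Matrix ι ι ℂ} (hG : G.PosDef) :
    ∃ δ : ℝ, 0 < δ ∧ (G - (δ : ℂ) • (1 : Matrix ι ι ℂ)).PosSemidef := by
  rcases isEmpty_or_nonempty ι with h | h
  · exact ⟨1, one_pos, by rw [Subsingleton.elim (G - _) 0]; exact Matrix.PosSemidef.zero⟩
  obtain ⟨i₀, hi₀⟩ := Finite.exists_min hG.isHermitian.eigenvalues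
  refine ⟨hG.isHermitian.eigenvalues i₀, hG.eigenvalues_pos i₀, ?_⟩
  have hspec := hG.isHermitian.spectral_theorem
  set U := hG.isHermitian.eigenvectorUnitary
  have : G - ((hG.isHermitian.eigenvalues i₀ : ℝ) : ℂ) • (1 : Matrix ι ι ℂ) =
      (U : Matrix ι ι ℂ) * Matrix.diagonal (fun i => ((hG.isHermitian.eigenvalues i -
        hG.isHermitian.eigenvalues i₀ : ℝ) : ℂ)) * (U : Matrix ι ι ℂ)ᴴ := by
    have hd : Matrix.diagonal (fun i => ((hG.isHermitian.eigenvalues i -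
        hG.isHermitian.eigenvalues i₀ : ℝ) : ℂ)) = Matrix.diagonal (fun i =>
        ((hG.isHermitian.eigenvalues i : ℝ) : ℂ)) -
        ((hG.isHermitian.eigenvalues i₀ : ℝ) : ℂ) • (1 : Matrix ι ι ℂ) := by
      ext i j
      by_cases hij : i = j <;> simp [hij]
    have hU : (U : Matrix ι ι ℂ) * (U : Matrix ι ι ℂ)ᴴ = 1 := Unitary.coe_mul_star_self U
    rw [hd, Matrix.mul_sub, Matrix.sub_mul, Matrix.mul_smul, Matrix.mul_one, Matrix.smul_mul, hU]
    congr 1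
  rw [this]
  refine Matrix.PosSemidef.mul_mul_conjTranspose_same
    (Matrix.posSemidef_diagonal_iff.2 fun i => ?_) _
  exact_mod_cast sub_nonneg.2 (hi₀ i)

end States

/-! ### Lifting self-adjoint contractions to unitaries -/

section Lifting

variable {B C : Type*} [CStarAlgebra B] [CStarAlgebra C]

/-- Truncation of a real number to the interval `[-1, 1]`. -/
def clamp (t : ℝ) : ℝ := max (-1) (min 1 t)

theorem continuous_clamp : Continuous clamp := by unfold clamp; fun_prop

theorem clamp_mul_self_le (t : ℝ) : clamp t * clamp t ≤ 1 := by
  have h1 : -1 ≤ clamp t := le_max_left _ _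
  have h2 : clamp t ≤ 1 := max_le (by norm_num) (min_le_left _ _)
  nlinarith

theorem clamp_of_mem {t : ℝ} (h₁ : -1 ≤ t) (h₂ : t ≤ 1) : clamp t = t := by
  rw [clamp, min_eq_right h₂, max_eq_right h₁]

theorem exists_selfAdjoint_lift {q : B →⋆ₐ[ℂ] C} (hq : Function.Surjective q) {c : C}
    (hc : star c = c) : ∃ b : B, star b = b ∧ q b = c := by
  obtain ⟨b, hb⟩ := hq c
  refine ⟨(2⁻¹ : ℂ) • (b + star b), ?_, ?_⟩
  · rw [star_smul, star_add, star_star, add_comm (star b)]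
    simp
  · rw [map_smul, map_add, map_star, hb, hc, ← two_smul ℂ c, smul_smul]
    norm_num

theorem StarAlgHom.continuous (q : B →⋆ₐ[ℂ] C) : Continuous q :=
  AddMonoidHomClass.continuous_of_bound q 1 fun x => by
    simpa using NonUnitalStarAlgHom.norm_apply_le q x

/-- A self-adjoint contraction `S` of a quotient has a unitary dilation `S + i √(1 - S²)` that
lifts to a unitary. -/
theorem exists_unitary_lift [PartialOrder C] [StarOrderedRing C] {q : B →⋆ₐ[ℂ] C}
    (hq : Function.Surjective q) {S : C} (hS : star S = S) (h₁ : -1 ≤ S) (h₂ : S ≤ 1) :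
    ∃ Z : B, star Z * Z = 1 ∧ Z * star Z = 1 ∧
      ∃ T : C, star T = T ∧ T * T = 1 - S * S ∧ q Z = S + Complex.I • T := by
  obtain ⟨b, hb, hqb⟩ := exists_selfAdjoint_lift hq hS
  have hbsa : IsSelfAdjoint b := hb
  have hSsa : IsSelfAdjoint S := hS
  have hcl : ContinuousOn clamp (spectrum ℝ b) := continuous_clamp.continuousOn
  have hct : Continuous fun t => √(1 - clamp t * clamp t) := by
    have := continuous_clamp
    fun_prop
  have hqS : q (cfc clamp b) = S := by
    rw [StarAlgHom.map_cfc q clamp b hcl (StarAlgHom.continuous q) hbsa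
      (by rw [hqb]; exact hSsa), hqb]
    refine (cfc_congr fun t ht => ?_).trans (cfc_id ℝ S hSsa)
    refine clamp_of_mem ?_ ?_
    · have := (algebraMap_le_iff_le_spectrum (r := (-1 : ℝ)) (a := S) hSsa).1 (by simpa using h₁)
      exact this t ht
    · have := (le_algebraMap_iff_spectrum_le (r := (1 : ℝ)) (a := S) hSsa).1 (by simpa using h₂)
      exact this t ht
  -- `b` need not be a contraction; clamping its spectrum does not change its image under `q`
  set S' := cfc clamp b with hS'
  set T' := cfc (fun t => √(1 - clamp t * clamp t)) b with hT'
  have hS's : star S' = S' := (cfc_predicate clamp b : IsSelfAdjoint S')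
  have hT's : star T' = T' := (cfc_predicate _ b : IsSelfAdjoint T')
  have hcomm : S' * T' = T' * S' := cfc_commute_cfc _ _ b
  have hsq : S' * S' + T' * T' = 1 := by
    rw [hS', hT', ← cfc_mul clamp clamp b hcl hcl,
      ← cfc_mul _ _ b hct.continuousOn hct.continuousOn,
      ← cfc_add b (fun t => clamp t * clamp t) (fun t => √(1 - clamp t * clamp t) *
        √(1 - clamp t * clamp t)) (hcl.mul hcl) (hct.mul hct).continuousOn]
    refine (cfc_congr fun t _ => ?_).trans (cfc_one ℝ b)
    rw [Real.mul_self_sqrt (sub_nonneg.2 (clamp_mul_self_le t))]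
    simp
  have hTT : T' * T' = 1 - S' * S' := eq_sub_of_add_eq' hsq
  have hI : star (S' + Complex.I • T') = S' - Complex.I • T' := by
    rw [star_add, star_smul, hS's, hT's, Complex.star_def, Complex.conj_I, neg_smul, sub_eq_add_neg]
  refine ⟨S' + Complex.I • T', ?_, ?_, q T', ?_, ?_, ?_⟩
  · rw [hI, sub_mul, mul_add, mul_add, smul_mul_assoc, smul_mul_assoc, mul_smul_comm,
      mul_smul_comm, smul_smul, Complex.I_mul_I, hTT, hcomm]
    module
  · rw [hI, mul_sub, add_mul, add_mul, smul_mul_assoc, smul_mul_assoc, mul_smul_comm,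
      mul_smul_comm, smul_smul, Complex.I_mul_I, hTT, hcomm]
    module
  · rw [← map_star, hT's]
  · rw [← map_mul, hTT, map_sub, map_one, map_mul, hqS]
  · rw [map_add, map_smul, hqS]

/-- An inverse square root `r` of `g`. -/
theorem exists_inverse_sqrt [PartialOrder C] [StarOrderedRing C] {g : C} (hg : 0 ≤ g)
    (hu : IsUnit g) : ∃ r : C, star r = r ∧ r * g * r = 1 ∧ r * r * g = 1 := by
  have h := CFC.conjugate_rpow_neg_one_half g ⟨hg, hu⟩
  set r := g ^ (-(1 / 2) : ℝ)
  have hr : star r = r := (IsSelfAdjoint.of_nonneg (CFC.rpow_nonneg : 0 ≤ r))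
  refine ⟨r, hr, h, ?_⟩
  have h1 : r * (g * r) = 1 := by rw [← mul_assoc]; exact h
  have h2 : r * g = g * r := by
    calc r * g = r * g * (r * (g * r)) := by rw [h1, mul_one]
      _ = (r * g * r) * (g * r) := by simp only [mul_assoc]
      _ = g * r := by rw [h, one_mul]
  rw [mul_assoc, h2, h1]

/-- Applying a ⋆-homomorphism entrywise to square matrices. -/
def StarAlgHom.mapCStarMatrix {κ : Type*} [Fintype κ] [DecidableEq κ] (q : B →⋆ₐ[ℂ] C) :
    CStarMatrix κ κ B →⋆ₐ[ℂ] CStarMatrix κ κ C where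
  toFun X := CStarMatrix.ofMatrix ((CStarMatrix.ofMatrix.symm X).map q)
  map_one' := by
    refine congrArg CStarMatrix.ofMatrix (Matrix.map_one q ?_ ?_) <;> simp
  map_mul' X Y := congrArg CStarMatrix.ofMatrix
    (Matrix.map_mul (f := (q : B →+* C)) (L := CStarMatrix.ofMatrix.symm X)
      (M := CStarMatrix.ofMatrix.symm Y))
  map_zero' := by
    refine congrArg CStarMatrix.ofMatrix (Matrix.map_zero q ?_)
    simp
  map_add' X Y := congrArg CStarMatrix.ofMatrix (Matrix.map_add q (map_add q) _ _)
  commutes' c := by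
    ext i j
    simp only [CStarMatrix.ofMatrix_apply, Matrix.map_apply]
    change q ((algebraMap ℂ (CStarMatrix κ κ B) c) i j) = _
    rw [CStarMatrix.algebraMap_apply, CStarMatrix.algebraMap_apply]
    split_ifs
    · exact AlgHomClass.commutes q c
    · simp
  map_star' X := by
    ext i j
    exact map_star q _

end Lifting

section Vectors

variable {C : Type*} [CStarAlgebra C] {κ : Type*} [Fintype κ]

theorem eq_zero_of_dotProduct_star_self {x : κ → C} (h : star x ⬝ᵥ x = 0) : x = 0 := by
  let _ := CStarAlgebra.spectralOrder C
  have := CStarAlgebra.spectralOrderedRing C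
  funext i
  have h1 := (Finset.sum_eq_zero_iff_of_nonneg
    fun i _ => star_mul_self_nonneg (x i)).1 h i (Finset.mem_univ i)
  exact (CStarRing.star_mul_self_eq_zero_iff _).1 h1

theorem star_mulVec_dotProduct {κ' : Type*} [Fintype κ'] (M : Matrix κ κ' C) (x : κ' → C)
    (y : κ → C) : star (M *ᵥ x) ⬝ᵥ y = star x ⬝ᵥ (Mᴴ *ᵥ y) := by
  simp only [dotProduct, Matrix.mulVec, Pi.star_apply, star_sum, Finset.sum_mul, Finset.mul_sum,
    star_mul, Matrix.conjTranspose_apply]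
  rw [Finset.sum_comm]
  simp only [mul_assoc]

/-- The defect operator of a contraction kills the vectors on which the contraction is
isometric. -/
theorem mulVec_defect_eq_zero {S T : Matrix κ κ C} [DecidableEq κ] (hS : Sᴴ = S) (hT : Tᴴ = T)
    (h : T * T = 1 - S * S) {x : κ → C} (hx : star (S *ᵥ x) ⬝ᵥ (S *ᵥ x) = star x ⬝ᵥ x) :
    T *ᵥ x = 0 := by
  apply eq_zero_of_dotProduct_star_self
  rw [star_mulVec_dotProduct, hT, Matrix.mulVec_mulVec, h, Matrix.sub_mulVec, Matrix.one_mulVec,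
    dotProduct_sub, ← hx, star_mulVec_dotProduct, hS, Matrix.mulVec_mulVec, sub_self]

end Vectors

/-! ### Compressions to the module of a Gram matrix -/

/-- The self-adjoint unitary `[[0, u], [u⋆, 0]]` over `U_nc(n)`. -/
def Unc.flipU (n : ℕ) : Matrix (Bool × Fin n) (Bool × Fin n) (Unc n) :=
  Matrix.of fun x y => if x.1 then (if y.1 then 0 else star (Unc.u y.2 x.2))
    else (if y.1 then Unc.u x.2 y.2 else 0)

theorem Unc.flipU_conjTranspose (n : ℕ) : (Unc.flipU n)ᴴ = Unc.flipU n := by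
  ext ⟨a, i⟩ ⟨b, j⟩
  cases a <;> cases b <;> simp [Unc.flipU]

theorem Unc.flipU_mul_self (n : ℕ) : Unc.flipU n * Unc.flipU n = 1 := by
  ext ⟨a, i⟩ ⟨b, j⟩
  rw [Matrix.mul_apply, Fintype.sum_prod_type]
  cases a <;> cases b <;>
    simp [Unc.flipU, Matrix.one_apply, Unc.sum_u_mul_star_u, Unc.sum_star_u_mul_u]

theorem Unc.flipU_mul_mem_polys {n d : ℕ} {y : Unc n} (hy : y ∈ Unc.polys n d)
    (p q : Bool × Fin n) : Unc.flipU n p q * y ∈ Unc.polys n (d + 1) := by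
  obtain ⟨a, i⟩ := p
  obtain ⟨b, j⟩ := q
  cases a <;> cases b <;>
    simp [Unc.flipU, Unc.u_mul_mem_polys hy, Unc.star_u_mul_mem_polys hy]

section GramCoordinates

variable {A C : Type*} [CStarAlgebra A] [CStarAlgebra C] {ι σ : Type*} [Fintype ι] [Fintype σ]

/-- The coordinates of `y` in the module spanned by the vectors `v i` with the `C`-valued inner
product `⟨x, y⟩ = L (x⋆ y)`, with respect to the orthonormal frame given by an inverse square
root `R` of the Gram matrix. -/
def gramCoord (L : A →ₗ[ℂ] C) (v : ι → A) (R : Matrix ι ι C) (y : A) : ι → C :=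
  R *ᵥ fun i => L (star (v i) * y)

/-- The compression of the matrix `w` over `A`, acting by left multiplication, to the module
spanned by the `v i`. -/
def gramCompress (L : A →ₗ[ℂ] C) (v : ι → A) (R : Matrix ι ι C) (w : Matrix σ σ A) :
    Matrix (σ × ι) (σ × ι) C :=
  Matrix.of fun p q =>
    (R * (Matrix.of fun i j => L (star (v i) * w p.1 q.1 * v j)) * R) p.2 q.2

/-- A vector `f` placed in the slot `x` of a direct sum. -/
def slot [DecidableEq σ] (x : σ) (f : ι → C) : σ × ι → C := fun p => if p.1 = x then f p.2 else 0

theorem star_slot_dotProduct [DecidableEq σ] (x : σ) (f g : ι → C) :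
    star (slot x f) ⬝ᵥ slot x g = star f ⬝ᵥ g := by
  simp only [dotProduct, slot, Pi.star_apply, Fintype.sum_prod_type]
  rw [Finset.sum_eq_single x (fun z _ hz => by simp [hz]) (by simp)]
  simp

variable {L : A →ₗ[ℂ] C} {v : ι → A} {R : Matrix ι ι C}

theorem gramCoord_add (y z : A) :
    gramCoord L v R (y + z) = gramCoord L v R y + gramCoord L v R z := by
  simp only [gramCoord, mul_add, map_add]
  exact Matrix.mulVec_add R _ _

theorem gramCoord_zero : gramCoord L v R 0 = 0 := by
  have h := gramCoord_add (L := L) (v := v) (R := R) 0 0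
  simpa using h

theorem gramCoord_smul (c : ℂ) (y : A) : gramCoord L v R (c • y) = c • gramCoord L v R y := by
  simp only [gramCoord, mul_smul_comm, map_smul]
  exact Matrix.mulVec_smul R c fun i => L (star (v i) * y)

omit [Fintype σ] in
/-- If `R'` inverts the matrix with columns `f (v j)`, then `M R'` takes `f y` to `g y` on the span
of the `v j` as soon as `M` has the columns `g (v j)`. The entries of `f y` lie in the
noncommutative ring `C`, but linearity over `ℂ` suffices. -/
theorem mulVec_span {G : Matrix ι ι C} (R' : Matrix ι ι C) [DecidableEq ι]
    (hG : R' * G = 1) (f : A →ₗ[ℂ] (ι → C)) (hf : ∀ j, f (v j) = fun i => G i j) {y : A}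
    {M : Matrix σ ι C} (g : A →ₗ[ℂ] (σ → C)) (hg : ∀ j, g (v j) = fun i => M i j)
    (hy : y ∈ Submodule.span ℂ (Set.range v)) : M *ᵥ (R' *ᵥ f y) = g y := by
  induction hy using Submodule.span_induction with
  | mem x hx =>
    obtain ⟨j, rfl⟩ := hx
    have h1 : (fun i => G i j) = G *ᵥ Pi.single j 1 := by ext i; simp
    have h2 : R' *ᵥ (G *ᵥ Pi.single j 1) = Pi.single j 1 := by
      rw [Matrix.mulVec_mulVec, hG, Matrix.one_mulVec]
    rw [hf, hg, h1, h2]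
    ext i
    simp
  | zero => simp
  | add x y _ _ hx hy => rw [map_add, map_add, Matrix.mulVec_add, Matrix.mulVec_add, hx, hy]
  | smul c x _ hx => rw [map_smul, map_smul, Matrix.mulVec_smul, Matrix.mulVec_smul, hx]

variable (hL : ∀ a, L (star a) = star (L a)) (hR : Rᴴ = R)

/-- The linear map `y ↦ (L (a i * y))_i`. -/
def leftPairing (L : A →ₗ[ℂ] C) (a : σ → A) : A →ₗ[ℂ] (σ → C) :=
  LinearMap.pi fun i => L ∘ₗ LinearMap.mulLeft ℂ (a i)

omit [Fintype σ] in
/-- The pairing of `y` with any `a i` is recovered from the coordinates of `y`. -/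
theorem mulVec_leftPairing [DecidableEq ι]
    (hRG : R * R * (Matrix.of fun i j => L (star (v i) * v j)) = 1) (a : σ → A) {y : A}
    (hy : y ∈ Submodule.span ℂ (Set.range v)) :
    (Matrix.of fun i j => L (a i * v j)) *ᵥ (R *ᵥ gramCoord L v R y) = fun i => L (a i * y) := by
  have h := mulVec_span (v := v) (R * R) hRG (leftPairing L fun i => star (v i)) (fun j => rfl)
    (M := Matrix.of fun i j => L (a i * v j)) (leftPairing L a) (fun j => rfl) hy
  rw [← Matrix.mulVec_mulVec] at h
  exact h

include hL hR in
/-- The coordinates are isometric on the span of the `v i`. -/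
theorem star_gramCoord_dotProduct [DecidableEq ι]
    (hRG : R * R * (Matrix.of fun i j => L (star (v i) * v j)) = 1) (x : A) {y : A}
    (hy : y ∈ Submodule.span ℂ (Set.range v)) :
    star (gramCoord L v R x) ⬝ᵥ gramCoord L v R y = L (star x * y) := by
  have h := congrFun (mulVec_leftPairing (σ := Unit) hRG (fun _ => star x) hy) ()
  rw [← h]
  conv_lhs => rw [gramCoord, star_mulVec_dotProduct, hR]
  simp only [Matrix.mulVec, dotProduct, Matrix.of_apply, Pi.star_apply, ← hL, star_mul, star_star]

/-- The compression acts as left multiplication, followed by taking coordinates. -/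
theorem gramCompress_mulVec_slot [DecidableEq ι] [DecidableEq σ]
    (hRG : R * R * (Matrix.of fun i j => L (star (v i) * v j)) = 1) (w : Matrix σ σ A) (x : σ)
    {y : A} (hy : y ∈ Submodule.span ℂ (Set.range v)) :
    gramCompress L v R w *ᵥ slot x (gramCoord L v R y) =
      fun p => gramCoord L v R (w p.1 x * y) p.2 := by
  ext p
  have h : (gramCompress L v R w *ᵥ slot x (gramCoord L v R y)) p =
      ((R * (Matrix.of fun i j => L (star (v i) * w p.1 x * v j)) * R) *ᵥ
        gramCoord L v R y) p.2 := by
    simp only [Matrix.mulVec, dotProduct, gramCompress, slot, Matrix.of_apply,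
      Fintype.sum_prod_type, mul_ite, mul_zero]
    rw [Finset.sum_comm]
    simp
  rw [h, ← Matrix.mulVec_mulVec, ← Matrix.mulVec_mulVec,
    mulVec_leftPairing hRG (fun i => star (v i) * w p.1 x) hy, gramCoord]
  simp only [mul_assoc]

omit [Fintype σ] in
include hL hR in
theorem gramCompress_conjTranspose {w : Matrix σ σ A} (hw : wᴴ = w) :
    (gramCompress L v R w)ᴴ = gramCompress L v R w := by
  ext p q
  have h : (R * (Matrix.of fun i j => L (star (v i) * w q.1 p.1 * v j)) * R)ᴴ =
      R * (Matrix.of fun i j => L (star (v i) * w p.1 q.1 * v j)) * R := by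
    rw [Matrix.conjTranspose_mul, Matrix.conjTranspose_mul, hR, Matrix.mul_assoc]
    congr 3
    ext i j
    have hw' : star (w q.1 p.1) = w p.1 q.1 := congrFun (congrFun hw p.1) q.1
    simp [← hL, hw', mul_assoc]
  exact congrFun (congrFun h p.2) q.2

omit [Fintype σ] in
theorem gramCompress_one [DecidableEq ι] [DecidableEq σ]
    (hRG : R * (Matrix.of fun i j => L (star (v i) * v j)) * R = 1) :
    gramCompress L v R (1 : Matrix σ σ A) = 1 := by
  ext ⟨x, i⟩ ⟨y, j⟩
  by_cases h : x = y
  · subst h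
    simp only [gramCompress, Matrix.of_apply, Matrix.one_apply_eq, mul_one, hRG]
    simp [Matrix.one_apply]
  · have : (Matrix.of fun _ _ : ι => (0 : C)) = 0 := rfl
    simp [gramCompress, Matrix.one_apply, h, this]

omit [Fintype σ] in
theorem gramCompress_add (w w' : Matrix σ σ A) :
    gramCompress L v R (w + w') = gramCompress L v R w + gramCompress L v R w' := by
  ext p q
  have : (Matrix.of fun i j => L (star (v i) * (w + w') p.1 q.1 * v j)) =
      (Matrix.of fun i j => L (star (v i) * w p.1 q.1 * v j)) +
      (Matrix.of fun i j => L (star (v i) * w' p.1 q.1 * v j)) := by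
    ext i j
    simp [mul_add, add_mul]
  change (R * (Matrix.of fun i j => L (star (v i) * (w + w') p.1 q.1 * v j)) * R) p.2 q.2 = _
  rw [this, Matrix.mul_add, Matrix.add_mul]
  rfl

omit [Fintype σ] in
theorem gramCompress_neg (w : Matrix σ σ A) :
    gramCompress L v R (-w) = -gramCompress L v R w := by
  have h := gramCompress_add (L := L) (v := v) (R := R) w (-w)
  have h0 : gramCompress L v R (0 : Matrix σ σ A) = 0 := by
    have := gramCompress_add (L := L) (v := v) (R := R) (0 : Matrix σ σ A) 0
    simpa using this
  rw [add_neg_cancel, h0] at h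
  exact (neg_eq_of_add_eq_zero_right h.symm).symm

include hR in
/-- The compression of a hermitian square `w = ½ w⋆w` is positive. -/
theorem gramCompress_matPos [DecidableEq σ] {w : Matrix σ σ A} (hw : (2 : ℂ) • w = wᴴ * w)
    (hpos : ∀ x : σ, MatPos (Matrix.of fun p q : σ × ι =>
      L (star (w x p.1 * v p.2) * (w x q.1 * v q.2)))) :
    MatPos (gramCompress L v R w) := by
  have h := ((matPos_sum Finset.univ _ fun x _ => hpos x).smul
    (c := 2⁻¹) (by norm_num)).conjTranspose_mul_mul
      (Matrix.of fun p q : σ × ι => if p.1 = q.1 then R p.2 q.2 else 0)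
  convert h using 1
  have hsum : (((2⁻¹ : ℝ) : ℂ) • ∑ x, Matrix.of fun p q : σ × ι =>
      L (star (w x p.1 * v p.2) * (w x q.1 * v q.2))) =
      Matrix.of fun p q : σ × ι => L (star (v p.2) * w p.1 q.1 * v q.2) := by
    ext p q
    have h2 := congrFun (congrFun hw p.1) q.1
    have h3 : w p.1 q.1 = (2⁻¹ : ℂ) • ∑ x, star (w x p.1) * w x q.1 := by
      rw [Matrix.smul_apply, Matrix.mul_apply] at h2
      rw [show ∑ x, star (w x p.1) * w x q.1 = ∑ x, wᴴ p.1 x * w x q.1 from rfl, ← h2, smul_smul]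
      norm_num
    simp only [Matrix.smul_apply, Matrix.sum_apply, Matrix.of_apply]
    rw [h3, mul_smul_comm, smul_mul_assoc, map_smul, Finset.mul_sum, Finset.sum_mul, map_sum]
    congr 1
    · push_cast; rfl
    · exact Finset.sum_congr rfl fun x _ => by rw [star_mul]; simp only [mul_assoc]
  rw [hsum]
  ext ⟨x, i⟩ ⟨y, j⟩
  have hR' : ∀ i j, star (R i j) = R j i := fun i j => congrFun (congrFun hR j) i
  simp only [gramCompress, Matrix.of_apply, Matrix.mul_apply, Matrix.conjTranspose_apply,
    Fintype.sum_prod_type, apply_ite star, star_zero, ite_mul, zero_mul, mul_ite, mul_zero]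
  simp [hR', Finset.sum_ite_irrel]

end GramCoordinates

/-! ### The truncated dilation -/

section Dilation

variable {B C : Type*} [CStarAlgebra B] [CStarAlgebra C]

/-- A unitary lift, in matrix form. -/
theorem exists_unitary_lift_matrix {κ : Type*} [Fintype κ] [DecidableEq κ] {q : B →⋆ₐ[ℂ] C}
    (hq : Function.Surjective q) {S : Matrix κ κ C} (hS : Sᴴ = S) (h₁ : MatPos (1 + S))
    (h₂ : MatPos (1 - S)) :
    ∃ Z : Matrix κ κ B, Zᴴ * Z = 1 ∧ Z * Zᴴ = 1 ∧
      ∃ T : Matrix κ κ C, Tᴴ = T ∧ T * T = 1 - S * S ∧ Z.map q = S + Complex.I • T := by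
  let _ := CStarAlgebra.spectralOrder B
  have := CStarAlgebra.spectralOrderedRing B
  let _ := CStarAlgebra.spectralOrder C
  have := CStarAlgebra.spectralOrderedRing C
  rw [matPos_iff_nonneg] at h₁ h₂
  have hQ : Function.Surjective (StarAlgHom.mapCStarMatrix (κ := κ) q) := fun X => by
    choose f hf using hq
    exact ⟨CStarMatrix.ofMatrix ((CStarMatrix.ofMatrix.symm X).map f), by
      ext i j; exact hf _⟩
  obtain ⟨Z, h1, h2, T, h3, h4, h5⟩ := exists_unitary_lift (B := CStarMatrix κ κ B)
    (C := CStarMatrix κ κ C) hQ (S := CStarMatrix.ofMatrix S) hS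
    (neg_le_iff_add_nonneg.2 (by rw [add_comm]; exact h₁)) (sub_nonneg.1 h₂)
  exact ⟨Z, h1, h2, T, h3, h4, h5⟩

/-- A positive invertible matrix has an inverse square root. -/
theorem exists_inverse_sqrt_matrix {κ : Type*} [Fintype κ] [DecidableEq κ]
    {G : Matrix κ κ C} (hG : MatPos G) (hu : IsUnit G) :
    ∃ R : Matrix κ κ C, Rᴴ = R ∧ R * G * R = 1 ∧ R * R * G = 1 := by
  let _ := CStarAlgebra.spectralOrder C
  have := CStarAlgebra.spectralOrderedRing C
  exact exists_inverse_sqrt (C := CStarMatrix κ κ C) (g := CStarMatrix.ofMatrix G)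
    (matPos_iff_nonneg.1 hG) hu

/-- For a self-adjoint unitary `w` the compression `S` satisfies `1 + S ≥ 0`, since `1 + w` is half
of its own square. -/
theorem gramCompress_one_add_matPos {n d N : ℕ} {L : Unc n →ₗ[ℂ] C}
    (hpos : ∀ (κ : Type) [Fintype κ] (y : κ → Unc n), (∀ k, y k ∈ Unc.polys n (d + 1)) →
      MatPos (Matrix.of fun i j => L (star (y i) * y j)))
    {v : Fin N → Unc n} (hv : ∀ i, v i ∈ Unc.polys n d) {R : Matrix (Fin N) (Fin N) C}
    (hR : Rᴴ = R) (hRG : R * (Matrix.of fun i j => L (star (v i) * v j)) * R = 1)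
    {w : Matrix (Bool × Fin n) (Bool × Fin n) (Unc n)} (hw : wᴴ = w) (hww : w * w = 1)
    (hwv : ∀ p q i, w p q * v i ∈ Unc.polys n (d + 1)) :
    MatPos (1 + gramCompress L v R w) := by
  have hmem : ∀ (x : Bool × Fin n) (p : (Bool × Fin n) × Fin N),
      (1 + w) x p.1 * v p.2 ∈ Unc.polys n (d + 1) := by
    intro x p
    rw [Matrix.add_apply, add_mul, Matrix.one_apply]
    refine add_mem ?_ (hwv _ _ _)
    split_ifs
    · rw [one_mul]; exact Unc.polys_mono (Nat.le_succ d) (hv _)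
    · simp
  have hsq : (2 : ℂ) • (1 + w) = (1 + w)ᴴ * (1 + w) := by
    rw [Matrix.conjTranspose_add, Matrix.conjTranspose_one, hw, mul_add, add_mul, add_mul, hww]
    simp only [one_mul, mul_one]
    module
  rw [← gramCompress_one (σ := Bool × Fin n) hRG, ← gramCompress_add]
  exact gramCompress_matPos hR hsq fun x =>
    hpos ((Bool × Fin n) × Fin N) (fun p => (1 + w) x p.1 * v p.2) (hmem x)

/-- The compression of `[[0, u], [u⋆, 0]]` to the polynomials of degree at most `d` has a unitary
dilation which lifts through `q` and acts as left multiplication on lower degrees. -/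
theorem exists_lifted_unitary {n d N : ℕ} {q : B →⋆ₐ[ℂ] C} (hq : Function.Surjective q)
    {L : Unc n →ₗ[ℂ] C} (hL : ∀ a, L (star a) = star (L a))
    (hpos : ∀ (κ : Type) [Fintype κ] (y : κ → Unc n), (∀ k, y k ∈ Unc.polys n (d + 1)) →
      MatPos (Matrix.of fun i j => L (star (y i) * y j)))
    {v : Fin N → Unc n} (hv : Submodule.span ℂ (Set.range v) = Unc.polys n d)
    {R : Matrix (Fin N) (Fin N) C} (hR : Rᴴ = R)
    (hRG : R * (Matrix.of fun i j => L (star (v i) * v j)) * R = 1)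
    (hRRG : R * R * (Matrix.of fun i j => L (star (v i) * v j)) = 1) :
    ∃ Z : Matrix ((Bool × Fin n) × Fin N) ((Bool × Fin n) × Fin N) B, Zᴴ * Z = 1 ∧ Z * Zᴴ = 1 ∧
      ∀ (e : ℕ) (x : Bool × Fin n) (y : Unc n), e < d → y ∈ Unc.polys n e →
      (Z.map q *ᵥ slot x (gramCoord L v R y) =
        fun p => gramCoord L v R (Unc.flipU n p.1 x * y) p.2) ∧
      ((Z.map q)ᴴ *ᵥ slot x (gramCoord L v R y) =
        fun p => gramCoord L v R (Unc.flipU n p.1 x * y) p.2) := by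
  have hvd : ∀ i, v i ∈ Unc.polys n d := fun i => hv ▸ Submodule.subset_span ⟨i, rfl⟩
  set S := gramCompress L v R (Unc.flipU n) with hSdef
  have hS : Sᴴ = S := gramCompress_conjTranspose hL hR (Unc.flipU_conjTranspose n)
  have hp1 : MatPos (1 + S) := gramCompress_one_add_matPos hpos hvd hR hRG
    (Unc.flipU_conjTranspose n) (Unc.flipU_mul_self n)
    fun p q i => Unc.flipU_mul_mem_polys (hvd i) p q
  have hp2 : MatPos (1 - S) := by
    rw [hSdef, sub_eq_add_neg, ← gramCompress_neg]
    refine gramCompress_one_add_matPos hpos hvd hR hRG ?_ ?_ fun p q i => ?_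
    · rw [Matrix.conjTranspose_neg, Unc.flipU_conjTranspose]
    · rw [neg_mul_neg, Unc.flipU_mul_self]
    · rw [Matrix.neg_apply, neg_mul]
      exact neg_mem (Unc.flipU_mul_mem_polys (hvd i) p q)
  obtain ⟨Z, hZ1, hZ2, T, hT, hTT, hqZ⟩ := exists_unitary_lift_matrix hq hS hp1 hp2
  -- on coordinate vectors of polynomials of degree below `d` the defect operator `T` vanishes
  have hSx : ∀ (x : Bool × Fin n) (y : Unc n), y ∈ Unc.polys n d →
      S *ᵥ slot x (gramCoord L v R y) = fun p => gramCoord L v R (Unc.flipU n p.1 x * y) p.2 :=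
    fun x y hy => gramCompress_mulVec_slot hRRG _ x (hv ▸ hy)
  have hTx : ∀ (e : ℕ) (x : Bool × Fin n) (y : Unc n), e < d → y ∈ Unc.polys n e →
      T *ᵥ slot x (gramCoord L v R y) = 0 := by
    intro e x y he hy
    have hyd : y ∈ Unc.polys n d := Unc.polys_mono he.le hy
    refine mulVec_defect_eq_zero hS hT hTT ?_
    have hl : star (slot x (gramCoord L v R y)) ⬝ᵥ slot x (gramCoord L v R y) =
        L (star y * y) := by
      rw [← star_gramCoord_dotProduct hL hR hRRG y (hv ▸ hyd), star_slot_dotProduct]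
    rw [hl, hSx x y hyd]
    have hr : ∀ z, star (gramCoord L v R (Unc.flipU n z x * y)) ⬝ᵥ
        gramCoord L v R (Unc.flipU n z x * y) =
        L (star (Unc.flipU n z x * y) * (Unc.flipU n z x * y)) := fun z =>
      star_gramCoord_dotProduct hL hR hRRG _
        (hv ▸ Unc.polys_mono he (Unc.flipU_mul_mem_polys hy z x))
    have hsum : star (fun p : (Bool × Fin n) × Fin N =>
        gramCoord L v R (Unc.flipU n p.1 x * y) p.2) ⬝ᵥ
        (fun p => gramCoord L v R (Unc.flipU n p.1 x * y) p.2) =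
        ∑ z, star (gramCoord L v R (Unc.flipU n z x * y)) ⬝ᵥ
        gramCoord L v R (Unc.flipU n z x * y) := Fintype.sum_prod_type _
    rw [hsum, Finset.sum_congr rfl fun z _ => hr z, ← map_sum]
    have hu2 := congrFun (congrFun (Unc.flipU_mul_self n) x) x
    nth_rewrite 1 [← Unc.flipU_conjTranspose n] at hu2
    rw [Matrix.mul_apply, Matrix.one_apply_eq] at hu2
    have : ∑ z, star (Unc.flipU n z x * y) * (Unc.flipU n z x * y) =
        star y * (∑ z, (Unc.flipU n)ᴴ x z * Unc.flipU n z x) * y := by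
      rw [Finset.mul_sum, Finset.sum_mul]
      refine Finset.sum_congr rfl fun z _ => ?_
      rw [star_mul, Matrix.conjTranspose_apply]
      simp only [mul_assoc]
    rw [this, hu2, mul_one]
  have hZx : ∀ (e : ℕ) (x : Bool × Fin n) (y : Unc n), e < d → y ∈ Unc.polys n e →
      Z.map q *ᵥ slot x (gramCoord L v R y) =
        fun p => gramCoord L v R (Unc.flipU n p.1 x * y) p.2 := by
    intro e x y he hy
    rw [hqZ, Matrix.add_mulVec, Matrix.smul_mulVec, hTx e x y he hy, smul_zero, add_zero,
      hSx x y (Unc.polys_mono he.le hy)]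
  have hZsx : ∀ (e : ℕ) (x : Bool × Fin n) (y : Unc n), e < d → y ∈ Unc.polys n e →
      (Z.map q)ᴴ *ᵥ slot x (gramCoord L v R y) =
        fun p => gramCoord L v R (Unc.flipU n p.1 x * y) p.2 := by
    intro e x y he hy
    rw [hqZ, Matrix.conjTranspose_add, Matrix.conjTranspose_smul, hS, hT, Matrix.add_mulVec,
      Matrix.smul_mulVec, hTx e x y he hy, smul_zero, add_zero, hSx x y (Unc.polys_mono he.le hy)]
  exact ⟨Z, hZ1, hZ2, fun e x y he hy => ⟨hZx e x y he hy, hZsx e x y he hy⟩⟩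

/-- A truncated Stinespring dilation that lifts through a quotient map. If `L` is positive on
hermitian squares of polynomials of degree at most `d + 1` and its Gram matrix in degree `d` is
invertible, then on polynomials of degree at most `d` it is a vector form of a representation
that lifts through `q`. -/
theorem exists_lifted_dilation {n d N : ℕ} {q : B →⋆ₐ[ℂ] C} (hq : Function.Surjective q)
    {L : Unc n →ₗ[ℂ] C} (hL : ∀ a, L (star a) = star (L a))
    (hpos : ∀ (κ : Type) [Fintype κ] (y : κ → Unc n), (∀ k, y k ∈ Unc.polys n (d + 1)) →
      MatPos (Matrix.of fun i j => L (star (y i) * y j)))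
    {v : Fin N → Unc n} (hv : Submodule.span ℂ (Set.range v) = Unc.polys n d)
    (hu : IsUnit (Matrix.of fun i j => L (star (v i) * v j))) :
    ∃ (π : Unc n →⋆ₐ[ℂ] Matrix (Bool × Fin N) (Bool × Fin N) B) (ξ : Bool × Fin N → C),
      ∀ y ∈ Unc.polys n d, L y = star ξ ⬝ᵥ ((π y).map q *ᵥ ξ) := by
  have hvd : ∀ i, v i ∈ Unc.polys n d := fun i => hv ▸ Submodule.subset_span ⟨i, rfl⟩
  obtain ⟨R, hR, hRG, hRRG⟩ := exists_inverse_sqrt_matrix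
    (hpos (Fin N) v fun k => Unc.polys_mono (Nat.le_succ d) (hvd k)) hu
  obtain ⟨Z, hZ1, hZ2, hZx⟩ := exists_lifted_unitary hq hL hpos hv hR hRG hRRG
  let _ := CStarAlgebra.spectralOrder B
  have := CStarAlgebra.spectralOrderedRing B
  -- the flip of the two summands turns `[[0, u], [u⋆, 0]]` into the diagonal matrix with blocks
  -- `u`, `u⋆`; `U a b` is the dilation of the entry `(a, b)`
  let U : Fin n → Fin n → Matrix (Bool × Fin N) (Bool × Fin N) B := fun a b =>
    Matrix.of fun p r => Z ((p.1, a), p.2) ((!r.1, b), r.2)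
  have hU1 : ∀ a b, ∑ k, (U k a)ᴴ * U k b = if a = b then 1 else 0 := by
    intro a b
    ext ⟨β, i⟩ ⟨γ, j⟩
    have h := congrFun (congrFun hZ1 ((!β, a), i)) ((!γ, b), j)
    rw [Matrix.mul_apply, Fintype.sum_prod_type, Fintype.sum_prod_type, Finset.sum_comm] at h
    rw [Matrix.sum_apply]
    simp only [Matrix.mul_apply, Fintype.sum_prod_type, Matrix.conjTranspose_apply, U,
      Matrix.of_apply] at h ⊢
    rw [h]
    by_cases hab : a = b <;> simp [Matrix.one_apply, hab]
  have hU2 : ∀ a b, ∑ k, U a k * (U b k)ᴴ = if a = b then 1 else 0 := by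
    intro a b
    ext ⟨β, i⟩ ⟨γ, j⟩
    have h := congrFun (congrFun hZ2 ((β, a), i)) ((γ, b), j)
    rw [Matrix.mul_apply, Fintype.sum_prod_type, Fintype.sum_prod_type, Finset.sum_comm] at h
    rw [Matrix.sum_apply]
    simp only [Matrix.mul_apply, Fintype.sum_prod_type, Matrix.conjTranspose_apply, U,
      Matrix.of_apply] at h ⊢
    simp only [Fintype.sum_bool, Bool.not_true, Bool.not_false] at h ⊢
    simp only [add_comm] at h ⊢
    rw [h]
    by_cases hab : a = b <;> simp [Matrix.one_apply, hab]
  obtain ⟨π₀, hπ₀⟩ := Unc.exists_starAlgHom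
    (D := CStarMatrix (Bool × Fin N) (Bool × Fin N) B)
    (Matrix.of fun a b => CStarMatrix.ofMatrix (U a b))
    (by
      ext1 a b
      rw [Matrix.mul_apply, Matrix.one_apply]
      exact hU1 a b)
    (by
      ext1 a b
      rw [Matrix.mul_apply, Matrix.one_apply]
      exact hU2 a b)
  let π : Unc n →⋆ₐ[ℂ] Matrix (Bool × Fin N) (Bool × Fin N) B :=
    { toFun := fun a => CStarMatrix.ofMatrix.symm (π₀ a)
      map_one' := map_one π₀
      map_mul' := map_mul π₀
      map_zero' := map_zero π₀
      map_add' := map_add π₀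
      commutes' := AlgHomClass.commutes π₀
      map_star' := map_star π₀ }
  have hπu : ∀ a b, π (Unc.u a b) = U a b := fun a b => hπ₀ a b
  let e : Unc n → Bool × Fin N → C := fun y => slot false (gramCoord L v R y)
  -- on the cyclic vector `e 1` the representation is left multiplication, letter by letter
  have hact : ∀ y ∈ Unc.polys n d, (π y).map q *ᵥ e 1 = e y := by
    intro y hy
    refine Unc.polys_induction (motive := fun y => (π y).map q *ᵥ e 1 = e y) ?_ ?_ ?_ ?_ hy
    · intro x y hx hy
      rw [map_add, Matrix.map_add q (map_add q), Matrix.add_mulVec, hx, hy]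
      ext p
      simp only [e, slot, gramCoord_add, Pi.add_apply]
      split_ifs <;> simp
    · intro c x hx
      rw [map_smul, Matrix.map_smul q c (map_smul q c), Matrix.smul_mulVec, hx]
      ext p
      simp only [e, slot, gramCoord_smul, Pi.smul_apply]
      split_ifs <;> simp
    · rw [map_one, Matrix.map_one q (map_zero q) (map_one q), Matrix.one_mulVec]
    · intro k hk y hyk hy a
      have hmul : (π (Unc.letter a * y)).map q = (π (Unc.letter a)).map q * (π y).map q := by
        rw [map_mul]
        exact Matrix.map_mul (f := (q : B →+* C))
      rw [hmul, ← Matrix.mulVec_mulVec, hy]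
      obtain ⟨⟨a, b⟩, c⟩ := a
      cases c with
      | false =>
        rw [Unc.letter_false, hπu]
        ext ⟨β, i⟩
        have h := congrFun (hZx k (true, b) y hk hyk).1 ((β, a), i)
        simp only [Matrix.mulVec, dotProduct, Fintype.sum_prod_type, Matrix.map_apply, slot,
          Prod.mk.injEq, mul_ite, mul_zero] at h
        simp only [e, slot, U, Matrix.mulVec, dotProduct, Fintype.sum_prod_type, Matrix.map_apply,
          Matrix.of_apply]
        simp [Finset.sum_ite_irrel, ite_and] at h ⊢
        rw [h]
        cases β <;> simp [Unc.flipU, gramCoord_zero]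
      | true =>
        rw [Unc.letter_true, map_star, hπu]
        ext ⟨β, i⟩
        have h := congrFun (hZx k (false, a) y hk hyk).2 ((!β, b), i)
        simp only [Matrix.mulVec, dotProduct, Fintype.sum_prod_type, slot,
          Prod.mk.injEq, mul_ite, mul_zero] at h
        simp only [e, slot, U, Matrix.mulVec, dotProduct, Fintype.sum_prod_type, Matrix.map_apply,
          Matrix.of_apply, Matrix.star_eq_conjTranspose, Matrix.conjTranspose_apply] at h ⊢
        simp [Finset.sum_ite_irrel, ite_and, map_star] at h ⊢
        rw [h]
        cases β <;> simp [Unc.flipU, gramCoord_zero]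
  refine ⟨π, e 1, fun y hy => ?_⟩
  rw [hact y hy]
  have h := star_gramCoord_dotProduct hL hR hRRG 1 (hv ▸ hy : y ∈ Submodule.span ℂ (Set.range v))
  rw [star_one, one_mul] at h
  rw [← h]
  simp [e, slot, dotProduct, Fintype.sum_prod_type]

end Dilation

/-! ### Operations on ucp maps -/

section UCP

variable {A B C : Type*} [CStarAlgebra A] [CStarAlgebra B] [CStarAlgebra C]

/-- The Gram matrix of `1` and `a` is positive, hence so is its image, which is therefore
self-adjoint. -/
theorem IsUCP.map_star {φ : A →ₗ[ℂ] B} (hφ : IsUCP φ) (a : A) : φ (star a) = star (φ a) := by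
  have h := (hφ.matPos_map_of_fintype (matPos_gram ![1, a])).conjTranspose_eq
  have h2 := congrFun (congrFun h 1) 0
  simpa using h2.symm

/-- A ucp map is contractive; the constant `2`, from splitting into real and imaginary parts, is
enough for the approximations below. -/
theorem IsUCP.norm_le_two_mul {φ : A →ₗ[ℂ] B} (hφ : IsUCP φ) (a : A) : ‖φ a‖ ≤ 2 * ‖a‖ := by
  let _ := CStarAlgebra.spectralOrder A
  have := CStarAlgebra.spectralOrderedRing A
  let _ := CStarAlgebra.spectralOrder B
  have := CStarAlgebra.spectralOrderedRing B
  have hpos : ∀ x : A, 0 ≤ x → 0 ≤ φ x := fun x hx => by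
    have h := hφ.map_matPos 1 (Matrix.of fun _ _ => x) (matPos_one_iff.2 hx)
    exact matPos_one_iff.1 h
  have halg : ∀ r : ℝ, φ (algebraMap ℝ A r) = algebraMap ℝ B r := fun r => by
    rw [Algebra.algebraMap_eq_smul_one, Algebra.algebraMap_eq_smul_one, ← Complex.coe_smul,
      map_smul, hφ.map_one, Complex.coe_smul]
  have hsa : ∀ x : A, IsSelfAdjoint x → ‖φ x‖ ≤ ‖x‖ := fun x hx => by
    have hx' : IsSelfAdjoint (φ x) := by
      rw [isSelfAdjoint_iff, ← hφ.map_star, hx.star_eq]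
    have h1 := hpos _ (sub_nonneg.2 hx.neg_algebraMap_norm_le_self)
    rw [map_sub, map_neg, halg, sub_nonneg, ← map_neg,
      algebraMap_le_iff_le_spectrum (a := φ x) hx'] at h1
    have h2 := hpos _ (sub_nonneg.2 hx.le_algebraMap_norm_self)
    rw [map_sub, halg, sub_nonneg, le_algebraMap_iff_spectrum_le (a := φ x) hx'] at h2
    rw [← cfc_id ℝ (φ x) hx']
    exact norm_cfc_le (norm_nonneg x) fun t ht => abs_le.2 ⟨h1 t ht, h2 t ht⟩
  have hd := realPart_add_I_smul_imaginaryPart a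
  calc ‖φ a‖ = ‖φ (realPart a) + Complex.I • φ (imaginaryPart a)‖ := by
        rw [← map_smul, ← map_add, hd]
    _ ≤ ‖φ (realPart a)‖ + ‖φ (imaginaryPart a)‖ := by
        refine (norm_add_le _ _).trans ?_
        rw [norm_smul, Complex.norm_I, one_mul]
    _ ≤ ‖a‖ + ‖a‖ := add_le_add
        ((hsa _ (realPart a).2).trans (realPart.norm_le a))
        ((hsa _ (imaginaryPart a).2).trans (imaginaryPart.norm_le a))
    _ = 2 * ‖a‖ := (two_mul _).symm

theorem IsUCP.comp_starAlgHom {φ : A →ₗ[ℂ] B} (hφ : IsUCP φ) (q : B →⋆ₐ[ℂ] C) :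
    IsUCP ((q : B →ₗ[ℂ] C) ∘ₗ φ) where
  map_one := by
    change q (φ 1) = 1
    rw [hφ.map_one]
    exact _root_.map_one q
  map_matPos r X hX := by
    have h := q.isUCP.map_matPos r _ (hφ.map_matPos r X hX)
    rwa [Matrix.map_map] at h

theorem Matrix.PosSemidef.matPos_map_algebraMap {κ : Type*} [Fintype κ] [DecidableEq κ]
    {G : Matrix κ κ ℂ} (hG : G.PosSemidef) : MatPos (G.map (algebraMap ℂ C)) := by
  open scoped MatrixOrder in
  obtain ⟨Z, rfl⟩ := CStarAlgebra.nonneg_iff_eq_star_mul_self.1 hG.nonneg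
  refine ⟨Z.map (algebraMap ℂ C), ?_⟩
  rw [Matrix.map_mul]
  congr 1
  ext i j
  exact algebraMap_star_comm (A := C) (Z j i)

/-- A state, seen as a ucp map with scalar values in `C`. -/
theorem isUCP_of_state {τ : A →ₗ[ℂ] ℂ} (hs : ∀ a, τ (star a) = star (τ a))
    (hp : IsPositiveFunctional τ) (h1 : τ 1 = 1) :
    IsUCP (Algebra.linearMap ℂ C ∘ₗ τ) where
  map_one := by simp [h1]
  map_matPos r X hX := by
    obtain ⟨Y, rfl⟩ := hX
    have h : (Yᴴ * Y).map (Algebra.linearMap ℂ C ∘ₗ τ) =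
        ∑ k, (Matrix.of fun i j => τ (star (Y k i) * Y k j)).map (algebraMap ℂ C) := by
      ext i j
      simp [Matrix.mul_apply, Matrix.sum_apply]
    rw [h]
    exact matPos_sum _ _ fun k _ => (gram_posSemidef hs hp (Y k)).matPos_map_algebraMap

theorem IsUCP.convex {φ ψ : A →ₗ[ℂ] B} (hφ : IsUCP φ) (hψ : IsUCP ψ) {t : ℝ} (h0 : 0 ≤ t)
    (h1 : t ≤ 1) : IsUCP (((1 - t : ℝ) : ℂ) • φ + (t : ℂ) • ψ) where
  map_one := by
    simp only [LinearMap.add_apply, LinearMap.smul_apply, hφ.map_one, hψ.map_one]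
    rw [← add_smul]
    simp
  map_matPos r X hX := by
    have h := ((hφ.map_matPos r X hX).smul (sub_nonneg.2 h1)).add
      ((hψ.map_matPos r X hX).smul h0)
    exact h

/-- The map `a ↦ ξ⋆ π(a) ξ + χ(a) (1 - ξ⋆ξ)` is ucp when `ξ` is a contractive column. -/
theorem isUCP_compression {J : Type*} [Fintype J] [DecidableEq J] (π : A →⋆ₐ[ℂ] Matrix J J B)
    (χ : A →⋆ₐ[ℂ] ℂ) {ξ : J → B} {c : B} (hc : 1 - star ξ ⬝ᵥ ξ = star c * c) :
    ∃ ψ : A →ₗ[ℂ] B, IsUCP ψ ∧ ∀ a, ψ a = star ξ ⬝ᵥ (π a *ᵥ ξ) + χ a • (star c * c) := by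
  let ψ : A →ₗ[ℂ] B :=
    { toFun := fun a => star ξ ⬝ᵥ (π a *ᵥ ξ) + χ a • (star c * c)
      map_add' := fun a b => by
        rw [map_add, map_add, Matrix.add_mulVec, dotProduct_add, add_smul]
        abel
      map_smul' := fun z a => by
        rw [map_smul, map_smul, Matrix.smul_mulVec, dotProduct_smul, smul_assoc, smul_add]
        rfl }
  have hψ : ∀ a, ψ a = star ξ ⬝ᵥ (π a *ᵥ ξ) + χ a • (star c * c) := fun a => rfl
  refine ⟨ψ, ⟨?_, fun r X hX => ?_⟩, hψ⟩
  · rw [hψ, map_one, map_one, Matrix.one_mulVec, one_smul, ← hc, add_sub_cancel]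
  · obtain ⟨Y, rfl⟩ := hX
    have h : (Yᴴ * Y).map ψ =
        (Matrix.of fun (p : Fin r × J) j => (π (Y p.1 j) *ᵥ ξ) p.2)ᴴ *
          (Matrix.of fun (p : Fin r × J) j => (π (Y p.1 j) *ᵥ ξ) p.2) +
        (Matrix.of fun k j => χ (Y k j) • c)ᴴ * (Matrix.of fun k j => χ (Y k j) • c) := by
      ext i j
      rw [Matrix.map_apply, hψ, Matrix.add_apply, Matrix.mul_apply, Matrix.mul_apply,
        Matrix.mul_apply, Fintype.sum_prod_type, map_sum, map_sum, Matrix.sum_mulVec,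
        dotProduct_sum, Finset.sum_smul]
      congr 1
      · refine Finset.sum_congr rfl fun k _ => ?_
        rw [map_mul, Matrix.conjTranspose_apply, map_star, ← Matrix.mulVec_mulVec,
          Matrix.star_eq_conjTranspose, ← star_mulVec_dotProduct]
        rfl
      · refine Finset.sum_congr rfl fun k _ => ?_
        simp [smul_smul, map_star, mul_comm]
    rw [h]
    exact (matPos_conjTranspose_mul_self _).add (matPos_conjTranspose_mul_self _)

/-- A unit column over a quotient lifts to a contractive column. -/
theorem exists_contractive_column_lift {J : Type*} [Fintype J] {q : B →⋆ₐ[ℂ] C}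
    (hq : Function.Surjective q) {ξ : J → C} (hξ : star ξ ⬝ᵥ ξ = 1) :
    ∃ (η : J → B) (c : B), (∀ j, q (η j) = ξ j) ∧ 1 - star η ⬝ᵥ η = star c * c := by
  let _ := CStarAlgebra.spectralOrder B
  have := CStarAlgebra.spectralOrderedRing B
  -- `η₀` is any lift and `h = η₀⋆η₀` is sent to `1`; multiplying `η₀` by `max(1, h)^(-1/2)` makes
  -- it contractive
  choose f hf using hq
  set η₀ : J → B := fun j => f (ξ j)
  set h : B := star η₀ ⬝ᵥ η₀ with hh
  have hqh : q h = 1 := by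
    rw [hh, ← hξ, dotProduct, dotProduct, map_sum]
    refine Finset.sum_congr rfl fun j _ => ?_
    rw [map_mul, Pi.star_apply, map_star, hf]
    rfl
  have hpos : 0 ≤ h := Finset.sum_nonneg fun j _ => star_mul_self_nonneg (η₀ j)
  have hsa : IsSelfAdjoint h := IsSelfAdjoint.of_nonneg hpos
  have hc1 : Continuous fun t : ℝ => (√(max 1 t))⁻¹ :=
    (Real.continuous_sqrt.comp (continuous_const.max continuous_id)).inv₀ fun t =>
      (Real.sqrt_pos.2 (lt_of_lt_of_le one_pos (le_max_left 1 t))).ne'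
  have hc2 : Continuous fun t : ℝ => √(1 - (√(max 1 t))⁻¹ * t * (√(max 1 t))⁻¹) := by
    have := hc1
    fun_prop
  set k : B := cfc (fun t : ℝ => (√(max 1 t))⁻¹) h with hk
  set c : B := cfc (fun t : ℝ => √(1 - (√(max 1 t))⁻¹ * t * (√(max 1 t))⁻¹)) h with hcdef
  have hks : star k = k := (cfc_predicate _ h : IsSelfAdjoint k)
  have hcs : star c = c := (cfc_predicate _ h : IsSelfAdjoint c)
  refine ⟨fun j => η₀ j * k, c, fun j => ?_, ?_⟩
  · have hqk : q k = 1 := by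
      rw [hk, StarAlgHom.map_cfc q _ h hc1.continuousOn (StarAlgHom.continuous q) hsa
        (by rw [hqh]; exact IsSelfAdjoint.one C), hqh]
      rw [← map_one (algebraMap ℝ C), cfc_algebraMap]
      simp
    rw [map_mul, hqk, mul_one]
    exact hf _
  · have h1 : star (fun j => η₀ j * k) ⬝ᵥ (fun j => η₀ j * k) = k * h * k := by
      simp only [dotProduct, Pi.star_apply, star_mul, hks, hh, Finset.mul_sum, Finset.sum_mul,
        mul_assoc]
    have h2 : k * h * k = cfc (fun t : ℝ => (√(max 1 t))⁻¹ * t * (√(max 1 t))⁻¹) h := by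
      rw [cfc_mul (fun t : ℝ => (√(max 1 t))⁻¹ * t) (fun t : ℝ => (√(max 1 t))⁻¹) h
          (hc1.mul continuous_id).continuousOn hc1.continuousOn,
        cfc_mul (fun t : ℝ => (√(max 1 t))⁻¹) (fun t : ℝ => t) h hc1.continuousOn continuousOn_id,
        cfc_id' ℝ h hsa]
    rw [h1, h2, hcs, hcdef, ← cfc_mul _ _ h hc2.continuousOn hc2.continuousOn,
      ← cfc_one ℝ h hsa, ← cfc_sub _ _ h (by fun_prop) (by have := hc1; fun_prop)]
    refine cfc_congr fun t ht => ?_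
    have ht0 : 0 ≤ t := spectrum_nonneg_of_nonneg hpos ht
    have hm : 0 < max 1 t := lt_of_lt_of_le one_pos (le_max_left 1 t)
    have hle : (√(max 1 t))⁻¹ * t * (√(max 1 t))⁻¹ ≤ 1 := by
      have : (√(max 1 t))⁻¹ * t * (√(max 1 t))⁻¹ = t / max 1 t := by
        rw [mul_right_comm, ← mul_inv, Real.mul_self_sqrt hm.le]
        ring
      rw [this, div_le_one hm]
      exact le_max_right 1 t
    rw [Real.mul_self_sqrt (sub_nonneg.2 hle)]
    rfl

end UCP

/-! ### Approximate lifting of ucp maps -/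

section ApproximateLifting

variable {B C : Type*} [CStarAlgebra B] [CStarAlgebra C] {n : ℕ}

instance : Nontrivial (Unc n) := by
  obtain ⟨χ⟩ := Unc.exists_character n
  exact ⟨0, 1, fun h => by simpa using congrArg χ h⟩

theorem Unc.exists_basis_polys (n d : ℕ) : ∃ (N : ℕ) (v : Fin N → Unc n),
    LinearIndependent ℂ v ∧ Submodule.span ℂ (Set.range v) = Unc.polys n d := by
  let b := Module.finBasis ℂ (Unc.polys n d)
  refine ⟨_, fun i => (b i : Unc n), ?_, ?_⟩
  · exact b.linearIndependent.map' (Unc.polys n d).subtype (Submodule.ker_subtype _)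
  · rw [show Set.range (fun i => (b i : Unc n)) =
        (Unc.polys n d).subtype '' Set.range b by rw [← Set.range_comp]; rfl,
      Submodule.span_image, b.span_eq, Submodule.map_subtype_top]

/-- A positive definite scalar Gram matrix stays invertible after adding a positive matrix. -/
theorem isUnit_add_smul_map_algebraMap {κ : Type*} [Fintype κ] [DecidableEq κ] {X : Matrix κ κ C}
    (hX : MatPos X) {G : Matrix κ κ ℂ} (hG : G.PosDef) {t : ℝ} (ht : 0 < t) :
    IsUnit (X + (t : ℂ) • G.map (algebraMap ℂ C)) := by
  let _ := CStarAlgebra.spectralOrder C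
  have := CStarAlgebra.spectralOrderedRing C
  have hu : IsUnit (G.map (algebraMap ℂ C)) := hG.isUnit.map (algebraMap ℂ C).mapMatrix
  have hu2 : IsUnit ((t : ℂ) • G.map (algebraMap ℂ C)) := by
    have := hu.smul (Units.mk0 (t : ℂ) (by exact_mod_cast ht.ne'))
    exact this
  have h1 : IsStrictlyPositive
      (CStarMatrix.ofMatrix ((t : ℂ) • G.map (algebraMap ℂ C)) : CStarMatrix κ κ C) :=
    ⟨matPos_iff_nonneg.1 (hG.posSemidef.matPos_map_algebraMap.smul ht.le), hu2⟩
  exact (IsStrictlyPositive.nonneg_add (A := CStarMatrix κ κ C) (matPos_iff_nonneg.1 hX) h1).isUnit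

/-- A ucp map from `U_nc(n)` into a quotient lifts approximately on finite sets. -/
theorem exists_approx_lift_of_isUCP {q : B →⋆ₐ[ℂ] C} (hq : Function.Surjective q)
    {φ : Unc n →ₗ[ℂ] C} (hφ : IsUCP φ) {κ : Type*} [Finite κ] (t : κ → Unc n) {ε : ℝ}
    (hε : 0 < ε) : ∃ ψ : Unc n →ₗ[ℂ] B, IsUCP ψ ∧ ∀ k, ‖q (ψ (t k)) - φ (t k)‖ ≤ ε := by
  have := Fintype.ofFinite κ
  obtain ⟨d, hd⟩ := Unc.exists_polys_forall_norm_sub_lt t (ε := min 1 (ε / 8)) (by positivity)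
  obtain ⟨N, v, hli, hv⟩ := Unc.exists_basis_polys n d
  obtain ⟨τ, hτs, hτp, hτ1, -, hτE⟩ := exists_state_posOn (Unc.polys n d)
  obtain ⟨M, hM⟩ : ∃ M : ℝ, ∀ k, ‖t k‖ ≤ M := by
    obtain ⟨M, hM⟩ := (Set.finite_range fun k => ‖t k‖).bddAbove
    exact ⟨M, fun k => hM ⟨k, rfl⟩⟩
  -- perturb `φ` by a state to make the Gram matrix in degree `d` invertible
  obtain ⟨s, hs0, hs1, hsε⟩ : ∃ s : ℝ, 0 < s ∧ s ≤ 1 ∧ s * (4 * (|M| + 1)) ≤ ε / 2 := by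
    refine ⟨min 1 (ε / (8 * (|M| + 1))), by positivity, min_le_left _ _, ?_⟩
    calc min 1 (ε / (8 * (|M| + 1))) * (4 * (|M| + 1))
        ≤ ε / (8 * (|M| + 1)) * (4 * (|M| + 1)) := by gcongr; exact min_le_right _ _
      _ = ε / 2 := by field_simp; norm_num
  have hτu : IsUCP (Algebra.linearMap ℂ C ∘ₗ τ) := isUCP_of_state hτs hτp hτ1
  set L : Unc n →ₗ[ℂ] C := ((1 - s : ℝ) : ℂ) • φ + (s : ℂ) • (Algebra.linearMap ℂ C ∘ₗ τ) with hLdef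
  have hL : IsUCP L := hφ.convex hτu hs0.le hs1
  have hpos : ∀ (κ : Type) [Fintype κ] (y : κ → Unc n), (∀ k, y k ∈ Unc.polys n (d + 1)) →
      MatPos (Matrix.of fun i j => L (star (y i) * y j)) := fun κ _ y _ =>
    hL.matPos_map_of_fintype (matPos_gram y)
  have hvd : ∀ i, v i ∈ Unc.polys n d := fun i => hv ▸ Submodule.subset_span ⟨i, rfl⟩
  have hu : IsUnit (Matrix.of fun i j => L (star (v i) * v j)) := by
    have h := isUnit_add_smul_map_algebraMap
      ((hφ.matPos_map_of_fintype (matPos_gram v)).smul (sub_nonneg.2 hs1))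
      (gram_posDef hτs hτE hvd hli) hs0
    exact h
  obtain ⟨π, ξ, hπ⟩ := exists_lifted_dilation hq hL.map_star hpos hv hu
  have hξ : star ξ ⬝ᵥ ξ = 1 := by
    have h := hπ 1 (Unc.one_mem_polys d)
    rw [hL.map_one, map_one, Matrix.map_one q (map_zero q) (map_one q), Matrix.one_mulVec] at h
    exact h.symm
  obtain ⟨η, c, hη, hc⟩ := exists_contractive_column_lift hq hξ
  obtain ⟨χ⟩ := Unc.exists_character n
  obtain ⟨ψ, hψ, hψa⟩ := isUCP_compression π χ hc
  have hqη : (fun j => q (η j)) = ξ := funext hη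
  have hqc : q (star c * c) = 0 := by
    rw [← hc, map_sub, map_one, sub_eq_zero, ← hξ, ← hqη]
    simp [dotProduct, map_star]
  have hqψ : ∀ y ∈ Unc.polys n d, q (ψ y) = L y := by
    intro y hy
    rw [hπ y hy, hψa, map_add, map_smul, hqc, smul_zero, add_zero, ← hqη]
    simp [dotProduct, Matrix.mulVec, map_star]
  refine ⟨ψ, hψ, fun k => ?_⟩
  obtain ⟨y, hy, hty⟩ := hd k
  have h1 : ‖q (ψ (t k - y))‖ ≤ ε / 4 :=
    ((hψ.comp_starAlgHom q).norm_le_two_mul (t k - y)).trans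
      (by nlinarith [min_le_right 1 (ε / 8)])
  have h2 : ‖φ (t k - y)‖ ≤ ε / 4 := (hφ.norm_le_two_mul (t k - y)).trans
      (by nlinarith [min_le_right 1 (ε / 8)])
  have hyM : ‖y‖ ≤ |M| + 1 := by
    have := norm_sub_norm_le y (t k)
    rw [norm_sub_rev] at this
    have h3 := (hM k).trans (le_abs_self M)
    have h4 := min_le_left 1 (ε / 8)
    linarith
  have h3 : ‖L y - φ y‖ ≤ ε / 2 := by
    have h4 : L y - φ y = (s : ℂ) • ((Algebra.linearMap ℂ C ∘ₗ τ) y - φ y) := by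
      simp only [hLdef, LinearMap.add_apply, LinearMap.smul_apply]
      push_cast
      module
    rw [h4, norm_smul, Complex.norm_real, Real.norm_of_nonneg hs0.le]
    refine le_trans (mul_le_mul_of_nonneg_left ?_ hs0.le) hsε
    have h5 := (norm_sub_le ((Algebra.linearMap ℂ C ∘ₗ τ) y) (φ y)).trans
      (add_le_add (hτu.norm_le_two_mul y) (hφ.norm_le_two_mul y))
    linarith
  have h4 : q (ψ (t k)) - φ (t k) = q (ψ (t k - y)) + (L y - φ y) - φ (t k - y) := by
    rw [map_sub, map_sub, map_sub, hqψ y hy]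
    abel
  rw [h4]
  refine (norm_sub_le _ _).trans ?_
  linarith [norm_add_le (q (ψ (t k - y))) (L y - φ y)]

end ApproximateLifting

/-! ### Quasicentral elements of an ideal -/

section QuasiCentral

variable {B C : Type*} [CStarAlgebra B] [CStarAlgebra C]

section Ordered

variable [PartialOrder B] [StarOrderedRing B]

/-- Every element of a quotient has a lift of at most the same norm. -/
theorem exists_lift_norm_le {q : B →⋆ₐ[ℂ] C} (hq : Function.Surjective q) (c : C) :
    ∃ b, q b = c ∧ ‖b‖ ≤ ‖c‖ := by
  rcases eq_or_ne c 0 with rfl | hc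
  · exact ⟨0, map_zero q, by simp⟩
  let _ := CStarAlgebra.spectralOrder C
  have := CStarAlgebra.spectralOrderedRing C
  set r := ‖c‖ with hr
  have hr0 : 0 < r := norm_pos_iff.2 hc
  obtain ⟨b, hb⟩ := hq c
  have hpos : 0 ≤ star b * b := star_mul_self_nonneg b
  have hsa : IsSelfAdjoint (star b * b) := IsSelfAdjoint.of_nonneg hpos
  have hcsa : IsSelfAdjoint (star c * c) := IsSelfAdjoint.star_mul_self c
  have hqh : q (star b * b) = star c * c := by rw [map_mul, map_star, hb]
  set f : ℝ → ℝ := fun t => (√(max 1 (t / r ^ 2)))⁻¹ with hf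
  have hfc : Continuous f :=
    (Real.continuous_sqrt.comp (continuous_const.max (continuous_id.div_const _))).inv₀ fun t =>
      (Real.sqrt_pos.2 (lt_of_lt_of_le one_pos (le_max_left 1 _))).ne'
  set k := cfc f (star b * b) with hk
  have hks : star k = k := (cfc_predicate f _ : IsSelfAdjoint k)
  refine ⟨b * k, ?_, ?_⟩
  · have hqk : q k = 1 := by
      rw [hk, StarAlgHom.map_cfc q f _ hfc.continuousOn (StarAlgHom.continuous q) hsa
        (by rw [hqh]; exact hcsa), hqh]
      refine (cfc_congr fun t ht => ?_).trans (cfc_one ℝ _ hcsa)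
      have h1 := (le_algebraMap_iff_spectrum_le (a := star c * c) hcsa).1
        CStarAlgebra.star_mul_le_algebraMap_norm_sq t ht
      have h2 : t / r ^ 2 ≤ 1 := (div_le_one (by positivity)).2 h1
      simp [hf, max_eq_left h2]
    rw [map_mul, hqk, mul_one, hb]
  · have h1 : star (b * k) * (b * k) = cfc (fun t => f t * t * f t) (star b * b) := by
      rw [cfc_mul (fun t => f t * t) f _ (hfc.mul continuous_id).continuousOn hfc.continuousOn,
        cfc_mul f (fun t => t) _ hfc.continuousOn continuousOn_id, cfc_id' ℝ _ hsa, star_mul, hks]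
      simp only [mul_assoc, hk]
    have h2 : ‖cfc (fun t => f t * t * f t) (star b * b)‖ ≤ r ^ 2 := by
      refine norm_cfc_le (by positivity) fun t ht => ?_
      have ht0 : 0 ≤ t := spectrum_nonneg_of_nonneg hpos ht
      have hm : 0 < max 1 (t / r ^ 2) := lt_of_lt_of_le one_pos (le_max_left 1 _)
      have h3 : f t * t * f t = t / max 1 (t / r ^ 2) := by
        rw [hf]
        dsimp only
        rw [mul_right_comm, ← mul_inv, Real.mul_self_sqrt hm.le]
        ring
      rw [h3, Real.norm_of_nonneg (by positivity), div_le_iff₀ hm]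
      calc t = r ^ 2 * (t / r ^ 2) := by field_simp
        _ ≤ _ := by gcongr; exact le_max_right _ _
    rw [← h1, CStarRing.norm_star_mul_self] at h2
    nlinarith [norm_nonneg (b * k)]

/-- Positive contractions in the kernel of a ⋆-homomorphism form an approximate unit. -/
theorem exists_approx_unit (q : B →⋆ₐ[ℂ] C) {κ : Type*} [Finite κ] {x : κ → B}
    (hx : ∀ k, q (x k) = 0) {ε : ℝ} (hε : 0 < ε) :
    ∃ e : B, 0 ≤ e ∧ e ≤ 1 ∧ q e = 0 ∧ ∀ k, ‖x k - x k * e‖ ≤ ε := by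
  have := Fintype.ofFinite κ
  set h := ∑ k, star (x k) * x k with hh
  have hpos : 0 ≤ h := Finset.sum_nonneg fun k _ => star_mul_self_nonneg (x k)
  have hsa : IsSelfAdjoint h := IsSelfAdjoint.of_nonneg hpos
  have hqh : q h = 0 := by simp [hh, hx]
  set δ := ε ^ 2
  have hδ : 0 < δ := by positivity
  set f : ℝ → ℝ := fun t => max t 0 / (max t 0 + δ) with hf
  have hden : ∀ t : ℝ, 0 < max t 0 + δ := fun t => by positivity
  have hfc : Continuous f := by
    rw [hf]
    exact Continuous.div (by fun_prop) (by fun_prop) fun t => (hden t).ne'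
  have hf0 : ∀ t, 0 ≤ f t := fun t => by rw [hf]; positivity
  have hf1 : ∀ t, f t ≤ 1 := fun t => (div_le_one (hden t)).2 (by linarith)
  set e := cfc f h with he
  have hes : star e = e := (cfc_predicate f _ : IsSelfAdjoint e)
  refine ⟨e, cfc_nonneg fun t _ => hf0 t, cfc_le_one _ _ fun t _ => hf1 t, ?_, fun k => ?_⟩
  · rw [he, StarAlgHom.map_cfc q f _ hfc.continuousOn (StarAlgHom.continuous q) hsa
      (by rw [hqh]; exact IsSelfAdjoint.zero C), hqh, ← map_zero (algebraMap ℝ C),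
      cfc_algebraMap]
    simp [hf]
  · have h1 : 1 - e = cfc (fun t => 1 - f t) h := by
      rw [cfc_sub (fun _ => (1 : ℝ)) f h continuousOn_const hfc.continuousOn, cfc_const_one ℝ h]
    have h2 : (1 - e) * h * (1 - e) = cfc (fun t => (1 - f t) * t * (1 - f t)) h := by
      have hc : Continuous fun t => 1 - f t := continuous_const.sub hfc
      rw [cfc_mul (fun t => (1 - f t) * t) (fun t => 1 - f t) _
          (hc.mul continuous_id).continuousOn hc.continuousOn,
        cfc_mul (fun t => 1 - f t) (fun t => t) _ hc.continuousOn continuousOn_id,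
        cfc_id' ℝ _ hsa, h1]
    have h3 : ‖(1 - e) * h * (1 - e)‖ ≤ δ := by
      rw [h2]
      refine norm_cfc_le hδ.le fun t ht => ?_
      have ht0 : 0 ≤ t := spectrum_nonneg_of_nonneg hpos ht
      have h4 : 1 - f t = δ / (t + δ) := by
        rw [hf]
        dsimp only
        rw [max_eq_left ht0]
        have : t + δ ≠ 0 := by positivity
        field_simp
        ring
      rw [h4, Real.norm_of_nonneg (by positivity)]
      have h5 : δ / (t + δ) * t * (δ / (t + δ)) = δ * (δ * t / (t + δ) ^ 2) := by field_simp
      rw [h5]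
      refine mul_le_of_le_one_right hδ.le ((div_le_one (by positivity)).2 ?_)
      nlinarith
    have h1s : star (1 - e) = 1 - e := by rw [star_sub, star_one, hes]
    have h4 : star (x k - x k * e) * (x k - x k * e) ≤ (1 - e) * h * (1 - e) := by
      have h5 : x k - x k * e = x k * (1 - e) := by rw [mul_sub, mul_one]
      have h6 : star (x k) * x k ≤ h :=
        Finset.single_le_sum (f := fun k => star (x k) * x k)
          (fun k _ => star_mul_self_nonneg (x k)) (Finset.mem_univ k)
      have h7 := star_left_conjugate_le_conjugate h6 (1 - e)
      rw [h1s] at h7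
      rw [h5, star_mul, h1s]
      simpa only [mul_assoc] using h7
    have h5 := (CStarAlgebra.norm_le_norm_of_nonneg_of_le (star_mul_self_nonneg _) h4).trans h3
    rw [CStarRing.norm_star_mul_self] at h5
    exact abs_le_of_sq_le_sq' (by rw [sq]; exact h5) hε.le |>.2

/-- The estimate `‖x e + y (1 - e)‖² ≤ ‖x‖² + ‖y‖²` for `0 ≤ e ≤ 1`. -/
theorem norm_mul_add_mul_one_sub_sq_le {e : B} (h0 : 0 ≤ e) (h1 : e ≤ 1) (x y : B) :
    ‖x * e + y * (1 - e)‖ ^ 2 ≤ ‖x‖ ^ 2 + ‖y‖ ^ 2 := by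
  have hes : star e = e := IsSelfAdjoint.of_nonneg h0
  have h1' : 0 ≤ 1 - e := sub_nonneg.2 h1
  have h1s : star (1 - e) = 1 - e := by rw [star_sub, star_one, hes]
  have hc : 0 ≤ e * (1 - e) := by
    have ha := star_left_conjugate_nonneg h0 (1 - e)
    have hb := star_left_conjugate_nonneg h1' e
    rw [h1s] at ha
    rw [hes] at hb
    have := add_nonneg ha hb
    convert this using 1
    noncomm_ring
  have hle : (x * e + y * (1 - e)) * star (x * e + y * (1 - e)) ≤ x * star x + y * star y := by
    rw [← sub_nonneg]
    have ha := star_right_conjugate_nonneg hc (x - y)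
    have hb := star_right_conjugate_nonneg h1' x
    have hd := star_right_conjugate_nonneg h0 y
    have := add_nonneg (add_nonneg ha hb) hd
    convert this using 1
    simp only [star_add, star_sub, star_mul, hes, star_one]
    noncomm_ring
  have hn := CStarAlgebra.norm_le_norm_of_nonneg_of_le (mul_star_self_nonneg _) hle
  rw [CStarRing.norm_self_mul_star] at hn
  have h2 := norm_add_le (x * star x) (y * star y)
  rw [CStarRing.norm_self_mul_star, CStarRing.norm_self_mul_star] at h2
  nlinarith

/-- A bounded functional is uniformly small on `I (1 - e)` once the positive contraction `e` of
the ideal `I` is a unit, up to a small error, for one suitable element of `I`: otherwise its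
norm on `I` would be exceeded. -/
theorem exists_functional_small (q : B →⋆ₐ[ℂ] C) (f : StrongDual ℂ B) {ε : ℝ} (hε : 0 < ε) :
    ∃ (x : B) (η : ℝ), q x = 0 ∧ 0 < η ∧ ∀ e : B, 0 ≤ e → e ≤ 1 → q e = 0 → ‖x - x * e‖ ≤ η →
      ∀ y, q y = 0 → ‖y‖ ≤ 1 → ‖f (y * (1 - e))‖ ≤ ε := by
  let I : Submodule ℂ B := LinearMap.ker (q : B →ₗ[ℂ] C)
  have hI : ∀ y, y ∈ I ↔ q y = 0 := fun y => LinearMap.mem_ker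
  let g : StrongDual ℂ I := f.comp I.subtypeL
  have hg : ∀ y (hy : q y = 0), ‖f y‖ ≤ ‖g‖ * ‖y‖ := fun y hy => g.le_opNorm ⟨y, (hI y).2 hy⟩
  have hgf : ‖g‖ ≤ ‖f‖ := g.opNorm_le_bound (norm_nonneg f) fun y => f.le_opNorm y
  set t : ℝ := ε / (‖f‖ + 4)
  have ht : 0 < t := by positivity
  obtain ⟨x, hqx, hx1, hgx⟩ : ∃ x, q x = 0 ∧ ‖x‖ ≤ 1 ∧ ‖g‖ - t ^ 2 ≤ ‖f x‖ := by
    rcases le_or_gt (‖g‖) (t ^ 2) with h | h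
    · exact ⟨0, map_zero q, by simp, by simpa using h⟩
    · obtain ⟨x, hx1, hx⟩ := g.exists_lt_apply_of_lt_opNorm (r := ‖g‖ - t ^ 2)
        (by linarith [sq_pos_of_pos ht])
      exact ⟨x, (hI _).1 x.2, hx1.le, hx.le⟩
  refine ⟨x, t ^ 2 / (‖f‖ + 1), hqx, by positivity, fun e he0 he1 hqe hxe y hqy hy => ?_⟩
  obtain ⟨α, hα, hαf⟩ : ∃ α : ℂ, ‖α‖ = 1 ∧ α * f (x * e) = (‖f (x * e)‖ : ℂ) := by
    obtain ⟨α, hα, h⟩ := RCLike.exists_norm_eq_mul_self (K := ℂ) (f (x * e))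
    exact ⟨α, hα, h.symm⟩
  obtain ⟨β, hβ, hβf⟩ : ∃ β : ℂ, ‖β‖ = 1 ∧ β * f (y * (1 - e)) = (‖f (y * (1 - e))‖ : ℂ) := by
    obtain ⟨α, hα, h⟩ := RCLike.exists_norm_eq_mul_self (K := ℂ) (f (y * (1 - e)))
    exact ⟨α, hα, h.symm⟩
  set z := (α • x) * e + ((t : ℂ) • β • y) * (1 - e) with hz
  have hqz : q z = 0 := by
    rw [hz, map_add, map_mul, map_mul, map_smul, map_smul, map_smul, hqx, hqy]
    simp
  have hzn : ‖z‖ ^ 2 ≤ 1 + t ^ 2 := by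
    refine (norm_mul_add_mul_one_sub_sq_le he0 he1 _ _).trans ?_
    rw [norm_smul, norm_smul, norm_smul, hα, hβ, Complex.norm_real, Real.norm_of_nonneg ht.le,
      one_mul, one_mul, mul_pow]
    have h1 : ‖x‖ ^ 2 ≤ 1 := pow_le_one₀ (norm_nonneg x) hx1
    have h2 : ‖y‖ ^ 2 ≤ 1 := pow_le_one₀ (norm_nonneg y) hy
    nlinarith [sq_nonneg t]
  have hzn' : ‖z‖ ≤ 1 + t ^ 2 / 2 := by
    refine abs_le_of_sq_le_sq' (hzn.trans ?_) (by positivity) |>.2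
    nlinarith [sq_nonneg (t ^ 2)]
  have hfz : f z = ((‖f (x * e)‖ + t * ‖f (y * (1 - e))‖ : ℝ) : ℂ) := by
    rw [hz, map_add, smul_mul_assoc, smul_mul_assoc, smul_mul_assoc, map_smul, map_smul, map_smul,
      smul_eq_mul, smul_eq_mul, smul_eq_mul, hαf, hβf]
    push_cast
    ring
  have h1 := hg z hqz
  rw [hfz, Complex.norm_real, Real.norm_of_nonneg (by positivity)] at h1
  have h2 : ‖f x‖ ≤ ‖f (x * e)‖ + t ^ 2 := by
    have h3 : f x = f (x * e) + f (x - x * e) := by rw [← map_add]; congr 1; abel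
    have h4 : ‖f (x - x * e)‖ ≤ t ^ 2 := by
      calc ‖f (x - x * e)‖ ≤ ‖f‖ * ‖x - x * e‖ := f.le_opNorm _
        _ ≤ ‖f‖ * (t ^ 2 / (‖f‖ + 1)) := by gcongr
        _ = t ^ 2 * (‖f‖ / (‖f‖ + 1)) := by ring
        _ ≤ t ^ 2 := mul_le_of_le_one_right (by positivity)
            ((div_le_one (by positivity)).2 (by linarith))
    rw [h3]
    exact (norm_add_le _ _).trans (by linarith)
  have h3 : ‖g‖ * ‖z‖ ≤ ‖g‖ + ‖f‖ * t ^ 2 / 2 := by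
    calc ‖g‖ * ‖z‖ ≤ ‖g‖ * (1 + t ^ 2 / 2) := by gcongr
      _ = ‖g‖ + ‖g‖ * (t ^ 2 / 2) := by ring
      _ ≤ ‖g‖ + ‖f‖ * (t ^ 2 / 2) := by gcongr
      _ = _ := by ring
  have h4 : t * ‖f (y * (1 - e))‖ ≤ t * ε := by
    have h5 : t * (‖f‖ + 4) = ε := div_mul_cancel₀ _ (by positivity)
    have h6 : t * ε = t ^ 2 * (‖f‖ + 4) := by rw [← h5]; ring
    rw [h6]
    nlinarith [norm_nonneg f, sq_nonneg t]
  exact le_of_mul_le_mul_left h4 ht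

/-- Positive contractions in the kernel of a ⋆-homomorphism can be chosen to commute up to `ε`
with finitely many elements: commutators tend to zero weakly along the approximate unit, hence
in norm after passing to convex combinations. -/
theorem exists_quasicentral (q : B →⋆ₐ[ℂ] C) {κ κ' : Type*} [Finite κ] [Finite κ'] {x : κ → B}
    (hx : ∀ k, q (x k) = 0) (b : κ' → B) {ε : ℝ} (hε : 0 < ε) :
    ∃ e : B, 0 ≤ e ∧ e ≤ 1 ∧ q e = 0 ∧ (∀ k, ‖x k - x k * e‖ ≤ ε) ∧
      ∀ k, ‖e * b k - b k * e‖ ≤ ε := by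
  classical
  have := Fintype.ofFinite κ
  have := Fintype.ofFinite κ'
  let S : Set B := {e | 0 ≤ e ∧ e ≤ 1 ∧ q e = 0 ∧ ∀ k, ‖x k - x k * e‖ ≤ ε}
  have hS : Convex ℝ S := by
    rintro e ⟨he0, he1, hqe, hxe⟩ e' ⟨he0', he1', hqe', hxe'⟩ s t hs ht hst
    refine ⟨add_nonneg (smul_nonneg hs he0) (smul_nonneg ht he0'), ?_, ?_, fun k => ?_⟩
    · calc s • e + t • e' ≤ s • (1 : B) + t • (1 : B) :=
            add_le_add (smul_le_smul_of_nonneg_left he1 hs) (smul_le_smul_of_nonneg_left he1' ht)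
        _ = 1 := by rw [← add_smul, hst, one_smul]
    · rw [← Complex.coe_smul s e, ← Complex.coe_smul t e', map_add, map_smul, map_smul, hqe, hqe']
      simp
    · have h1 : x k - x k * (s • e + t • e') = s • (x k - x k * e) + t • (x k - x k * e') := by
        rw [mul_add, mul_smul_comm, mul_smul_comm, smul_sub, smul_sub,
          ← sub_eq_zero]
        have : s • x k + t • x k = x k := by rw [← add_smul, hst, one_smul]
        nth_rewrite 1 [← this]
        abel
      rw [h1]
      refine (norm_add_le _ _).trans ?_
      rw [norm_smul, norm_smul, Real.norm_of_nonneg hs, Real.norm_of_nonneg ht]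
      calc s * ‖x k - x k * e‖ + t * ‖x k - x k * e'‖ ≤ s * ε + t * ε :=
            add_le_add (mul_le_mul_of_nonneg_left (hxe k) hs)
              (mul_le_mul_of_nonneg_left (hxe' k) ht)
        _ = ε := by rw [← add_mul, hst, one_mul]
  let Λ : B →ₗ[ℝ] (κ' → B) := LinearMap.pi fun k =>
    LinearMap.mulRight ℝ (b k) - LinearMap.mulLeft ℝ (b k)
  have hΛ : ∀ e k, Λ e k = e * b k - b k * e := fun e k => rfl
  by_cases h0 : (0 : κ' → B) ∈ closure (Λ '' S)
  · obtain ⟨_, ⟨e, ⟨he0, he1, hqe, hxe⟩, rfl⟩, he⟩ := Metric.mem_closure_iff.1 h0 ε hε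
    rw [dist_zero_left] at he
    exact ⟨e, he0, he1, hqe, hxe, fun k => by
      rw [← hΛ]; exact (norm_le_pi_norm (Λ e) k).trans he.le⟩
  exfalso
  obtain ⟨f, u, hfu, hu⟩ := RCLike.geometric_hahn_banach_closed_point (𝕜 := ℂ)
    (hS.linear_image Λ).closure isClosed_closure h0
  rw [map_zero, map_zero] at hu
  let fk : κ' → StrongDual ℂ B := fun k => f.comp (ContinuousLinearMap.single ℂ (fun _ => B) k)
  have hfk : ∀ y, f y = ∑ k, fk k (y k) := fun y => by
    conv_lhs => rw [← Finset.univ_sum_single y, map_sum]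
    rfl
  let st : StrongDual ℂ B → StrongDual ℂ B := fun g =>
    { toFun := fun y => star (g (star y))
      map_add' := fun y z => by simp
      map_smul' := fun c y => by simp
      cont := by fun_prop }
  have hst : ∀ g y, st g y = star (g (star y)) := fun g y => rfl
  obtain ⟨M, hM0, hM⟩ : ∃ M : ℝ, 0 < M ∧ ∀ k, ‖b k‖ ≤ M := by
    obtain ⟨M, hM⟩ := (Set.finite_range fun k => ‖b k‖).bddAbove
    exact ⟨|M| + 1, by positivity, fun k => (hM ⟨k, rfl⟩).trans
      ((le_abs_self M).trans (by linarith))⟩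
  set ε' : ℝ := -u / (4 * M * (Fintype.card κ' + 1))
  have hε' : 0 < ε' := div_pos (by linarith) (by positivity)
  choose y₁ η₁ hy₁ hη₁ H₁ using fun k => exists_functional_small q (fk k) hε'
  choose y₂ η₂ hy₂ hη₂ H₂ using fun k => exists_functional_small q (st (fk k)) hε'
  obtain ⟨η, hη, hη'⟩ : ∃ η : ℝ, 0 < η ∧ η ≤ ε ∧ (∀ k, η ≤ η₁ k) ∧ ∀ k, η ≤ η₂ k := by
    have hfin := Set.finite_range (Sum.elim (fun _ : Unit => ε) (Sum.elim η₁ η₂))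
    have hne := Set.range_nonempty (Sum.elim (fun _ : Unit => ε) (Sum.elim η₁ η₂))
    obtain ⟨i, hi⟩ := hne.csInf_mem hfin
    refine ⟨sInf (Set.range (Sum.elim (fun _ : Unit => ε) (Sum.elim η₁ η₂))), ?_, ?_, ?_, ?_⟩
    · rw [← hi]
      rcases i with i | i | i
      · exact hε
      · exact hη₁ i
      · exact hη₂ i
    · exact csInf_le hfin.bddBelow ⟨Sum.inl (), rfl⟩
    · exact fun k => csInf_le hfin.bddBelow ⟨Sum.inr (Sum.inl k), rfl⟩
    · exact fun k => csInf_le hfin.bddBelow ⟨Sum.inr (Sum.inr k), rfl⟩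
  obtain ⟨e, he0, he1, hqe, hxe⟩ := exists_approx_unit q
    (x := Sum.elim x (Sum.elim y₁ y₂)) (by rintro (k | k | k) <;> simp [hx, hy₁, hy₂]) hη
  have hes : star e = e := IsSelfAdjoint.of_nonneg he0
  have heS : e ∈ S := ⟨he0, he1, hqe, fun k => (hxe (Sum.inl k)).trans hη'.1⟩
  have hen : ‖e‖ ≤ 1 := (CStarAlgebra.norm_le_one_iff_of_nonneg e he0).2 he1
  have hscale : ∀ (g : StrongDual ℂ B), (∀ y, q y = 0 → ‖y‖ ≤ 1 → ‖g (y * (1 - e))‖ ≤ ε') →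
      ∀ y, q y = 0 → ‖y‖ ≤ M → ‖g (y * (1 - e))‖ ≤ M * ε' := by
    intro g hg y hy hyM
    have h1 := hg ((M : ℂ)⁻¹ • y) (by rw [map_smul, hy, smul_zero]) (by
      rw [norm_smul, norm_inv, Complex.norm_real, Real.norm_of_nonneg hM0.le]
      rw [inv_mul_le_iff₀ hM0]; simpa using hyM)
    rw [smul_mul_assoc, map_smul, norm_smul, norm_inv, Complex.norm_real,
      Real.norm_of_nonneg hM0.le, inv_mul_le_iff₀ hM0] at h1
    exact h1
  have hkey : ∀ k, ‖fk k (e * b k - b k * e)‖ ≤ 2 * (M * ε') := by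
    intro k
    have h1 := hscale (fk k) (H₁ k e he0 he1 hqe ((hxe (Sum.inr (Sum.inl k))).trans (hη'.2.1 k)))
      (e * b k) (by rw [map_mul, hqe, zero_mul])
      ((norm_mul_le _ _).trans ((mul_le_of_le_one_left (norm_nonneg _) hen).trans (hM k)))
    have h2 := hscale (st (fk k))
      (H₂ k e he0 he1 hqe ((hxe (Sum.inr (Sum.inr k))).trans (hη'.2.2 k)))
      (e * star (b k)) (by rw [map_mul, hqe, zero_mul])
      ((norm_mul_le _ _).trans ((mul_le_of_le_one_left (norm_nonneg _) hen).trans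
        (by rw [norm_star]; exact hM k)))
    rw [hst, norm_star, star_mul, star_mul, star_sub, star_one, hes, star_star] at h2
    have h3 : e * b k - b k * e = e * b k * (1 - e) - (1 - e) * (b k * e) := by noncomm_ring
    rw [h3, map_sub]
    exact (norm_sub_le _ _).trans (by linarith)
  have h1 := hfu (Λ e) (subset_closure ⟨e, heS, rfl⟩)
  have h2 : ‖f (Λ e)‖ ≤ Fintype.card κ' * (2 * (M * ε')) := by
    rw [hfk]
    refine (norm_sum_le _ _).trans ((Finset.sum_le_sum fun k _ => ?_).trans
      (by rw [Finset.sum_const, nsmul_eq_mul, Finset.card_univ]))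
    rw [hΛ]
    exact hkey k
  have h3 : -‖f (Λ e)‖ ≤ RCLike.re (f (Λ e)) := by
    have := RCLike.abs_re_le_norm (f (Λ e))
    exact neg_le_of_abs_le this
  have h4 : (Fintype.card κ' : ℝ) * (2 * (M * ε')) ≤ -u / 2 := by
    have h5 : (4 * M * (Fintype.card κ' + 1)) * ε' = -u := mul_div_cancel₀ _ (by positivity)
    nlinarith [mul_pos hM0 hε']
  linarith

/-- If `e` almost commutes with `b`, so does `g(e)`. -/
theorem exists_commutator_cfc_small {g : ℝ → ℝ} (hg : Continuous g) (b : B) {ε : ℝ}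
    (hε : 0 < ε) : ∃ δ : ℝ, 0 < δ ∧ ∀ e : B, 0 ≤ e → e ≤ 1 → ‖e * b - b * e‖ ≤ δ →
      ‖cfc g e * b - b * cfc g e‖ ≤ ε := by
  obtain ⟨p, hp⟩ := exists_polynomial_near_of_continuousOn 0 1 g hg.continuousOn
    (ε / (4 * (‖b‖ + 1))) (by positivity)
  have hpoly : ∀ p : Polynomial ℝ, ∃ K : ℝ, 0 ≤ K ∧ ∀ e : B, ‖e‖ ≤ 1 →
      ‖Polynomial.aeval e p * b - b * Polynomial.aeval e p‖ ≤ K * ‖e * b - b * e‖ := by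
    intro p
    induction p using Polynomial.induction_on' with
    | add p q hp hq =>
      obtain ⟨K, hK0, hK⟩ := hp
      obtain ⟨K', hK0', hK'⟩ := hq
      refine ⟨K + K', by positivity, fun e he => ?_⟩
      rw [map_add, add_mul K, show ∀ x y : B, (x + y) * b - b * (x + y) =
        (x * b - b * x) + (y * b - b * y) from fun x y => by noncomm_ring]
      exact (norm_add_le _ _).trans (add_le_add (hK e he) (hK' e he))
    | monomial m c =>
      refine ⟨|c| * m, by positivity, fun e he => ?_⟩
      have hm : ∀ m : ℕ, ‖e ^ m * b - b * e ^ m‖ ≤ m * ‖e * b - b * e‖ := by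
        intro m
        induction m with
        | zero => simp
        | succ m ih =>
          have h1 : e ^ (m + 1) * b - b * e ^ (m + 1) =
              e * (e ^ m * b - b * e ^ m) + (e * b - b * e) * e ^ m := by
            rw [pow_succ']; noncomm_ring
          rw [h1]
          have h2 : ‖(e * b - b * e) * e ^ m‖ ≤ ‖e * b - b * e‖ := by
            rcases Nat.eq_zero_or_pos m with rfl | hm
            · simp
            · exact (norm_mul_le _ _).trans (mul_le_of_le_one_right (norm_nonneg _)
                ((norm_pow_le' e hm).trans (pow_le_one₀ (norm_nonneg e) he)))
          have h3 : ‖e * (e ^ m * b - b * e ^ m)‖ ≤ m * ‖e * b - b * e‖ :=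
            (norm_mul_le _ _).trans ((mul_le_of_le_one_left (norm_nonneg _) he).trans ih)
          push_cast
          exact (norm_add_le _ _).trans (by linarith)
      rw [Polynomial.aeval_monomial, mul_assoc, ← Algebra.smul_def, ← Algebra.smul_def,
        mul_smul_comm, ← smul_sub, norm_smul, Real.norm_eq_abs, mul_assoc]
      exact mul_le_mul_of_nonneg_left (hm m) (abs_nonneg c)
  obtain ⟨K, hK0, hK⟩ := hpoly p
  refine ⟨ε / (2 * (K + 1)), by positivity, fun e he0 he1 he => ?_⟩
  have hsa : IsSelfAdjoint e := IsSelfAdjoint.of_nonneg he0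
  have hen : ‖e‖ ≤ 1 := (CStarAlgebra.norm_le_one_iff_of_nonneg e he0).2 he1
  have hd : ‖cfc g e - Polynomial.aeval e p‖ ≤ ε / (4 * (‖b‖ + 1)) := by
    rw [← cfc_polynomial p e hsa, ← cfc_sub g p.eval e hg.continuousOn p.continuous.continuousOn]
    refine norm_cfc_le (by positivity) fun t ht => ?_
    have ht0 : 0 ≤ t := spectrum_nonneg_of_nonneg he0 ht
    have ht1 : t ≤ 1 := (le_algebraMap_iff_spectrum_le (r := (1 : ℝ)) (a := e) hsa).1
      (by simpa using he1) t ht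
    rw [Real.norm_eq_abs, abs_sub_comm]
    exact (hp t ⟨ht0, ht1⟩).le
  have h1 : cfc g e * b - b * cfc g e = (cfc g e - Polynomial.aeval e p) * b -
      b * (cfc g e - Polynomial.aeval e p) +
      (Polynomial.aeval e p * b - b * Polynomial.aeval e p) := by noncomm_ring
  have h2 : ‖(cfc g e - Polynomial.aeval e p) * b‖ ≤ ε / 4 := by
    refine (norm_mul_le _ _).trans ((mul_le_mul_of_nonneg_right hd (norm_nonneg b)).trans ?_)
    rw [div_mul_eq_mul_div, div_le_div_iff₀ (by positivity) (by norm_num)]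
    nlinarith [norm_nonneg b]
  have h3 : ‖b * (cfc g e - Polynomial.aeval e p)‖ ≤ ε / 4 := by
    refine (norm_mul_le _ _).trans ((mul_le_mul_of_nonneg_left hd (norm_nonneg b)).trans ?_)
    rw [mul_div_assoc', div_le_div_iff₀ (by positivity) (by norm_num)]
    nlinarith [norm_nonneg b]
  have h4 : K * ‖e * b - b * e‖ ≤ ε / 2 := by
    refine (mul_le_mul_of_nonneg_left he hK0).trans ?_
    rw [mul_div_assoc', div_le_div_iff₀ (by positivity) (by norm_num)]
    nlinarith
  rw [h1]
  refine (norm_add_le _ _).trans ?_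
  have := norm_sub_le ((cfc g e - Polynomial.aeval e p) * b) (b * (cfc g e - Polynomial.aeval e p))
  linarith [hK e hen]

end Ordered

end QuasiCentral

/-! ### The local lifting property -/

section LocalLifting

open Filter Topology

theorem exists_pos_forall_le {κ : Type*} [Finite κ] {δ : κ → ℝ} (hδ : ∀ k, 0 < δ k) :
    ∃ η : ℝ, 0 < η ∧ ∀ k, η ≤ δ k := by
  have h : ∀ k, ∀ᶠ η in 𝓝[>] (0 : ℝ), η ≤ δ k := fun k =>
    mem_nhdsWithin_of_mem_nhds (Iic_mem_nhds (hδ k))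
  obtain ⟨η, h1, h2⟩ := ((eventually_all.2 h).and self_mem_nhdsWithin).exists
  exact ⟨η, h2, h1⟩

variable {A B C : Type*} [CStarAlgebra A] [CStarAlgebra B] [CStarAlgebra C]

/-- A C⋆-convex combination of two ucp maps is ucp. -/
theorem isUCP_sandwich_add {ψ₀ ψ₁ : A →ₗ[ℂ] B} (h₀ : IsUCP ψ₀) (h₁ : IsUCP ψ₁) {f g : B}
    (hfg : star f * f + star g * g = 1) : ∃ ψ : A →ₗ[ℂ] B, IsUCP ψ ∧
      ∀ a, ψ a = star f * ψ₀ a * f + star g * ψ₁ a * g := by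
  let ψ : A →ₗ[ℂ] B := (LinearMap.mulLeftRight ℂ (star f, f)) ∘ₗ ψ₀ +
    (LinearMap.mulLeftRight ℂ (star g, g)) ∘ₗ ψ₁
  have hψ : ∀ a, ψ a = star f * ψ₀ a * f + star g * ψ₁ a * g := fun a => by
    simp [ψ, LinearMap.mulLeftRight_apply]
  have key : ∀ {r : ℕ} {φ : A →ₗ[ℂ] B} (hφ : IsUCP φ) {X : Matrix (Fin r) (Fin r) A}
      (hX : MatPos X) (h : B), MatPos (X.map fun a => star h * φ a * h) := by
    intro r φ hφ X hX h
    have := (hφ.map_matPos r X hX).conjTranspose_mul_mul (Matrix.diagonal fun _ => h)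
    convert this using 1
    ext i j
    simp [Matrix.diagonal_conjTranspose, Matrix.mul_diagonal, Matrix.diagonal_mul]
  refine ⟨ψ, ⟨?_, fun r X hX => ?_⟩, hψ⟩
  · rw [hψ, h₀.map_one, h₁.map_one, mul_one, mul_one, hfg]
  · convert (key h₀ hX f).add (key h₁ hX g) using 1
    ext i j
    simp [hψ]

/-- Two ucp maps that nearly agree modulo the kernel of `q` can be patched along a quasicentral
element: the result has the values of the second one modulo the kernel, and is close to the
first one. -/
theorem exists_isUCP_patch {q : B →⋆ₐ[ℂ] C} (hq : Function.Surjective q) {ψ₀ ψ₁ : A →ₗ[ℂ] B}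
    (h₀ : IsUCP ψ₀) (h₁ : IsUCP ψ₁) {κ : Type*} [Finite κ] (t : κ → A) {ε : ℝ} (hε : 0 < ε) :
    ∃ ψ : A →ₗ[ℂ] B, IsUCP ψ ∧ (∀ a, q (ψ a) = q (ψ₁ a)) ∧
      ∀ k, ‖ψ (t k) - ψ₀ (t k)‖ ≤ ‖q (ψ₁ (t k)) - q (ψ₀ (t k))‖ + ε := by
  let _ := CStarAlgebra.spectralOrder B
  have := CStarAlgebra.spectralOrderedRing B
  choose D hD hDn using fun k => exists_lift_norm_le hq (q (ψ₁ (t k)) - q (ψ₀ (t k)))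
  -- `D k` lifts the discrepancy modulo the kernel with the same norm, so that the rest `x k` is in
  -- the kernel
  set x : κ → B := fun k => ψ₁ (t k) - ψ₀ (t k) - D k with hx
  have hqx : ∀ k, q (x k) = 0 := fun k => by simp [hx, hD]
  have hcf : Continuous fun t : ℝ => √t := Real.continuous_sqrt
  have hcg : Continuous fun t : ℝ => √(1 - t) := by fun_prop
  choose δf hδf hf using fun k => exists_commutator_cfc_small hcf (ψ₀ (t k)) (ε := ε / 4)
    (by positivity)
  choose δg hδg hg using fun k => exists_commutator_cfc_small hcg (ψ₀ (t k)) (ε := ε / 4)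
    (by positivity)
  have hδx : ∀ k, 0 < ε ^ 2 / (4 * (‖x k‖ + 1)) := fun k => by positivity
  obtain ⟨η, hη, hηk⟩ := exists_pos_forall_le fun k =>
    lt_min (hδx k) (lt_min (hδf k) (hδg k))
  obtain ⟨e, he0, he1, hqe, hxe, hbe⟩ := exists_quasicentral q hqx (fun k => ψ₀ (t k)) hη
  have hsa : IsSelfAdjoint e := IsSelfAdjoint.of_nonneg he0
  have hsp : ∀ t ∈ spectrum ℝ e, 0 ≤ t ∧ t ≤ 1 := fun t ht =>
    ⟨spectrum_nonneg_of_nonneg he0 ht, (le_algebraMap_iff_spectrum_le (r := (1 : ℝ)) (a := e)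
      hsa).1 (by simpa using he1) t ht⟩
  set f : B := cfc (fun t : ℝ => √t) e with hfdef
  set g : B := cfc (fun t : ℝ => √(1 - t)) e with hgdef
  have hfs : star f = f := (cfc_predicate _ e : IsSelfAdjoint f)
  have hgs : star g = g := (cfc_predicate _ e : IsSelfAdjoint g)
  have hff : f * f = e := by
    rw [hfdef, ← cfc_mul _ _ e hcf.continuousOn hcf.continuousOn]
    conv_rhs => rw [← cfc_id' ℝ e hsa]
    exact cfc_congr fun t ht => Real.mul_self_sqrt (hsp t ht).1
  have hgg : g * g = 1 - e := by
    rw [hgdef, ← cfc_mul _ _ e hcg.continuousOn hcg.continuousOn]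
    conv_rhs => rw [← cfc_id' ℝ e hsa, ← cfc_one ℝ e hsa, ← cfc_sub _ _ e (by fun_prop)
      (by fun_prop)]
    exact cfc_congr fun t ht => Real.mul_self_sqrt (sub_nonneg.2 (hsp t ht).2)
  have hfn : ‖f‖ ≤ 1 := norm_cfc_le one_pos.le fun t ht => by
    rw [Real.norm_of_nonneg (Real.sqrt_nonneg _)]
    exact Real.sqrt_le_one.2 (hsp t ht).2
  have hgn : ‖g‖ ≤ 1 := norm_cfc_le one_pos.le fun t ht => by
    rw [Real.norm_of_nonneg (Real.sqrt_nonneg _)]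
    exact Real.sqrt_le_one.2 (by linarith [(hsp t ht).1])
  have hqf : q f = 0 := by
    rw [hfdef, StarAlgHom.map_cfc q _ e hcf.continuousOn (StarAlgHom.continuous q) hsa
      (by rw [hqe]; exact IsSelfAdjoint.zero C), hqe, ← map_zero (algebraMap ℝ C), cfc_algebraMap]
    simp
  have hqg : q g = 1 := by
    rw [hgdef, StarAlgHom.map_cfc q _ e hcg.continuousOn (StarAlgHom.continuous q) hsa
      (by rw [hqe]; exact IsSelfAdjoint.zero C), hqe, ← map_zero (algebraMap ℝ C), cfc_algebraMap]
    simp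
  -- `f = √e` and `g = √(1 - e)`: use `ψ₁` away from the kernel and `ψ₀` on it
  obtain ⟨ψ, hψ, hψa⟩ := isUCP_sandwich_add h₀ h₁ (f := f) (g := g) (by
    rw [hfs, hgs, hff, hgg, add_sub_cancel])
  rw [hfs, hgs] at hψa
  refine ⟨ψ, hψ, fun a => ?_, fun k => ?_⟩
  · rw [hψa]
    simp [hqf, hqg]
  · have e1 : ψ (t k) - ψ₀ (t k) = (f * ψ₀ (t k) - ψ₀ (t k) * f) * f +
        (g * ψ₀ (t k) - ψ₀ (t k) * g) * g + g * D k * g + g * (x k * g) := by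
      have e2 : ψ₀ (t k) = ψ₀ (t k) * (f * f) + ψ₀ (t k) * (g * g) := by
        rw [hff, hgg, ← mul_add, add_sub_cancel, mul_one]
      rw [hψa]
      nth_rewrite 2 [e2]
      simp only [hx]
      noncomm_ring
    have hk := hηk k
    have n1 : ‖(f * ψ₀ (t k) - ψ₀ (t k) * f) * f‖ ≤ ε / 4 :=
      (norm_mul_le _ _).trans (mul_le_of_le_one_right (norm_nonneg _) hfn |>.trans
        (hf k e he0 he1 ((hbe k).trans (hk.trans ((min_le_right _ _).trans (min_le_left _ _))))))
    have n2 : ‖(g * ψ₀ (t k) - ψ₀ (t k) * g) * g‖ ≤ ε / 4 :=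
      (norm_mul_le _ _).trans (mul_le_of_le_one_right (norm_nonneg _) hgn |>.trans
        (hg k e he0 he1 ((hbe k).trans (hk.trans ((min_le_right _ _).trans (min_le_right _ _))))))
    have n3 : ‖g * D k * g‖ ≤ ‖q (ψ₁ (t k)) - q (ψ₀ (t k))‖ :=
      (norm_mul_le _ _).trans (mul_le_of_le_one_right (norm_nonneg _) hgn |>.trans
        ((norm_mul_le _ _).trans (mul_le_of_le_one_left (norm_nonneg _) hgn |>.trans (hDn k))))
    have n4 : ‖x k * g‖ ≤ ε / 2 := by
      refine abs_le_of_sq_le_sq' ?_ (by positivity) |>.2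
      have e3 : (x k * g) * star (x k * g) = (x k - x k * e) * star (x k) := by
        rw [star_mul, hgs, mul_assoc, ← mul_assoc g, hgg]
        noncomm_ring
      rw [sq, ← CStarRing.norm_self_mul_star, e3]
      refine (norm_mul_le _ _).trans ?_
      rw [norm_star]
      have h5 := (hxe k).trans (hk.trans (min_le_left _ _))
      rw [le_div_iff₀ (by positivity)] at h5
      nlinarith [norm_nonneg (x k), norm_nonneg (x k - x k * e)]
    have n5 : ‖g * (x k * g)‖ ≤ ε / 2 :=
      (norm_mul_le _ _).trans (mul_le_of_le_one_left (norm_nonneg _) hgn |>.trans n4)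
    rw [e1]
    refine (norm_add_le _ _).trans ?_
    have m1 := norm_add_le ((f * ψ₀ (t k) - ψ₀ (t k) * f) * f +
        (g * ψ₀ (t k) - ψ₀ (t k) * g) * g) (g * D k * g)
    have m2 := norm_add_le ((f * ψ₀ (t k) - ψ₀ (t k) * f) * f)
        ((g * ψ₀ (t k) - ψ₀ (t k) * g) * g)
    linarith

/-- `A` has the local lifting property as soon as ucp maps into quotients lift approximately on
finite sets: approximate lifts can be corrected to a norm convergent sequence. -/
theorem hasLLP_of_approx {A : Type u} [CStarAlgebra A]
    (h : ∀ (B : Type v) (C : Type w) [CStarAlgebra B] [CStarAlgebra C] (q : B →⋆ₐ[ℂ] C),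
      Function.Surjective q → ∀ φ : A →ₗ[ℂ] C, IsUCP φ → ∀ (m : ℕ) (t : Fin m → A) (ε : ℝ), 0 < ε →
      ∃ ψ : A →ₗ[ℂ] B, IsUCP ψ ∧ ∀ k, ‖q (ψ (t k)) - φ (t k)‖ ≤ ε) :
    HasLLP.{u, v, w} A := by
  intro B C _ _ q hq φ hφ T hT hfd
  let b := Module.finBasis ℂ T
  let t : Fin (Module.finrank ℂ T) → A := fun k => b k
  -- `P r` holds for lifts with error at most `2⁻ʳ`; successive lifts differ by at most `3 · 2⁻ʳ`,
  -- so they converge in norm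
  let P : ℕ → (A →ₗ[ℂ] B) → Prop := fun r ψ =>
    IsUCP ψ ∧ ∀ j, ‖q (ψ (t j)) - φ (t j)‖ ≤ (1 / 2) ^ r
  have hP0 : ∃ ψ, P 0 ψ := h B C q hq φ hφ _ t _ (by positivity)
  have hstep : ∀ r ψ, P r ψ → ∃ ψ', P (r + 1) ψ' ∧
      ∀ j, ‖ψ' (t j) - ψ (t j)‖ ≤ 3 * (1 / 2) ^ r := by
    intro r ψ hψ
    obtain ⟨ψ₁, h₁, h₁t⟩ := h B C q hq φ hφ _ t ((1 / 2) ^ (r + 1)) (by positivity)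
    obtain ⟨ψ', h', hq', ht'⟩ := exists_isUCP_patch hq hψ.1 h₁ t (ε := (1 / 2) ^ r) (by positivity)
    refine ⟨ψ', ⟨h', fun j => by rw [hq']; exact h₁t j⟩, fun j => (ht' j).trans ?_⟩
    have e1 : q (ψ₁ (t j)) - q (ψ (t j)) =
        (q (ψ₁ (t j)) - φ (t j)) - (q (ψ (t j)) - φ (t j)) := by abel
    have e2 := norm_sub_le (q (ψ₁ (t j)) - φ (t j)) (q (ψ (t j)) - φ (t j))
    rw [← e1] at e2
    have e3 := h₁t j
    have e4 := hψ.2 j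
    rw [pow_succ] at e3
    have : (0 : ℝ) < (1 / 2) ^ r := by positivity
    linarith
  choose! nxt hnxt hdist using hstep
  obtain ⟨ψ₀, hψ₀⟩ := hP0
  let Ψ : ℕ → (A →ₗ[ℂ] B) := fun r => Nat.rec ψ₀ (fun r ψ => nxt r ψ) r
  have hΨ : ∀ r, P r (Ψ r) := fun r => by
    induction r with
    | zero => exact hψ₀
    | succ r ih => exact hnxt r _ ih
  have hlim : ∀ j, ∃ c, Tendsto (fun r => Ψ r (t j)) atTop (𝓝 c) := fun j => by
    refine cauchySeq_tendsto_of_complete (cauchySeq_of_le_geometric (1 / 2) 3 (by norm_num) ?_)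
    intro r
    rw [dist_comm, dist_eq_norm]
    exact hdist r _ (hΨ r) j
  choose c hc using hlim
  let ψ : T →ₗ[ℂ] B := b.constr ℂ c
  have hsum : ∀ x : T, (x : A) = ∑ j, b.repr x j • t j := fun x => by
    conv_lhs => rw [← b.sum_repr x]
    exact (AddSubmonoidClass.coe_finsetSum _ _).trans rfl
  have hψlim : ∀ x : T, Tendsto (fun r => Ψ r (x : A)) atTop (𝓝 (ψ x)) := by
    intro x
    have e1 : ∀ r, Ψ r (x : A) = ∑ j, b.repr x j • Ψ r (t j) := fun r => by
      conv_lhs => rw [hsum x, map_sum]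
      simp only [map_smul]
    have e2 : ψ x = ∑ j, b.repr x j • c j := by
      rw [Module.Basis.constr_apply_fintype]
      simp [Module.Basis.equivFun_apply]
    simp only [e1, e2]
    exact tendsto_finsetSum _ fun j _ => (hc j).const_smul _
  refine ⟨ψ, ⟨?_, fun r X hX => ?_⟩, fun x => ?_⟩
  · refine tendsto_nhds_unique (hψlim ⟨1, hT.one_mem⟩) ?_
    simp only [(hΨ _).1.map_one]
    exact tendsto_const_nhds
  · have hm : Tendsto (fun k => (X.map (fun x : T => (x : A))).map (Ψ k)) atTop (𝓝 (X.map ψ)) :=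
      tendsto_pi_nhds.2 fun i => tendsto_pi_nhds.2 fun j => hψlim (X i j)
    exact isClosed_matPos.mem_of_tendsto hm
      (Eventually.of_forall fun k => (hΨ k).1.map_matPos r _ hX)
  · have e1 : ∀ x : T, φ x = ∑ j, b.repr x j • φ (t j) := fun x => by
      conv_lhs => rw [hsum x, map_sum]
      simp only [map_smul]
    have e3 : ∀ j, q (c j) = φ (t j) := fun j => by
      refine tendsto_nhds_unique (((StarAlgHom.continuous q).tendsto _).comp (hc j)) ?_
      refine tendsto_iff_norm_sub_tendsto_zero.2 (squeeze_zero (fun _ => norm_nonneg _)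
        (fun r => (hΨ r).2 j) (tendsto_pow_atTop_nhds_zero_of_lt_one (by norm_num) (by norm_num)))
    rw [e1, Module.Basis.constr_apply_fintype]
    simp [Module.Basis.equivFun_apply, e3]

/-- The local lifting property of `U_nc(n)`. -/
theorem Unc.hasLLP (n : ℕ) : HasLLP.{0, u, v} (Unc n) :=
  hasLLP_of_approx fun _ _ _ _ _ hq _ hφ _ t _ hε => exists_approx_lift_of_isUCP hq hφ t hε

end LocalLifting

/-! ### The maximal cone lies in the minimal cone -/

section MaxLeMin

open scoped Kronecker

variable {A B : Type*} [CStarAlgebra A] [CStarAlgebra B]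

theorem tensorToMatrix_tmul {k m : ℕ} (φ : A →ₗ[ℂ] Matrix (Fin k) (Fin k) ℂ)
    (ψ : B →ₗ[ℂ] Matrix (Fin m) (Fin m) ℂ) (a : A) (b : B) :
    tensorToMatrix φ ψ (a ⊗ₜ[ℂ] b) = φ a ⊗ₖ ψ b := rfl

/-- Writing `φ(S) = Y⋆Y` and `ψ(T) = Z⋆Z`, the image of `α (S ⊗ T) α⋆` is `R⋆R` for
`R = (Y ⊗ Z) α⋆`. -/
theorem matPos_map_tensorToMatrix_of_mem_preMaxCone {p k m : ℕ}
    {X : Matrix (Fin p) (Fin p) (A ⊗[ℂ] B)} (hX : X ∈ preMaxCone A B p)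
    {φ : A →ₗ[ℂ] Matrix (Fin k) (Fin k) ℂ} {ψ : B →ₗ[ℂ] Matrix (Fin m) (Fin m) ℂ}
    (hφ : IsUCP φ) (hψ : IsUCP ψ) : MatPos (X.map (tensorToMatrix φ ψ)) := by
  obtain ⟨k', m', S, T, α, hS, hT, rfl⟩ := hX
  obtain ⟨Y, hY⟩ := hφ.map_matPos _ S hS
  obtain ⟨Z, hZ⟩ := hψ.map_matPos _ T hT
  have hY' : ∀ i j, φ (S i j) = ∑ x, (Y x i)ᴴ * Y x j := fun i j =>
    (congrFun (congrFun hY i) j).trans (Matrix.mul_apply ..)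
  have hZ' : ∀ i j, ψ (T i j) = ∑ x, (Z x i)ᴴ * Z x j := fun i j =>
    (congrFun (congrFun hZ i) j).trans (Matrix.mul_apply ..)
  let R : Matrix (Fin k' × Fin m') (Fin p) (Matrix (Fin k × Fin m) (Fin k × Fin m) ℂ) :=
    Matrix.of fun x b => ∑ t : Fin k' × Fin m', star (α b t) • (Y x.1 t.1 ⊗ₖ Z x.2 t.2)
  convert matPos_conjTranspose_mul_self_matrix R using 1
  ext1 a b
  have hR : (Rᴴ * R) a b = ∑ x : Fin k' × Fin m', ∑ s : Fin k' × Fin m', ∑ t : Fin k' × Fin m',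
      (α a s * star (α b t)) •
        (((Y x.1 s.1)ᴴ * Y x.1 t.1) ⊗ₖ ((Z x.2 s.2)ᴴ * Z x.2 t.2)) := by
    rw [Matrix.mul_apply]
    refine Finset.sum_congr rfl fun x _ => ?_
    rw [Matrix.conjTranspose_apply]
    simp only [R, Matrix.of_apply, star_sum, Finset.sum_mul_sum, star_smul, star_star,
      smul_mul_smul_comm, Matrix.star_eq_conjTranspose, Matrix.conjTranspose_kronecker,
      ← Matrix.mul_kronecker_mul]
  rw [hR, Matrix.map_apply, Matrix.of_apply, map_sum, Finset.sum_comm]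
  refine Finset.sum_congr rfl fun s _ => ?_
  rw [map_sum, Finset.sum_comm]
  refine Finset.sum_congr rfl fun t _ => ?_
  rw [map_smul, tensorToMatrix_tmul, hY', hZ', ← Finset.smul_sum, Fintype.sum_prod_type]
  congr 1
  ext ⟨i, j⟩ ⟨i', j'⟩
  simp [Matrix.sum_apply, Matrix.kroneckerMap_apply, Finset.sum_mul_sum]

theorem map_tensorToMatrix_add_smul_one {p k m : ℕ} (X : Matrix (Fin p) (Fin p) (A ⊗[ℂ] B))
    {φ : A →ₗ[ℂ] Matrix (Fin k) (Fin k) ℂ} {ψ : B →ₗ[ℂ] Matrix (Fin m) (Fin m) ℂ}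
    (hφ : IsUCP φ) (hψ : IsUCP ψ) (c : ℂ) :
    (X + c • (1 : Matrix (Fin p) (Fin p) (A ⊗[ℂ] B))).map (tensorToMatrix φ ψ) =
      X.map (tensorToMatrix φ ψ) + c • 1 := by
  have h1 : tensorToMatrix φ ψ 1 = 1 := by
    rw [Algebra.TensorProduct.one_def, tensorToMatrix_tmul, hφ.map_one, hψ.map_one,
      Matrix.one_kronecker_one]
  ext1 a b
  by_cases hab : a = b
  · subst hab
    simp [h1]
  · simp [hab]

/-- The maximal cone is contained in the minimal one for any C⋆-algebras. -/
theorem maxCone_subset_minCone (p : ℕ) : maxCone A B p ⊆ minCone A B p := by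
  rintro X ⟨hX, h⟩
  refine ⟨hX, fun k m φ ψ hφ hψ => ?_⟩
  refine matPos_of_forall_add_smul (A := CStarMatrix (Fin k × Fin m) (Fin k × Fin m) ℂ)
    fun ε hε => ?_
  have := matPos_map_tensorToMatrix_of_mem_preMaxCone (h ε hε) hφ hψ
  rw [map_tensorToMatrix_add_smul_one X hφ hψ] at this
  exact this

end MaxLeMin

/-! ### Calculus of the maximal cone and polynomial approximation -/

section PreMaxCone

variable {A B : Type*} [CStarAlgebra A] [CStarAlgebra B] {p : ℕ}

/-- The cone `preMaxCone` may be computed with arbitrary finite index types. -/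
theorem mem_preMaxCone_of_fintype {κ μ : Type*} [Fintype κ] [Fintype μ] {S : Matrix κ κ A}
    {T : Matrix μ μ B} (hS : MatPos S) (hT : MatPos T) (α : Fin p → κ × μ → ℂ) :
    (Matrix.of fun a b => ∑ s : κ × μ, ∑ t : κ × μ,
      (α a s * star (α b t)) • (S s.1 t.1 ⊗ₜ[ℂ] T s.2 t.2)) ∈ preMaxCone A B p := by
  let e := Fintype.equivFin κ
  let f := Fintype.equivFin μ
  refine ⟨_, _, S.submatrix e.symm e.symm, T.submatrix f.symm f.symm,
    Matrix.of fun a s => α a (e.symm s.1, f.symm s.2), hS.submatrix _, hT.submatrix _, ?_⟩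
  ext1 a b
  simp only [Matrix.of_apply, Matrix.submatrix_apply]
  refine Fintype.sum_equiv (e.prodCongr f) _ _ fun s => ?_
  refine Fintype.sum_equiv (e.prodCongr f) _ _ fun t => ?_
  simp

theorem Matrix.matPos_fromBlocks {κ κ' : Type*} [Fintype κ] [Fintype κ'] (M : Matrix κ κ A)
    (M' : Matrix κ' κ' A) : MatPos (Matrix.fromBlocks (Mᴴ * M) 0 0 (M'ᴴ * M')) :=
  ⟨Matrix.fromBlocks M 0 0 M', by
    simp [Matrix.fromBlocks_conjTranspose, Matrix.fromBlocks_multiply]⟩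

theorem add_mem_preMaxCone {X Y : Matrix (Fin p) (Fin p) (A ⊗[ℂ] B)} (hX : X ∈ preMaxCone A B p)
    (hY : Y ∈ preMaxCone A B p) : X + Y ∈ preMaxCone A B p := by
  obtain ⟨k, m, S, T, α, ⟨Y₁, rfl⟩, ⟨Y₂, rfl⟩, rfl⟩ := hX
  obtain ⟨k', m', S', T', α', ⟨Y₃, rfl⟩, ⟨Y₄, rfl⟩, rfl⟩ := hY
  -- `S ⊕ S'` and `T ⊕ T'`, with `α` zero on the mixed blocks
  convert mem_preMaxCone_of_fintype (Y₁.matPos_fromBlocks Y₃) (Y₂.matPos_fromBlocks Y₄)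
    (fun a s => Sum.elim (fun i => Sum.elim (fun j => α a (i, j)) (fun _ => 0) s.2)
      (fun i => Sum.elim (fun _ => 0) (fun j => α' a (i, j)) s.2) s.1) using 1
  ext1 a b
  simp [Fintype.sum_prod_type, Fintype.sum_sum_type]

/-- Block-wise sums of Schur products of positive matrices lie in `preMaxCone`. -/
theorem sum_schur_mem_preMaxCone {ι : Type*} [Fintype ι] {S : Matrix (Fin p × ι) (Fin p × ι) A}
    {T : Matrix (Fin p × ι) (Fin p × ι) B} (hS : MatPos S) (hT : MatPos T) :
    (Matrix.of fun a b => ∑ i, ∑ j, S (a, i) (b, j) ⊗ₜ[ℂ] T (a, i) (b, j)) ∈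
      preMaxCone A B p := by
  classical
  -- `α` selects from `S ⊗ T` the diagonal copy, that is, the Schur product, and sums over `ι`
  let α : Fin p → (Fin p × ι) × (Fin p × ι) → ℂ := fun a s => if s.2 = s.1 ∧ s.1.1 = a then 1 else 0
  have hα : ∀ a (f : (Fin p × ι) × (Fin p × ι) → A ⊗[ℂ] B),
      ∑ s, α a s • f s = ∑ i, f ((a, i), (a, i)) := fun a f => by
    simp only [α, Fintype.sum_prod_type (α₁ := Fin p × ι), ite_and, ite_smul, one_smul, zero_smul,
      Finset.sum_ite_eq', Finset.mem_univ, if_true]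
    rw [Fintype.sum_prod_type, Finset.sum_comm]
    simp
  convert mem_preMaxCone_of_fintype hS hT α using 1
  ext1 a b
  have hs : ∀ b s, star (α b s) = α b s := fun b s => by simp [α, apply_ite star]
  simp only [Matrix.of_apply, mul_smul, ← Finset.smul_sum, hs, hα]

/-- A finite family in `A ⊗ B`, written with common right-hand factors. -/
theorem exists_eq_sum_tmul {κ : Type*} [Finite κ] (r : κ → A ⊗[ℂ] B) :
    ∃ (s : Finset (A × B)) (x : κ → A × B → A), ∀ k, r k = ∑ i ∈ s, x k i ⊗ₜ[ℂ] i.2 := by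
  classical
  have := Fintype.ofFinite κ
  choose s hs using fun k => TensorProduct.exists_finset (r k)
  refine ⟨Finset.univ.biUnion s, fun k i => if i ∈ s k then i.1 else 0, fun k => ?_⟩
  have h : ∀ i : A × B, (if i ∈ s k then i.1 else 0) ⊗ₜ[ℂ] i.2 =
      if i ∈ s k then i.1 ⊗ₜ[ℂ] i.2 else 0 := fun i => by split_ifs <;> simp
  simp only [h, ← Finset.sum_filter]
  conv_lhs => rw [hs k]
  refine Finset.sum_congr (Finset.ext fun i => ?_) fun _ _ => rfl
  simp only [Finset.mem_filter, Finset.mem_biUnion, Finset.mem_univ, true_and]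
  exact ⟨fun h => ⟨⟨k, h⟩, h⟩, fun h => h.2⟩

/-- Gram matrices lie in the cone: after writing the `r a` with common right-hand factors, the Gram
matrix is a block-wise sum of Schur products of two Gram matrices. -/
theorem gram_mem_preMaxCone (r : Fin p → A ⊗[ℂ] B) :
    (Matrix.of fun a b => star (r a) * r b) ∈ preMaxCone A B p := by
  obtain ⟨s, x, hr⟩ := exists_eq_sum_tmul r
  convert sum_schur_mem_preMaxCone (matPos_gram fun i : Fin p × s => x i.1 i.2)
    (matPos_gram fun i : Fin p × s => (i.2 : A × B).2) using 1
  ext1 a b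
  simp only [hr, ← Finset.sum_coe_sort s, star_sum, Finset.sum_mul_sum, TensorProduct.star_tmul,
    Matrix.of_apply, Algebra.TensorProduct.tmul_mul_tmul]

theorem zero_mem_preMaxCone : (0 : Matrix (Fin p) (Fin p) (A ⊗[ℂ] B)) ∈ preMaxCone A B p := by
  convert gram_mem_preMaxCone (0 : Fin p → A ⊗[ℂ] B) using 1
  ext1 a b
  simp

theorem sum_mem_preMaxCone {l : Type*} (s : Finset l) (X : l → Matrix (Fin p) (Fin p) (A ⊗[ℂ] B))
    (h : ∀ i ∈ s, X i ∈ preMaxCone A B p) : ∑ i ∈ s, X i ∈ preMaxCone A B p :=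
  Finset.sum_induction _ (· ∈ preMaxCone A B p) (fun _ _ => add_mem_preMaxCone)
    zero_mem_preMaxCone h

theorem smul_mem_preMaxCone {X : Matrix (Fin p) (Fin p) (A ⊗[ℂ] B)} (hX : X ∈ preMaxCone A B p)
    {c : ℝ} (hc : 0 ≤ c) : (c : ℂ) • X ∈ preMaxCone A B p := by
  obtain ⟨k, m, S, T, α, hS, hT, rfl⟩ := hX
  refine ⟨k, m, _, T, α, hS.smul hc, hT, ?_⟩
  ext1 a b
  simp [Finset.smul_sum, TensorProduct.smul_tmul', smul_comm (c : ℂ)]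

theorem single_tmul_mem_preMaxCone (a : Fin p) (x : A) (y : B) :
    Matrix.single a a ((star x * x) ⊗ₜ[ℂ] (star y * y)) ∈ preMaxCone A B p := by
  convert gram_mem_preMaxCone (Pi.single a (x ⊗ₜ[ℂ] y)) using 1
  ext1 b c
  simp only [Matrix.single_apply, Pi.single_apply, Matrix.of_apply, apply_ite star, star_zero,
    TensorProduct.star_tmul, ite_mul, mul_ite, zero_mul, mul_zero, ite_and, @eq_comm _ a,
    Algebra.TensorProduct.tmul_mul_tmul]
  split_ifs <;> rfl

theorem diagonal_mem_preMaxCone {d : Fin p → ℝ} (hd : ∀ a, 0 ≤ d a) :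
    Matrix.diagonal (fun a => (d a : ℂ) • (1 : A ⊗[ℂ] B)) ∈ preMaxCone A B p := by
  have h : Matrix.diagonal (fun a => (d a : ℂ) • (1 : A ⊗[ℂ] B)) =
      ∑ a, (d a : ℂ) • Matrix.single a a ((star (1 : A) * 1) ⊗ₜ[ℂ] (star (1 : B) * 1)) := by
    ext1 b c
    simp [Matrix.sum_apply, Matrix.single_apply, Matrix.diagonal_apply,
      Algebra.TensorProduct.one_def, ite_and]
  rw [h]
  exact sum_mem_preMaxCone _ _ fun a _ =>
    smul_mem_preMaxCone (single_tmul_mem_preMaxCone a 1 1) (hd a)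

/-- `t² - x⋆x` is a hermitian square for `‖x‖ ≤ t`. -/
theorem exists_sq_sub_star_mul_self {x : A} {t : ℝ} (h : ‖x‖ ≤ t) :
    ∃ c : A, ((t ^ 2 : ℝ) : ℂ) • 1 - star x * x = star c * c := by
  let _ := CStarAlgebra.spectralOrder A
  have := CStarAlgebra.spectralOrderedRing A
  rw [← CStarAlgebra.nonneg_iff_exists_star_mul_self, sub_nonneg]
  refine CStarAlgebra.star_mul_le_algebraMap_norm_sq.trans ?_
  rw [Complex.coe_smul, ← Algebra.algebraMap_eq_smul_one]
  exact algebraMap_mono A (pow_le_pow_left₀ (norm_nonneg x) h 2)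

/-- The real part of a matrix unit with a small elementary tensor is dominated by a small multiple
of the unit in `preMaxCone`. -/
theorem smul_one_add_single_mem_preMaxCone (a b : Fin p) {x : A} {y : B} {t : ℝ} (ht : 0 < t)
    (hx : ‖x‖ ≤ t) (hy : ‖y‖ ≤ 1) :
    ((2 * t : ℝ) : ℂ) • (1 : Matrix (Fin p) (Fin p) (A ⊗[ℂ] B)) + Matrix.single a b (x ⊗ₜ[ℂ] y) +
      (Matrix.single a b (x ⊗ₜ[ℂ] y))ᴴ ∈ preMaxCone A B p := by
  obtain ⟨c, hc⟩ := exists_sq_sub_star_mul_self hx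
  obtain ⟨d, hd⟩ := exists_sq_sub_star_mul_self (x := y) (t := 1) hy
  set z := x ⊗ₜ[ℂ] y with hz
  let α : Fin p → ℝ := Pi.single a 1
  let β : Fin p → ℝ := Pi.single b 1
  -- `h1` is the Gram matrix of the row with entry `√t` at `a` plus `z/√t` at `b`. Its mixed terms
  -- are those of the claim, and its diagonal terms are `t` at `a` and `z⋆z/t` at `b`. In `h3` the
  -- latter is completed to `t`, and `h2` fills up the diagonal to `2t`.
  have h1 := gram_mem_preMaxCone fun i => ((√t * α i : ℝ) : ℂ) • (1 : A ⊗[ℂ] B) +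
    (((√t)⁻¹ * β i : ℝ) : ℂ) • z
  have h2 : Matrix.diagonal (fun i => ((2 * t - t * α i - t * β i : ℝ) : ℂ) • (1 : A ⊗[ℂ] B)) ∈
      preMaxCone A B p := diagonal_mem_preMaxCone fun i => by
    have hα : α i ≤ 1 := by simp only [α, Pi.single_apply]; split_ifs <;> norm_num
    have hβ : β i ≤ 1 := by simp only [β, Pi.single_apply]; split_ifs <;> norm_num
    nlinarith
  have h3 := smul_mem_preMaxCone (add_mem_preMaxCone
    (single_tmul_mem_preMaxCone (B := B) b c 1) (single_tmul_mem_preMaxCone b x d))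
    (inv_nonneg.2 ht.le)
  have hw : (star c * c) ⊗ₜ[ℂ] (star (1 : B) * 1) + (star x * x) ⊗ₜ[ℂ] (star d * d) =
      ((t ^ 2 : ℝ) : ℂ) • (1 : A ⊗[ℂ] B) - star z * z := by
    rw [← hc, ← hd, hz, TensorProduct.star_tmul, Algebra.TensorProduct.tmul_mul_tmul,
      TensorProduct.sub_tmul, TensorProduct.tmul_sub, Algebra.TensorProduct.one_def,
      TensorProduct.smul_tmul']
    simp
  rw [← Matrix.single_add, hw] at h3
  convert add_mem_preMaxCone (add_mem_preMaxCone h1 h2) h3 using 1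
  -- the rest is an identity between the entries `(i, j)`, in which `δ`, `α`, `β` take the values
  -- `0` and `1`
  obtain ⟨r, hr, rfl⟩ : ∃ r : ℝ, 0 < r ∧ t = r ^ 2 :=
    ⟨√t, Real.sqrt_pos.2 ht, (Real.sq_sqrt ht.le).symm⟩
  have hr' : (r : ℂ) ≠ 0 := by exact_mod_cast hr.ne'
  rw [Real.sqrt_sq hr.le]
  ext1 i j
  -- generalized so that the entries become scalar multiples, with coefficients polynomial in `δ`,
  -- `α`, `β`
  obtain ⟨δ, hδ⟩ : ∃ δ : ℝ, δ = if i = j then 1 else 0 := ⟨_, rfl⟩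
  have hα : α i * α j = δ * α i := by
    rw [hδ]
    by_cases hij : i = j
    · subst hij
      by_cases hi : i = a <;> simp [α, hi]
    · by_cases hi : i = a
      · have hj : j ≠ a := fun h => hij (hi.trans h.symm)
        simp [α, hij, hj]
      · simp [α, hij, hi]
  have hβ : β i * β j = δ * β i := by
    rw [hδ]
    by_cases hij : i = j
    · subst hij
      by_cases hi : i = b <;> simp [β, hi]
    · by_cases hi : i = b
      · have hj : j ≠ b := fun h => hij (hi.trans h.symm)
        simp [β, hij, hj]
      · simp [β, hij, hi]
  have e1 : (1 : Matrix (Fin p) (Fin p) (A ⊗[ℂ] B)) i j = (δ : ℂ) • 1 := by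
    rw [hδ, Matrix.one_apply]
    split_ifs <;> simp
  have e2 : ∀ (w : A ⊗[ℂ] B) (i j), Matrix.single a b w i j = ((α i * β j : ℝ) : ℂ) • w := by
    intro w i j
    by_cases hi : i = a <;> by_cases hj : j = b <;>
      simp [α, β, hi, hj, eq_comm (b := i), eq_comm (b := j)]
  have e3 : ∀ (w : A ⊗[ℂ] B) (i j), Matrix.single b b w i j = ((β i * β j : ℝ) : ℂ) • w := by
    intro w i j
    by_cases hi : i = b <;> by_cases hj : j = b <;>
      simp [β, hi, hj, eq_comm (b := i), eq_comm (b := j)]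
  have e4 : ∀ d : Fin p → A ⊗[ℂ] B, Matrix.diagonal d i j = (δ : ℂ) • d i := fun d => by
    rw [hδ, Matrix.diagonal_apply]
    split_ifs <;> simp
  have hs : ∀ (c : ℝ) (w : A ⊗[ℂ] B), star ((c : ℂ) • w) = (c : ℂ) • star w := fun c w => by
    rw [star_smul, Complex.star_def, Complex.conj_ofReal]
  have hα' : (α i * α j : ℂ) = δ * α i := by exact_mod_cast hα
  have hβ' : (β i * β j : ℂ) = δ * β i := by exact_mod_cast hβ
  simp only [Matrix.add_apply, Matrix.smul_apply, Matrix.of_apply, Matrix.conjTranspose_apply, e1,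
    e2, e3, e4, hs, star_add, star_one, add_mul, mul_add, smul_mul_smul_comm, mul_one, one_mul]
  push_cast
  match_scalars
  · field_simp
    linear_combination -hα' - hβ'
  · field_simp
  · field_simp
  · field_simp
    ring

end PreMaxCone

section PolynomialApproximation

variable {B : Type*} [CStarAlgebra B] {n p : ℕ}

/-- The tensors whose left-hand factors are noncommutative polynomials of degree at most `d`. -/
def polyTensor (n d : ℕ) (B : Type*) [CStarAlgebra B] : Submodule ℂ (Unc n ⊗[ℂ] B) :=
  Submodule.span ℂ {z | ∃ x ∈ Unc.polys n d, ∃ y : B, z = x ⊗ₜ[ℂ] y}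

theorem polyTensor_mono {d e : ℕ} (h : d ≤ e) : polyTensor n d B ≤ polyTensor n e B :=
  Submodule.span_mono fun _ ⟨x, hx, y, hz⟩ => ⟨x, Unc.polys_mono h hx, y, hz⟩

theorem exists_star_mem_polyTensor {d : ℕ} {z : Unc n ⊗[ℂ] B} (hz : z ∈ polyTensor n d B) :
    ∃ e, star z ∈ polyTensor n e B := by
  induction hz using Submodule.span_induction with
  | mem z h =>
    obtain ⟨x, hx, y, rfl⟩ := h
    obtain ⟨e, he⟩ := Unc.star_mem_polys hx
    exact ⟨e, Submodule.subset_span ⟨_, he, star y, TensorProduct.star_tmul x y⟩⟩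
  | zero => exact ⟨0, by rw [star_zero]; exact Submodule.zero_mem _⟩
  | add z w _ _ hz hw =>
    obtain ⟨e, he⟩ := hz
    obtain ⟨f, hf⟩ := hw
    refine ⟨max e f, ?_⟩
    rw [star_add]
    exact add_mem (polyTensor_mono (le_max_left e f) he) (polyTensor_mono (le_max_right e f) hf)
  | smul c z _ hz =>
    obtain ⟨e, he⟩ := hz
    exact ⟨e, by rw [star_smul]; exact Submodule.smul_mem _ _ he⟩

/-- Matrices over `U_nc(n) ⊗ B` are approximated, in the order unit seminorm of `preMaxCone`, by
matrices with polynomial left-hand factors. -/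
theorem exists_polyTensor_approx (Z : Matrix (Fin p) (Fin p) (Unc n ⊗[ℂ] B)) {ε : ℝ} (hε : 0 < ε) :
    ∃ (d : ℕ) (W : Matrix (Fin p) (Fin p) (Unc n ⊗[ℂ] B)), (∀ a b, W a b ∈ polyTensor n d B) ∧
      (ε : ℂ) • 1 + (Z - W) + (Z - W)ᴴ ∈ preMaxCone (Unc n) B p ∧
      (ε : ℂ) • 1 + (W - Z) + (W - Z)ᴴ ∈ preMaxCone (Unc n) B p := by
  have hadd : ∀ Z₁ Z₂ : Matrix (Fin p) (Fin p) (Unc n ⊗[ℂ] B), (∀ ε : ℝ, 0 < ε →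
      ∃ (d : ℕ) (W : Matrix (Fin p) (Fin p) (Unc n ⊗[ℂ] B)), (∀ a b, W a b ∈ polyTensor n d B) ∧
      (ε : ℂ) • 1 + (Z₁ - W) + (Z₁ - W)ᴴ ∈ preMaxCone (Unc n) B p ∧
      (ε : ℂ) • 1 + (W - Z₁) + (W - Z₁)ᴴ ∈ preMaxCone (Unc n) B p) → (∀ ε : ℝ, 0 < ε →
      ∃ (d : ℕ) (W : Matrix (Fin p) (Fin p) (Unc n ⊗[ℂ] B)), (∀ a b, W a b ∈ polyTensor n d B) ∧
      (ε : ℂ) • 1 + (Z₂ - W) + (Z₂ - W)ᴴ ∈ preMaxCone (Unc n) B p ∧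
      (ε : ℂ) • 1 + (W - Z₂) + (W - Z₂)ᴴ ∈ preMaxCone (Unc n) B p) → ∀ ε : ℝ, 0 < ε →
      ∃ (d : ℕ) (W : Matrix (Fin p) (Fin p) (Unc n ⊗[ℂ] B)), (∀ a b, W a b ∈ polyTensor n d B) ∧
      (ε : ℂ) • 1 + (Z₁ + Z₂ - W) + (Z₁ + Z₂ - W)ᴴ ∈ preMaxCone (Unc n) B p ∧
      (ε : ℂ) • 1 + (W - (Z₁ + Z₂)) + (W - (Z₁ + Z₂))ᴴ ∈ preMaxCone (Unc n) B p := by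
    intro Z₁ Z₂ h₁ h₂ ε hε
    obtain ⟨d, W, hW, a1, a2⟩ := h₁ (ε / 2) (by positivity)
    obtain ⟨e, V, hV, b1, b2⟩ := h₂ (ε / 2) (by positivity)
    refine ⟨max d e, W + V, fun a b => add_mem (polyTensor_mono (le_max_left d e) (hW a b))
      (polyTensor_mono (le_max_right d e) (hV a b)), ?_, ?_⟩
    · convert add_mem_preMaxCone a1 b1 using 1
      simp only [Matrix.conjTranspose_sub, Matrix.conjTranspose_add]
      push_cast
      module
    · convert add_mem_preMaxCone a2 b2 using 1
      simp only [Matrix.conjTranspose_sub, Matrix.conjTranspose_add]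
      push_cast
      module
  have hzero : ∀ ε : ℝ, 0 < ε →
      ∃ (d : ℕ) (W : Matrix (Fin p) (Fin p) (Unc n ⊗[ℂ] B)), (∀ a b, W a b ∈ polyTensor n d B) ∧
      (ε : ℂ) • 1 + (0 - W) + (0 - W)ᴴ ∈ preMaxCone (Unc n) B p ∧
      (ε : ℂ) • 1 + (W - 0) + (W - 0)ᴴ ∈ preMaxCone (Unc n) B p := by
    intro ε hε
    have h : (ε : ℂ) • (1 : Matrix (Fin p) (Fin p) (Unc n ⊗[ℂ] B)) ∈ preMaxCone (Unc n) B p := by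
      convert diagonal_mem_preMaxCone (p := p) (A := Unc n) (B := B) (d := fun _ => ε)
        (fun _ => hε.le) using 1
      rw [← Matrix.diagonal_one, ← Matrix.diagonal_smul]
      rfl
    exact ⟨0, 0, fun _ _ => Submodule.zero_mem _, by simpa using h, by simpa using h⟩
  induction Z using Matrix.induction_on' generalizing ε with
  | h_zero => exact hzero ε hε
  | h_add Z₁ Z₂ h₁ h₂ => exact hadd Z₁ Z₂ (fun _ h => h₁ h) (fun _ h => h₂ h) ε hε
  | h_std_basis a b z =>
    induction z using TensorProduct.induction_on generalizing ε with
    | zero => simpa using hzero ε hε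
    | add z w hz hw =>
      rw [Matrix.single_add]
      exact hadd _ _ (fun _ h => hz h) (fun _ h => hw h) ε hε
    | tmul x y =>
      -- scale the right-hand factor to norm at most one
      set l : ℝ := ‖y‖ + 1 with hl
      have hl0 : 0 < l := by positivity
      have hl' : (l : ℂ) ≠ 0 := by exact_mod_cast hl0.ne'
      have hy : ‖((l⁻¹ : ℝ) : ℂ) • y‖ ≤ 1 := by
        rw [norm_smul, Complex.norm_real, Real.norm_of_nonneg (by positivity), inv_mul_le_one₀ hl0]
        linarith
      obtain ⟨d, x', hx', hxx⟩ := Unc.exists_polys_norm_sub_lt x (ε := ε / (2 * l)) (by positivity)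
      have key : ∀ w : Unc n, ‖w‖ < ε / (2 * l) → (ε : ℂ) • (1 : Matrix (Fin p) (Fin p) _) +
          Matrix.single a b (w ⊗ₜ[ℂ] y) + (Matrix.single a b (w ⊗ₜ[ℂ] y))ᴴ ∈
            preMaxCone (Unc n) B p := by
        intro w hw
        have h := smul_one_add_single_mem_preMaxCone a b (x := (l : ℂ) • w)
          (y := ((l⁻¹ : ℝ) : ℂ) • y) (t := ε / 2) (by positivity) (by
            rw [norm_smul, Complex.norm_real, Real.norm_of_nonneg hl0.le]
            rw [lt_div_iff₀ (by positivity)] at hw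
            linarith) hy
        rw [TensorProduct.smul_tmul_smul, Complex.ofReal_inv, mul_inv_cancel₀ hl', one_smul,
          mul_div_cancel₀ ε two_ne_zero] at h
        exact h
      have hsub : ∀ z w : Unc n ⊗[ℂ] B,
          Matrix.single a b (z - w) = Matrix.single a b z - Matrix.single a b w := fun z w => by
        ext i j
        simp only [Matrix.single_apply, Matrix.sub_apply]
        split_ifs <;> simp
      refine ⟨d, Matrix.single a b (x' ⊗ₜ[ℂ] y), fun i j => ?_, ?_, ?_⟩
      · rw [Matrix.single_apply]
        split_ifs
        · exact Submodule.subset_span ⟨x', hx', y, rfl⟩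
        · exact Submodule.zero_mem _
      · rw [← hsub, ← TensorProduct.sub_tmul]
        exact key _ hxx
      · rw [← hsub, ← TensorProduct.sub_tmul]
        exact key _ (by rwa [norm_sub_rev])

/-- The approximation of a self-adjoint matrix can be chosen self-adjoint: approximate `X / 2` and
add the adjoint. -/
theorem exists_selfAdjoint_polyTensor_approx {X : Matrix (Fin p) (Fin p) (Unc n ⊗[ℂ] B)}
    (hX : Xᴴ = X) {ε : ℝ} (hε : 0 < ε) :
    ∃ (d : ℕ) (Y : Matrix (Fin p) (Fin p) (Unc n ⊗[ℂ] B)), Yᴴ = Y ∧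
      (∀ a b, Y a b ∈ polyTensor n d B) ∧
      (ε : ℂ) • 1 + (X - Y) ∈ preMaxCone (Unc n) B p ∧
      (ε : ℂ) • 1 + (Y - X) ∈ preMaxCone (Unc n) B p := by
  obtain ⟨d, W, hW, h1, h2⟩ := exists_polyTensor_approx (((1 / 2 : ℝ) : ℂ) • X) hε
  choose e he using fun i : Fin p × Fin p => exists_star_mem_polyTensor (hW i.1 i.2)
  have hX2 : (((1 / 2 : ℝ) : ℂ) • X)ᴴ = ((1 / 2 : ℝ) : ℂ) • X := by
    rw [Matrix.conjTranspose_smul, hX, Complex.star_def, Complex.conj_ofReal]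
  refine ⟨max d (Finset.univ.sup e), W + Wᴴ, ?_, fun a b => add_mem
    (polyTensor_mono (le_max_left _ _) (hW a b)) (polyTensor_mono (le_max_of_le_right
      (Finset.le_sup (f := e) (Finset.mem_univ (b, a)))) (he (b, a))), ?_, ?_⟩
  · rw [Matrix.conjTranspose_add, Matrix.conjTranspose_conjTranspose, add_comm]
  · convert h1 using 1
    rw [Matrix.conjTranspose_sub, hX2]
    push_cast
    module
  · convert h2 using 1
    rw [Matrix.conjTranspose_sub, hX2]
    push_cast
    module

end PolynomialApproximation

/-! ### Sums of hermitian squares and a Positivstellensatz -/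

section SumsOfSquares

variable {A : Type*} [CStarAlgebra A] {N : ℕ} {ι : Type}

/-- The matrix `∑ᵢⱼ Q_{(i,s),(j,t)} vᵢ⋆ vⱼ`: a matrix-valued noncommutative quadratic form. For `Q`
positive semidefinite it is a sum of hermitian squares. -/
def squareSum (v : Fin N → A) (Q : Matrix (Fin N × ι) (Fin N × ι) ℂ) : Matrix ι ι A :=
  Matrix.of fun s t => ∑ i, ∑ j, Q (i, s) (j, t) • (star (v i) * v j)

theorem squareSum_add (v : Fin N → A) (Q Q' : Matrix (Fin N × ι) (Fin N × ι) ℂ) :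
    squareSum v (Q + Q') = squareSum v Q + squareSum v Q' := by
  ext s t
  simp [squareSum, add_smul, Finset.sum_add_distrib]

theorem squareSum_smul (v : Fin N → A) (c : ℂ) (Q : Matrix (Fin N × ι) (Fin N × ι) ℂ) :
    squareSum v (c • Q) = c • squareSum v Q := by
  ext s t
  simp [squareSum, mul_smul, Finset.smul_sum]

theorem squareSum_conjTranspose (v : Fin N → A)
    (Q : Matrix (Fin N × ι) (Fin N × ι) ℂ) :
    (squareSum v Q)ᴴ = squareSum v Qᴴ := by
  ext s t
  simp only [squareSum, Matrix.conjTranspose_apply, Matrix.of_apply, star_sum, star_smul, star_mul,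
    star_star]
  exact Finset.sum_comm

/-- Hermitian squares of rows of elements in the span of the `v i` are values of the quadratic form.
-/
theorem exists_squareSum_eq_gram [Finite ι] {v : Fin N → A} {x : ι → A}
    (hx : ∀ s, x s ∈ Submodule.span ℂ (Set.range v)) :
    ∃ Q : Matrix (Fin N × ι) (Fin N × ι) ℂ, Q.PosSemidef ∧
      squareSum v Q = Matrix.of fun s t => star (x s) * x t := by
  classical
  have := Fintype.ofFinite ι
  choose c hc using fun s => (Submodule.mem_span_range_iff_exists_fun ℂ).1 (hx s)
  refine ⟨Matrix.vecMulVec (star fun p => c p.2 p.1) (star (star fun p => c p.2 p.1)),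
    Matrix.posSemidef_vecMulVec_self_star _, ?_⟩
  ext s t
  simp only [squareSum, Matrix.of_apply, ← hc, star_sum, Finset.sum_mul_sum, Matrix.vecMulVec_apply,
    star_star, star_smul, smul_mul_smul_comm, Pi.star_apply]

end SumsOfSquares

section Positivstellensatz

variable {n d N : ℕ} {ι : Type} [Fintype ι]

/-- Positivity in the representations on the standard `ℂᵏ` gives it for all finite index types. -/
theorem Matrix.map_comp_posSemidef_of_forall_fin [DecidableEq ι] {A : Type*} [CStarAlgebra A]
    {M : Matrix ι ι A}
    (hM : ∀ (k : ℕ) (π : A →⋆ₐ[ℂ] Matrix (Fin k) (Fin k) ℂ), MatPos (M.map π))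
    {J : Type} [Fintype J] [DecidableEq J] (π : A →⋆ₐ[ℂ] Matrix J J ℂ) :
    (Matrix.comp _ _ _ _ ℂ (M.map π)).PosSemidef := by
  let e := Fintype.equivFin J
  let ρ : Matrix J J ℂ →⋆ₐ[ℂ] Matrix (Fin (Fintype.card J)) (Fin (Fintype.card J)) ℂ :=
    { (Matrix.reindexAlgEquiv ℂ ℂ e : Matrix J J ℂ →ₐ[ℂ] _) with
      map_star' := fun a => rfl }
  have h := hM _ (ρ.comp π)
  have h2 := (matPos_iff_posSemidef_comp.1 h).submatrix fun x : ι × J => (x.1, e x.2)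
  convert h2 using 1
  ext ⟨s, j⟩ ⟨t, l⟩
  change π (M s t) j l = π (M s t) (e.symm (e j)) (e.symm (e l))
  rw [e.symm_apply_apply, e.symm_apply_apply]

theorem star_dotProduct_mulVec_apply {J : Type*} [Fintype J] {ξ : J → Matrix ι ι ℂ}
    {X : Matrix J J (Matrix ι ι ℂ)} (s t : ι) :
    (star ξ ⬝ᵥ (X *ᵥ ξ)) s t = ∑ j, ∑ a, ∑ l, ∑ b,
      star (ξ j a s) * (X j l a b * ξ l b t) := by
  simp only [dotProduct, Matrix.mulVec, Matrix.sum_apply, Pi.star_apply, Matrix.mul_apply,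
    Matrix.star_apply, Finset.mul_sum]
  exact Finset.sum_congr rfl fun _ _ => Finset.sum_comm

/-- A noncommutative Positivstellensatz: a self-adjoint matrix of polynomials of degree at most `d`
that is positive in every finite-dimensional representation of `U_nc(n)` is a limit of sums of
hermitian squares of polynomials of degree at most `d + 1`. A separating functional would be a
positive linear map on polynomials of degree `d + 1`, and its truncated dilation would be a
finite-dimensional representation in which the matrix is not positive. -/
theorem exists_squareSum_near {v : Fin N → Unc n}
    (hv : Submodule.span ℂ (Set.range v) = Unc.polys n (d + 1)) {M : Matrix ι ι (Unc n)}
    (hMs : Mᴴ = M) (hMd : ∀ s t, M s t ∈ Unc.polys n d)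
    (hM : ∀ (k : ℕ) (π : Unc n →⋆ₐ[ℂ] Matrix (Fin k) (Fin k) ℂ), MatPos (M.map π))
    {ε : ℝ} (hε : 0 < ε) :
    ∃ Q : Matrix (Fin N × ι) (Fin N × ι) ℂ, Q.PosSemidef ∧
      ∀ s t, ‖M s t - squareSum v Q s t‖ ≤ ε := by
  classical
  let _ := CStarAlgebra.spectralOrder (Unc n)
  have := CStarAlgebra.spectralOrderedRing (Unc n)
  let K : Set (CStarMatrix ι ι (Unc n)) :=
    {X | ∃ Q : Matrix (Fin N × ι) (Fin N × ι) ℂ, Q.PosSemidef ∧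
      X = CStarMatrix.ofMatrix (squareSum v Q)}
  by_cases hcl : CStarMatrix.ofMatrix M ∈ closure K
  · obtain ⟨X, ⟨Q, hQ, rfl⟩, hX⟩ := Metric.mem_closure_iff.1 hcl ε hε
    rw [dist_eq_norm] at hX
    exact ⟨Q, hQ, fun s t => (CStarMatrix.norm_entry_le_norm (i := s) (j := t)).trans hX.le⟩
  exfalso
  obtain ⟨f, -, hfs, hfK, hfM⟩ := exists_hermitian_functional_neg
    (A := CStarMatrix ι ι (Unc n)) (K := K)
    ⟨0, Matrix.PosSemidef.zero, by ext s t; simp [squareSum]⟩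
    (by
      rintro _ ⟨Q, hQ, rfl⟩ _ ⟨Q', hQ', rfl⟩
      exact ⟨Q + Q', hQ.add hQ', by rw [squareSum_add]; rfl⟩)
    (by
      rintro c hc _ ⟨Q, hQ, rfl⟩
      exact ⟨(c : ℂ) • Q, hQ.smul (by exact_mod_cast hc), by rw [squareSum_smul]; rfl⟩)
    (by
      rintro _ ⟨Q, hQ, rfl⟩
      change (squareSum v Q)ᴴ = squareSum v Q
      rw [squareSum_conjTranspose, hQ.1])
    (x₀ := CStarMatrix.ofMatrix M) hMs hcl
  -- the matrix-valued linear map associated with the separating functional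
  let E : ι → ι → Unc n →ₗ[ℂ] CStarMatrix ι ι (Unc n) := fun s t =>
    Matrix.singleLinearMap ℂ s t
  have hE : ∀ X : Matrix ι ι (Unc n), f (CStarMatrix.ofMatrix X) =
      ∑ s, ∑ t, f (E s t (X s t)) := fun X => by
    have : CStarMatrix.ofMatrix X = ∑ s, ∑ t, E s t (X s t) := Matrix.matrix_eq_sum_single X
    rw [this, map_sum]
    simp only [map_sum]
  let L₀ : Unc n →ₗ[ℂ] CStarMatrix ι ι ℂ :=
    { toFun := fun a => CStarMatrix.ofMatrix (Matrix.of fun s t => f (E s t a))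
      map_add' := fun a b => by ext s t; simp
      map_smul' := fun c a => by ext s t; simp }
  have hL₀ : ∀ a s t, L₀ a s t = f (E s t a) := fun _ _ _ => rfl
  have hL₀s : ∀ a, L₀ (star a) = star (L₀ a) := fun a => by
    ext s t
    rw [CStarMatrix.star_apply, hL₀, hL₀, ← hfs]
    congr 1
    exact (Matrix.conjTranspose_single t s a).symm
  have hL₀pos : ∀ (κ : Type) [Fintype κ] (y : κ → Unc n), (∀ k, y k ∈ Unc.polys n (d + 1)) →
      MatPos (Matrix.of fun i j => L₀ (star (y i) * y j)) := by
    intro κ _ y hy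
    -- the quadratic form of this matrix is `f` on the hermitian square of a row of polynomials
    refine matPos_iff_posSemidef_comp.2 (Matrix.PosSemidef.of_dotProduct_mulVec_nonneg ?_ ?_)
    · ext ⟨k, s⟩ ⟨l, t⟩
      change star (L₀ (star (y l) * y k) t s) = L₀ (star (y k) * y l) s t
      rw [← CStarMatrix.star_apply, ← hL₀s, star_mul, star_star]
    · intro z
      obtain ⟨Q, hQ, hQx⟩ := exists_squareSum_eq_gram (v := v)
        (x := fun s => ∑ k, z (k, s) • y k)
        (fun s => hv ▸ sum_mem fun k _ => Submodule.smul_mem _ _ (hy k))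
      have h := hfK _ ⟨Q, hQ, rfl⟩
      rw [hQx, hE] at h
      have hgram : ∀ s t, f (E s t (star (∑ k, z (k, s) • y k) * ∑ l, z (l, t) • y l)) =
          ∑ k, ∑ l, star (z (k, s)) * z (l, t) * f (E s t (star (y k) * y l)) := fun s t => by
        simp only [star_sum, Finset.sum_mul_sum, map_sum, star_smul, smul_mul_smul_comm, map_smul,
          smul_eq_mul]
      simp only [Matrix.of_apply, hgram] at h
      convert h using 1
      simp only [dotProduct, Matrix.mulVec, Fintype.sum_prod_type, Pi.star_apply, Finset.mul_sum]
      rw [Finset.sum_comm]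
      refine Finset.sum_congr rfl fun s _ => ?_
      rw [Finset.sum_comm_cycle]
      refine Finset.sum_congr rfl fun t _ => ?_
      refine Finset.sum_congr rfl fun k _ => Finset.sum_congr rfl fun l _ => ?_
      change star (z (k, s)) * (f (E s t (star (y k) * y l)) * z (l, t)) = _
      ring
  -- a small multiple of a state makes the Gram matrix in degree `d` invertible
  obtain ⟨τ, hτs, hτp, hτ1, -, hτE⟩ := exists_state_posOn (Unc.polys n d)
  obtain ⟨N', v', hli, hv'⟩ := Unc.exists_basis_polys n d
  have hvd : ∀ i, v' i ∈ Unc.polys n d := fun i => hv' ▸ Submodule.subset_span ⟨i, rfl⟩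
  obtain ⟨hre, -⟩ := Complex.lt_def.1 hfM
  rw [Complex.zero_re] at hre
  set c := f (CStarMatrix.ofMatrix M) with hc
  obtain ⟨δ, hδ, hδc⟩ : ∃ δ : ℝ, 0 < δ ∧ c.re + δ * ‖∑ s, τ (M s s)‖ < 0 := by
    refine ⟨-c.re / (2 * (‖∑ s, τ (M s s)‖ + 1)), by
      have := neg_pos.2 hre
      positivity, ?_⟩
    have h1 : -c.re / (2 * (‖∑ s, τ (M s s)‖ + 1)) * ‖∑ s, τ (M s s)‖ ≤ -c.re / 2 := by
      rw [div_mul_eq_mul_div, div_le_div_iff₀ (by positivity) (by norm_num)]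
      nlinarith [norm_nonneg (∑ s, τ (M s s))]
    linarith
  have hτu : IsUCP (Algebra.linearMap ℂ (CStarMatrix ι ι ℂ) ∘ₗ τ) :=
    isUCP_of_state hτs hτp hτ1
  set L : Unc n →ₗ[ℂ] CStarMatrix ι ι ℂ :=
    L₀ + (δ : ℂ) • (Algebra.linearMap ℂ (CStarMatrix ι ι ℂ) ∘ₗ τ) with hL
  have hLs : ∀ a, L (star a) = star (L a) := fun a => by
    simp only [hL, LinearMap.add_apply, LinearMap.smul_apply, star_add, star_smul, hL₀s,
      hτu.map_star, Complex.star_def, Complex.conj_ofReal]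
  have hLpos : ∀ (κ : Type) [Fintype κ] (y : κ → Unc n), (∀ k, y k ∈ Unc.polys n (d + 1)) →
      MatPos (Matrix.of fun i j => L (star (y i) * y j)) := fun κ _ y hy =>
    (hL₀pos κ y hy).add ((hτu.matPos_map_of_fintype (matPos_gram y)).smul hδ.le)
  have hu : IsUnit (Matrix.of fun i j => L (star (v' i) * v' j)) :=
    isUnit_add_smul_map_algebraMap
      (hL₀pos _ v' fun k => Unc.polys_mono (Nat.le_succ d) (hvd k))
      (gram_posDef hτs hτE hvd hli) hδ
  obtain ⟨π, ξ, hπ⟩ := exists_lifted_dilation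
    (q := StarAlgHom.id ℂ (CStarMatrix ι ι ℂ)) Function.surjective_id hLs hLpos hv' hu
  -- flatten the dilation to a finite-dimensional representation
  let ρ : Matrix (Bool × Fin N') (Bool × Fin N') (CStarMatrix ι ι ℂ) →⋆ₐ[ℂ]
      Matrix ((Bool × Fin N') × ι) ((Bool × Fin N') × ι) ℂ :=
    { (Matrix.compAlgEquiv (Bool × Fin N') ι ℂ ℂ : Matrix (Bool × Fin N') (Bool × Fin N')
        (Matrix ι ι ℂ) →ₐ[ℂ] _) with
      map_star' := fun a => rfl }
  -- `c + δ ∑ τ (M s s)` is the value of a positive form of `M` in this representation, yet it is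
  -- negative
  have hpsd := (Matrix.map_comp_posSemidef_of_forall_fin hM (ρ.comp π)).dotProduct_mulVec_nonneg
    fun x : ι × ((Bool × Fin N') × ι) => (ξ x.2.1 : Matrix ι ι ℂ) x.2.2 x.1
  have hentry : ∀ s t, L (M s t) s t = ∑ j, ∑ a, ∑ l, ∑ b,
      star ((ξ j : Matrix ι ι ℂ) a s) *
        ((π (M s t) j l : Matrix ι ι ℂ) a b *
          (ξ l : Matrix ι ι ℂ) b t) := by
    intro s t
    rw [hπ _ (hMd s t)]
    exact star_dotProduct_mulVec_apply (ξ := ξ) (X := π (M s t)) s t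
  have hval : c + δ * ∑ s, τ (M s s) = ∑ s, ∑ t, L (M s t) s t := by
    have h1 : ∀ s t, L (M s t) s t = f (E s t (M s t)) + if s = t then δ * τ (M s t) else 0 := by
      intro s t
      change f (E s t (M s t)) +
        (δ : ℂ) * (algebraMap ℂ (Matrix ι ι ℂ) (τ (M s t))) s t = _
      rw [Matrix.algebraMap_matrix_apply]
      simp
    simp only [h1, Finset.sum_add_distrib, ← hE, Finset.sum_ite_eq, Finset.mem_univ, if_true,
      Finset.mul_sum, hc]
  have hnn : 0 ≤ c + δ * ∑ s, τ (M s s) := by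
    rw [hval]
    convert hpsd using 1
    simp only [dotProduct, Matrix.mulVec, Fintype.sum_prod_type (α₁ := ι), Pi.star_apply,
      Finset.mul_sum, hentry]
    refine Finset.sum_congr rfl fun s _ => ?_
    simp only [Fintype.sum_prod_type (α₁ := Bool × Fin N')]
    rw [Finset.sum_comm]
    exact Finset.sum_congr rfl fun j _ => Finset.sum_comm
  have h1 := (Complex.le_def.1 hnn).1
  rw [Complex.add_re, Complex.re_ofReal_mul, Complex.zero_re] at h1
  have h2 := mul_le_mul_of_nonneg_left (Complex.re_le_norm (∑ s, τ (M s s))) hδ.le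
  linarith

end Positivstellensatz

/-! ### Slices and positive forms on a Hilbert space -/

section Slices

open scoped InnerProductSpace

variable {A : Type*} [CStarAlgebra A] {H : Type*} [NormedAddCommGroup H] [InnerProductSpace ℂ H]

/-- The vector functional `b ↦ ⟪x, b y⟫` on bounded operators. -/
def vectorFunctional (x y : H) : (H →L[ℂ] H) →ₗ[ℂ] ℂ where
  toFun b := ⟪x, b y⟫_ℂ
  map_add' b c := by simp
  map_smul' c b := by simp

/-- The slice map `A ⊗ B(H) → A` of the vector functional `b ↦ ⟪x, b y⟫`. -/
def slice (x y : H) : A ⊗[ℂ] (H →L[ℂ] H) →ₗ[ℂ] A :=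
  TensorProduct.rid ℂ A ∘ₗ LinearMap.lTensor A (vectorFunctional x y)

theorem slice_tmul (x y : H) (a : A) (b : H →L[ℂ] H) :
    slice x y (a ⊗ₜ[ℂ] b) = ⟪x, b y⟫_ℂ • a := by
  simp [slice, vectorFunctional]

theorem slice_sum_smul {κ : Type*} [Fintype κ] (c d : κ → ℂ) (e : κ → H)
    (z : A ⊗[ℂ] (H →L[ℂ] H)) :
    slice (∑ s, c s • e s) (∑ t, d t • e t) z =
      ∑ s, ∑ t, (star (c s) * d t) • slice (e s) (e t) z := by
  induction z using TensorProduct.induction_on with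
  | zero => simp
  | add z w hz hw => simp only [map_add, hz, hw, smul_add, Finset.sum_add_distrib]
  | tmul a b =>
    simp only [slice_tmul, map_sum, map_smul, sum_inner, inner_sum, inner_smul_left,
      inner_smul_right, Finset.sum_smul, smul_smul, Complex.star_def, Finset.mul_sum]
    rw [Finset.sum_comm]
    refine Finset.sum_congr rfl fun s _ => Finset.sum_congr rfl fun t _ => ?_
    congr 1
    ring

theorem exists_norm_slice_le (z : A ⊗[ℂ] (H →L[ℂ] H)) :
    ∃ c : ℝ, 0 ≤ c ∧ ∀ x y, ‖slice x y z‖ ≤ c * ‖x‖ * ‖y‖ := by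
  induction z using TensorProduct.induction_on with
  | zero => exact ⟨0, le_rfl, by simp⟩
  | add z w hz hw =>
    obtain ⟨c, hc, hz⟩ := hz
    obtain ⟨d, hd, hw⟩ := hw
    refine ⟨c + d, add_nonneg hc hd, fun x y => ?_⟩
    rw [map_add, add_mul, add_mul]
    exact (norm_add_le _ _).trans (add_le_add (hz x y) (hw x y))
  | tmul a b =>
    refine ⟨‖b‖ * ‖a‖, by positivity, fun x y => ?_⟩
    rw [slice_tmul, norm_smul]
    calc ‖⟪x, b y⟫_ℂ‖ * ‖a‖ ≤ (‖x‖ * (‖b‖ * ‖y‖)) * ‖a‖ := by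
          gcongr
          exact (norm_inner_le_norm _ _).trans (by gcongr; exact b.le_opNorm y)
      _ = ‖b‖ * ‖a‖ * ‖x‖ * ‖y‖ := by ring

/-- Slices by vector functionals separate the points of the algebraic tensor product. -/
theorem eq_of_forall_slice_eq {z w : A ⊗[ℂ] (H →L[ℂ] H)}
    (h : ∀ x y, slice x y z = slice x y w) : z = w := by
  classical
  let b := Module.Basis.ofVectorSpace ℂ A
  have key : ∀ (z : A ⊗[ℂ] (H →L[ℂ] H)) (x y : H) i,
      b.repr (slice x y z) i = ⟪x, TensorProduct.equivFinsuppOfBasisLeft b z i y⟫_ℂ := by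
    intro z x y i
    induction z using TensorProduct.induction_on with
    | zero => simp
    | add z w hz hw => simp [hz, hw]
    | tmul a c =>
      rw [slice_tmul, TensorProduct.equivFinsuppOfBasisLeft_apply_tmul_apply]
      simp [mul_comm]
  refine (TensorProduct.equivFinsuppOfBasisLeft b).injective (Finsupp.ext fun i => ?_)
  refine ContinuousLinearMap.ext fun y => ext_inner_left ℂ fun x => ?_
  rw [← key, ← key, h]

variable [CompleteSpace H]

theorem star_slice (x y : H) (z : A ⊗[ℂ] (H →L[ℂ] H)) :
    star (slice x y z) = slice y x (star z) := by
  induction z using TensorProduct.induction_on with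
  | zero => simp
  | add z w hz hw => rw [map_add, star_add, hz, hw, star_add, map_add]
  | tmul a b =>
    rw [TensorProduct.star_tmul, slice_tmul, slice_tmul, star_smul,
      ContinuousLinearMap.star_eq_adjoint, ContinuousLinearMap.adjoint_inner_right,
      Complex.star_def, inner_conj_symm]

theorem slice_mem_polys {n d : ℕ} {z : Unc n ⊗[ℂ] (H →L[ℂ] H)}
    (hz : z ∈ polyTensor n d (H →L[ℂ] H)) (x y : H) : slice x y z ∈ Unc.polys n d := by
  induction hz using Submodule.span_induction with
  | mem z h =>
    obtain ⟨a, ha, b, rfl⟩ := h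
    rw [slice_tmul]
    exact Submodule.smul_mem _ _ ha
  | zero => rw [map_zero]; exact Submodule.zero_mem _
  | add z w _ _ hz hw => rw [map_add]; exact add_mem hz hw
  | smul c z _ hz => rw [map_smul]; exact Submodule.smul_mem _ _ hz

/-- If `ψ` is a compression, then `φ ⊗ ψ` consists of the values of `φ` on slices. -/
theorem tensorToMatrix_apply_eq_slice {k m : ℕ} {φ : A →ₗ[ℂ] Matrix (Fin k) (Fin k) ℂ}
    {ψ : (H →L[ℂ] H) →ₗ[ℂ] Matrix (Fin m) (Fin m) ℂ} {e : Fin m → H}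
    (hψ : ∀ b s t, ψ b s t = ⟪e s, b (e t)⟫_ℂ) (z : A ⊗[ℂ] (H →L[ℂ] H)) (i j : Fin k)
    (s t : Fin m) :
    tensorToMatrix φ ψ z (i, s) (j, t) = φ (slice (e s) (e t) z) i j := by
  induction z using TensorProduct.induction_on with
  | zero => simp
  | add z w hz hw => simp [hz, hw]
  | tmul a b =>
    rw [tensorToMatrix_tmul, slice_tmul, map_smul, Matrix.kroneckerMap_apply, hψ,
      Matrix.smul_apply, smul_eq_mul, mul_comm]

/-- Compression to the span of a finite orthonormal family is ucp. -/
theorem exists_isUCP_compression_orthonormal {m : ℕ} {e : Fin m → H} (he : Orthonormal ℂ e) :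
    ∃ ψ : (H →L[ℂ] H) →ₗ[ℂ] Matrix (Fin m) (Fin m) ℂ, IsUCP ψ ∧
      ∀ b s t, ψ b s t = ⟪e s, b (e t)⟫_ℂ := by
  let ψ : (H →L[ℂ] H) →ₗ[ℂ] Matrix (Fin m) (Fin m) ℂ :=
    { toFun := fun b => Matrix.of fun s t => ⟪e s, b (e t)⟫_ℂ
      map_add' := fun b c => by ext s t; simp
      map_smul' := fun c b => by ext s t; simp }
  have hψ : ∀ b s t, ψ b s t = ⟪e s, b (e t)⟫_ℂ := fun _ _ _ => rfl
  refine ⟨ψ, ⟨?_, fun r X hX => ?_⟩, hψ⟩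
  · ext s t
    rw [hψ, one_apply_eq_self, orthonormal_iff_ite.1 he, Matrix.one_apply]
  · obtain ⟨Y, rfl⟩ := hX
    have hY : ∀ i j s t, ψ ((Yᴴ * Y) i j) s t = ∑ k, ⟪Y k i (e s), Y k j (e t)⟫_ℂ := by
      intro i j s t
      rw [hψ, Matrix.mul_apply]
      simp [ContinuousLinearMap.star_eq_adjoint, ContinuousLinearMap.adjoint_inner_right]
    refine matPos_iff_posSemidef_comp.2 (Matrix.PosSemidef.of_dotProduct_mulVec_nonneg ?_ ?_)
    · ext ⟨i, s⟩ ⟨j, t⟩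
      change star (ψ ((Yᴴ * Y) j i) t s) = ψ ((Yᴴ * Y) i j) s t
      rw [hY, hY, star_sum]
      exact Finset.sum_congr rfl fun k _ => inner_conj_symm _ _
    · intro z
      have h : star z ⬝ᵥ (Matrix.comp _ _ _ _ ℂ ((Yᴴ * Y).map ψ) *ᵥ z) =
          ∑ k, ⟪∑ p, z p • Y k p.1 (e p.2), ∑ p, z p • Y k p.1 (e p.2)⟫_ℂ := by
        simp only [dotProduct, Matrix.mulVec, Matrix.comp_apply, Matrix.map_apply, hY, sum_inner,
          inner_sum, inner_smul_left, inner_smul_right, Finset.mul_sum, Finset.sum_mul,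
          Pi.star_apply, Complex.star_def]
        rw [Finset.sum_comm_cycle]
        refine Finset.sum_congr rfl fun k _ => ?_
        rw [Finset.sum_comm]
        refine Finset.sum_congr rfl fun p _ => Finset.sum_congr rfl fun q _ => ?_
        ring
      rw [h]
      refine Finset.sum_nonneg fun k _ => ?_
      rw [inner_self_eq_norm_sq_to_K, ← RCLike.ofReal_pow]
      exact RCLike.ofReal_nonneg.2 (sq_nonneg _)

end Slices

section PositiveForms

open scoped InnerProductSpace
open Filter Topology

variable {H : Type*} [NormedAddCommGroup H] [InnerProductSpace ℂ H] {κ : Type*} [Fintype κ]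

/-- A positive matrix of bounded sesquilinear forms on `H`. -/
structure IsPositiveForm (C : ℝ) (q : κ → κ → H → H → ℂ) : Prop where
  add_left : ∀ i j x x' y, q i j (x + x') y = q i j x y + q i j x' y
  smul_left : ∀ i j c x y, q i j (c • x) y = star c * q i j x y
  add_right : ∀ i j x y y', q i j x (y + y') = q i j x y + q i j x y'
  smul_right : ∀ i j c x y, q i j x (c • y) = c * q i j x y
  bound : ∀ i j x y, ‖q i j x y‖ ≤ C * ‖x‖ * ‖y‖
  nonneg : ∀ ξ : κ → H, 0 ≤ ∑ i, ∑ j, q i j (ξ i) (ξ j)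

/-- Uniformly bounded positive forms converge along an ultrafilter. -/
theorem IsPositiveForm.exists_tendsto {ι : Type*} (U : Ultrafilter ι) {C : ℝ}
    {q : ι → κ → κ → H → H → ℂ} (hq : ∀ l, IsPositiveForm C (q l)) :
    ∃ q' : κ → κ → H → H → ℂ, IsPositiveForm C q' ∧
      ∀ i j x y, Tendsto (fun l => q l i j x y) U (𝓝 (q' i j x y)) := by
  have h : ∀ i j x y, ∃ c, Tendsto (fun l => q l i j x y) U (𝓝 c) := fun i j x y => by
    obtain ⟨c, -, hc⟩ := (isCompact_closedBall (0 : ℂ) (C * ‖x‖ * ‖y‖)).ultrafilter_le_nhds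
      (U.map fun l => q l i j x y) (by
        rw [le_principal_iff, Ultrafilter.coe_map]
        exact mem_map.2 (univ_mem' fun l => mem_closedBall_zero_iff.2 ((hq l).bound i j x y)))
    exact ⟨c, hc⟩
  choose q' hq' using h
  refine ⟨q', ⟨fun i j x x' y => ?_, fun i j c x y => ?_, fun i j x y y' => ?_,
    fun i j c x y => ?_, fun i j x y => ?_, fun ξ => ?_⟩, hq'⟩
  · refine tendsto_nhds_unique (hq' i j (x + x') y) ?_
    simpa only [(hq _).add_left] using (hq' i j x y).add (hq' i j x' y)
  · refine tendsto_nhds_unique (hq' i j (c • x) y) ?_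
    simpa only [(hq _).smul_left] using (hq' i j x y).const_mul (star c)
  · refine tendsto_nhds_unique (hq' i j x (y + y')) ?_
    simpa only [(hq _).add_right] using (hq' i j x y).add (hq' i j x y')
  · refine tendsto_nhds_unique (hq' i j x (c • y)) ?_
    simpa only [(hq _).smul_right] using (hq' i j x y).const_mul c
  · have h : Tendsto (fun l => ‖q l i j x y‖) U (𝓝 ‖q' i j x y‖) := (hq' i j x y).norm
    exact le_of_tendsto' h fun l => (hq l).bound i j x y
  · have h : Tendsto (fun l => ∑ i, ∑ j, q l i j (ξ i) (ξ j)) U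
        (𝓝 (∑ i, ∑ j, q' i j (ξ i) (ξ j))) :=
      tendsto_finsetSum _ fun i _ => tendsto_finsetSum _ fun j _ => hq' i j (ξ i) (ξ j)
    exact ge_of_tendsto' h fun l => (hq l).nonneg ξ

variable [CompleteSpace H]

/-- A matrix of operators on `H` is positive if it is positive as an operator on the direct sum. -/
theorem matPos_of_forall_inner_nonneg [DecidableEq κ] {T : Matrix κ κ (H →L[ℂ] H)}
    (h : ∀ ξ : κ → H, 0 ≤ ∑ i, ∑ j, ⟪ξ i, T i j (ξ j)⟫_ℂ) : MatPos T := by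
  let P : κ → PiLp 2 (fun _ : κ => H) →L[ℂ] H := fun i => PiLp.proj 2 (fun _ : κ => H) i
  -- the operator on the direct sum with matrix `T`
  let S : PiLp 2 (fun _ : κ => H) →L[ℂ] PiLp 2 (fun _ : κ => H) :=
    ∑ i, ∑ j, ContinuousLinearMap.adjoint (P i) ∘L T i j ∘L P j
  have hS : ∀ x y, ⟪x, S y⟫_ℂ = ∑ i, ∑ j, ⟪x i, T i j (y j)⟫_ℂ := fun x y => by
    simp [S, ContinuousLinearMap.adjoint_inner_right, P]
  have hpos : S.IsPositive := by
    refine (ContinuousLinearMap.isPositive_iff_complex S).2 fun x => ?_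
    have h1 := h x
    rw [← hS] at h1
    have h2 : 0 ≤ ⟪S x, x⟫_ℂ := by
      rw [← inner_conj_symm]
      exact star_nonneg_iff.2 h1
    obtain ⟨h3, h4⟩ := Complex.le_def.1 h2
    exact ⟨Complex.ext rfl (by simpa using h4), h3⟩
  obtain ⟨R, hR⟩ := CStarAlgebra.nonneg_iff_exists_star_mul_self.1
    ((ContinuousLinearMap.nonneg_iff_isPositive S).2 hpos)
  let J : κ → H →L[ℂ] PiLp 2 (fun _ : κ => H) := fun i => ContinuousLinearMap.adjoint (P i)
  have hJ : ∀ i x, J i x = PiLp.single 2 i x := fun i x => by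
    refine ext_inner_left ℂ fun y => ?_
    rw [ContinuousLinearMap.adjoint_inner_right, PiLp.inner_apply, Finset.sum_eq_single i]
    · simp [P]
    · intro j _ hj
      rw [PiLp.single_eq_of_ne 2 hj, inner_zero_right]
    · simp
  refine ⟨Matrix.of fun i j => P i ∘L R ∘L J j, ?_⟩
  ext1 i j
  refine ContinuousLinearMap.ext fun y => ext_inner_left ℂ fun x => ?_
  have h1 : ⟪x, T i j y⟫_ℂ = ⟪J i x, S (J j y)⟫_ℂ := by
    rw [hS, Finset.sum_eq_single i, Finset.sum_eq_single j]
    · simp [hJ]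
    · intro l _ hl
      rw [hJ, hJ, PiLp.single_eq_of_ne 2 hl, map_zero, inner_zero_right]
    · simp
    · intro l _ hl
      simp only [hJ, PiLp.single_eq_of_ne 2 hl, inner_zero_left, Finset.sum_const_zero]
    · simp
  rw [h1, hR, mul_apply_eq_comp, ContinuousLinearMap.star_eq_adjoint,
    ContinuousLinearMap.adjoint_inner_right, PiLp.inner_apply, Matrix.mul_apply,
    sum_apply, inner_sum]
  refine Finset.sum_congr rfl fun k _ => ?_
  rw [Matrix.conjTranspose_apply, mul_apply_eq_comp,
    ContinuousLinearMap.star_eq_adjoint, ContinuousLinearMap.adjoint_inner_right]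
  rfl

/-- A positive matrix of bounded forms is represented by a positive matrix of bounded operators. -/
theorem IsPositiveForm.exists_matPos {C : ℝ} {q : κ → κ → H → H → ℂ} (hq : IsPositiveForm C q) :
    ∃ T : Matrix κ κ (H →L[ℂ] H), MatPos T ∧ ∀ i j x y, ⟪x, T i j y⟫_ℂ = q i j x y := by
  classical
  let f : κ → κ → H →L⋆[ℂ] H →L[ℂ] ℂ := fun i j =>
    (LinearMap.mk₂'ₛₗ (starRingEnd ℂ) (RingHom.id ℂ) (q i j) (hq.add_left i j)
      (hq.smul_left i j) (hq.add_right i j) (hq.smul_right i j)).mkContinuous₂ C (hq.bound i j)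
  have hf : ∀ i j x y, ⟪x, ContinuousLinearMap.adjoint
      (InnerProductSpace.continuousLinearMapOfBilin (f i j)) y⟫_ℂ = q i j x y := by
    intro i j x y
    rw [ContinuousLinearMap.adjoint_inner_right,
      InnerProductSpace.continuousLinearMapOfBilin_apply]
    rfl
  refine ⟨Matrix.of fun i j => ContinuousLinearMap.adjoint
    (InnerProductSpace.continuousLinearMapOfBilin (f i j)), matPos_of_forall_inner_nonneg ?_, hf⟩
  intro ξ
  simp only [Matrix.of_apply, hf]
  exact hq.nonneg ξ

end PositiveForms

/-! ### The minimal cone lies in the maximal cone -/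

section MinLeMax

open scoped InnerProductSpace
open Filter Topology

/-- If `G ≥ δ`, the Schur product of `G` with a Gram matrix `⟪zᵢ, zⱼ⟫` has large total sum. -/
theorem Matrix.PosSemidef.le_re_sum_mul_inner {E : Type*} [NormedAddCommGroup E]
    [InnerProductSpace ℂ E] {κ : Type*} [Fintype κ] [DecidableEq κ] {G : Matrix κ κ ℂ} {δ : ℝ}
    (hG : (G - (δ : ℂ) • (1 : Matrix κ κ ℂ)).PosSemidef) (z : κ → E) :
    δ * ∑ i, ‖z i‖ ^ 2 ≤ (∑ i, ∑ j, G i j * ⟪z i, z j⟫_ℂ).re := by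
  open scoped MatrixOrder in
  obtain ⟨W, hW⟩ := CStarAlgebra.nonneg_iff_eq_star_mul_self.1 hG.nonneg
  have h1 : ∀ i j, G i j = (if i = j then (δ : ℂ) else 0) + ∑ k, star (W k i) * W k j := by
    intro i j
    have h2 := congrFun (congrFun hW i) j
    rw [Matrix.sub_apply, Matrix.smul_apply, Matrix.one_apply, Matrix.star_eq_conjTranspose,
      Matrix.mul_apply] at h2
    simp only [Matrix.conjTranspose_apply] at h2
    rw [← h2]
    simp
  have h3 : ∑ i, ∑ j, G i j * ⟪z i, z j⟫_ℂ =
      ((δ * ∑ i, ‖z i‖ ^ 2 + ∑ k, ‖∑ i, W k i • z i‖ ^ 2 : ℝ) : ℂ) := by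
    have h4 : ∀ k, ((‖∑ i, W k i • z i‖ ^ 2 : ℝ) : ℂ) =
        ∑ i, ∑ j, star (W k i) * W k j * ⟪z i, z j⟫_ℂ := fun k => by
      have := inner_self_eq_norm_sq_to_K (𝕜 := ℂ) (∑ i, W k i • z i)
      rw [Complex.ofReal_pow, ← Complex.coe_algebraMap, ← this]
      simp only [sum_inner, inner_sum, inner_smul_left, inner_smul_right, Complex.star_def,
        Finset.mul_sum]
      rw [Finset.sum_comm]
      refine Finset.sum_congr rfl fun i _ => Finset.sum_congr rfl fun j _ => ?_
      ring
    have h5 : ∀ i, ⟪z i, z i⟫_ℂ = ((‖z i‖ ^ 2 : ℝ) : ℂ) := fun i => by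
      rw [inner_self_eq_norm_sq_to_K, Complex.ofReal_pow]
      rfl
    rw [Complex.ofReal_add, Complex.ofReal_sum, Complex.ofReal_mul, Complex.ofReal_sum]
    simp only [h4, h1, add_mul, Finset.sum_add_distrib, ite_mul, zero_mul, Finset.sum_ite_eq,
      Finset.mem_univ, if_true, Finset.sum_mul, Finset.mul_sum, h5]
    congr 1
    rw [Finset.sum_comm_cycle]
  rw [h3, Complex.ofReal_re]
  have : 0 ≤ ∑ k, ‖∑ i, W k i • z i‖ ^ 2 := Finset.sum_nonneg fun _ _ => sq_nonneg _
  linarith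

variable {H : Type*} [NormedAddCommGroup H] [InnerProductSpace ℂ H] [CompleteSpace H]
  {n d N p : ℕ}

/-- On a finite-dimensional subspace `K` of `H`, the matrix `X` in the minimal cone is
approximately a sum of hermitian squares, with a coefficient matrix of forms on `H` whose norm is
bounded independently of `K`. -/
theorem exists_isPositiveForm_near {v : Fin N → Unc n} (hli : LinearIndependent ℂ v)
    (hv : Submodule.span ℂ (Set.range v) = Unc.polys n (d + 1))
    {X : Matrix (Fin p) (Fin p) (Unc n ⊗[ℂ] (H →L[ℂ] H))}
    (hX : X ∈ minCone (Unc n) (H →L[ℂ] H) p)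
    (hXd : ∀ a b, X a b ∈ polyTensor n d (H →L[ℂ] H)) :
    ∃ C : ℝ, ∀ (K : Submodule ℂ H) [FiniteDimensional ℂ K] (η : ℝ), 0 < η →
      ∃ q : Fin N × Fin p → Fin N × Fin p → H → H → ℂ, IsPositiveForm C q ∧
        ∀ x ∈ K, ∀ y ∈ K, ∀ a b, ‖slice x y (X a b) -
          ∑ i, ∑ j, q (i, a) (j, b) x y • (star (v i) * v j)‖ ≤ η * ‖x‖ * ‖y‖ := by
  obtain ⟨τ, hτs, hτp, hτ1, -, hτE⟩ := exists_state_posOn (Unc.polys n (d + 1))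
  have hvd : ∀ i, v i ∈ Unc.polys n (d + 1) := fun i => hv ▸ Submodule.subset_span ⟨i, rfl⟩
  obtain ⟨δ, hδ, hG⟩ := (gram_posDef hτs hτE hvd hli).exists_smul_one_le
  have hτn : ∀ z, ‖τ z‖ ≤ 2 * ‖z‖ := (isUCP_of_state (C := ℂ) hτs hτp hτ1).norm_le_two_mul
  choose c₀ hc₀ hc using fun ab : Fin p × Fin p => exists_norm_slice_le (X ab.1 ab.2)
  set c : ℝ := ∑ ab, c₀ ab with hcdef
  have hc0 : 0 ≤ c := Finset.sum_nonneg fun ab _ => hc₀ ab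
  have hcX : ∀ a b x y, ‖slice x y (X a b)‖ ≤ c * ‖x‖ * ‖y‖ := fun a b x y =>
    (hc (a, b) x y).trans (by
      gcongr
      exact Finset.single_le_sum (fun ab _ => hc₀ ab) (Finset.mem_univ (a, b)))
  -- `c` bounds the slices of `X`, the error adds at most `1`, `2` is the norm bound of `τ`, and `δ`
  -- bounds the Gram matrix of `τ` from below
  refine ⟨2 * (c + 1) / δ, fun K _ η hη => ?_⟩
  set m := Module.finrank ℂ K with hm
  let b := stdOrthonormalBasis ℂ K
  let e : Fin m → H := fun s => b s
  have he : Orthonormal ℂ e := b.orthonormal.comp_linearIsometry K.subtypeₗᵢ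
  have hex : ∀ x ∈ K, x = ∑ s, ⟪e s, x⟫_ℂ • e s := fun x hx => by
    refine (congrArg Subtype.val (b.sum_repr' ⟨x, hx⟩).symm).trans ?_
    exact (AddSubmonoidClass.coe_finsetSum _ _).trans rfl
  obtain ⟨ψ, hψ, hψe⟩ := exists_isUCP_compression_orthonormal he
  -- the compression of `X` to `K`, as a matrix of polynomials
  let M : Matrix (Fin p × Fin m) (Fin p × Fin m) (Unc n) :=
    Matrix.of fun α β => slice (e α.2) (e β.2) (X α.1 β.1)
  have hMs : Mᴴ = M := by
    ext1 α β
    change star (slice (e β.2) (e α.2) (X β.1 α.1)) = slice (e α.2) (e β.2) (X α.1 β.1)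
    rw [star_slice]
    congr 1
    exact congrFun (congrFun hX.1 α.1) β.1
  have hM : ∀ (k : ℕ) (π : Unc n →⋆ₐ[ℂ] Matrix (Fin k) (Fin k) ℂ), MatPos (M.map π) := by
    intro k π
    have h := (matPos_iff_posSemidef_comp.1 (hX.2 k m π ψ π.isUCP hψ)).submatrix
      fun x : (Fin p × Fin m) × Fin k => (x.1.1, (x.2, x.1.2))
    refine matPos_iff_posSemidef_comp.2 ?_
    convert h using 1
    ext ⟨⟨a, s⟩, i⟩ ⟨⟨b, t⟩, j⟩
    exact (tensorToMatrix_apply_eq_slice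
      (φ := (π : Unc n →ₗ[ℂ] Matrix (Fin k) (Fin k) ℂ)) hψe (X a b) i j s t).symm
  set η' : ℝ := min η 1 with hη'
  have hη'0 : 0 < η' := lt_min hη one_pos
  -- an error of `η' / (m + 1)²` in each entry, since slices at vectors of `K` sum up `m²` entries
  obtain ⟨Q, hQ, hQM⟩ := exists_squareSum_near hv hMs (fun α β => slice_mem_polys (hXd _ _) _ _) hM
    (ε := η' / (m + 1) ^ 2) (by positivity)
  open scoped MatrixOrder in
  obtain ⟨W, hW⟩ := CStarAlgebra.nonneg_iff_eq_star_mul_self.1 hQ.nonneg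
  -- `Q` is the Gram matrix of the vectors `w`; the form is `⟪Z x, Z y⟫` with `Z` linear in the
  -- coordinates
  let w : Fin N × (Fin p × Fin m) → EuclideanSpace ℂ (Fin N × (Fin p × Fin m)) :=
    fun α => WithLp.toLp 2 fun k => W k α
  have hw : ∀ α β, ⟪w α, w β⟫_ℂ = Q α β := fun α β => by
    rw [hW, Matrix.star_eq_conjTranspose, Matrix.mul_apply, PiLp.inner_apply]
    refine Finset.sum_congr rfl fun k _ => ?_
    rw [Matrix.conjTranspose_apply, RCLike.inner_apply, mul_comm]
    rfl
  let Z : Fin N × Fin p → H →ₗ[ℂ] EuclideanSpace ℂ (Fin N × (Fin p × Fin m)) := fun P =>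
    ∑ s, (innerₛₗ ℂ (e s)).smulRight (w (P.1, (P.2, s)))
  have hZ : ∀ P x, Z P x = ∑ s, ⟪e s, x⟫_ℂ • w (P.1, (P.2, s)) := fun P x => by
    simp [Z]
  have hZZ : ∀ P R x y, ⟪Z P x, Z R y⟫_ℂ = ∑ s, ∑ t,
      (star ⟪e s, x⟫_ℂ * ⟪e t, y⟫_ℂ) * Q (P.1, (P.2, s)) (R.1, (R.2, t)) := by
    intro P R x y
    simp only [hZ, sum_inner, inner_sum, inner_smul_left, inner_smul_right, hw, Complex.star_def,
      Finset.mul_sum]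
    rw [Finset.sum_comm]
    refine Finset.sum_congr rfl fun s _ => Finset.sum_congr rfl fun t _ => ?_
    ring
  have hnear : ∀ x ∈ K, ∀ y ∈ K, ∀ a b, ‖slice x y (X a b) -
      ∑ i, ∑ j, ⟪Z (i, a) x, Z (j, b) y⟫_ℂ • (star (v i) * v j)‖ ≤ η' * ‖x‖ * ‖y‖ := by
    intro x hx y hy a b
    have h1 : ∑ i, ∑ j, ⟪Z (i, a) x, Z (j, b) y⟫_ℂ • (star (v i) * v j) =
        ∑ s, ∑ t, (star ⟪e s, x⟫_ℂ * ⟪e t, y⟫_ℂ) • squareSum v Q (a, s) (b, t) := by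
      simp only [hZZ, squareSum, Matrix.of_apply, Finset.smul_sum, Finset.sum_smul, smul_smul]
      rw [Finset.sum_comm_cycle]
      exact Finset.sum_congr rfl fun s _ => Finset.sum_comm_cycle
    have h2 : slice x y (X a b) = ∑ s, ∑ t, (star ⟪e s, x⟫_ℂ * ⟪e t, y⟫_ℂ) • M (a, s) (b, t) := by
      conv_lhs => rw [hex x hx, hex y hy]
      exact slice_sum_smul _ _ _ _
    rw [h1, h2, ← Finset.sum_sub_distrib]
    simp only [← Finset.sum_sub_distrib, ← smul_sub]
    have h3 : ∀ s x, ‖⟪e s, x⟫_ℂ‖ ≤ ‖x‖ := fun s x => by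
      have := norm_inner_le_norm (𝕜 := ℂ) (e s) x
      rwa [he.1 s, one_mul] at this
    calc _ ≤ ∑ s : Fin m, ∑ t : Fin m, ‖x‖ * ‖y‖ * (η' / (m + 1) ^ 2) := by
          refine (norm_sum_le _ _).trans (Finset.sum_le_sum fun s _ => ?_)
          refine (norm_sum_le _ _).trans (Finset.sum_le_sum fun t _ => ?_)
          rw [norm_smul, norm_mul, norm_star]
          gcongr
          · exact h3 s x
          · exact h3 t y
          · exact hQM _ _
      _ = (m : ℝ) ^ 2 / (m + 1) ^ 2 * (η' * ‖x‖ * ‖y‖) := by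
          simp only [Finset.sum_const, Finset.card_univ, Fintype.card_fin, nsmul_eq_mul]
          ring
      _ ≤ 1 * (η' * ‖x‖ * ‖y‖) := by
          gcongr
          rw [div_le_one (by positivity)]
          gcongr
          linarith
      _ = η' * ‖x‖ * ‖y‖ := one_mul _
  have hC0 : 0 ≤ 2 * (c + 1) / δ := by positivity
  -- apply `τ` to the diagonal entry `∑ ⟪Z x, Z x⟫ vᵢ⋆ vⱼ`, which is close to a slice of `X`
  have hbound : ∀ P, ∀ x ∈ K, ‖Z P x‖ ≤ √(2 * (c + 1) / δ) * ‖x‖ := by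
    rintro ⟨i, a⟩ x hx
    have h1 := hG.le_re_sum_mul_inner fun i => Z (i, a) x
    have h2 : ∑ i, ∑ j, (Matrix.of fun i j => τ (star (v i) * v j)) i j *
        ⟪Z (i, a) x, Z (j, a) x⟫_ℂ =
        τ (∑ i, ∑ j, ⟪Z (i, a) x, Z (j, a) x⟫_ℂ • (star (v i) * v j)) := by
      simp only [map_sum, map_smul, smul_eq_mul, Matrix.of_apply, mul_comm]
    rw [h2] at h1
    have h3 := (Complex.re_le_norm _).trans
      (hτn (∑ i, ∑ j, ⟪Z (i, a) x, Z (j, a) x⟫_ℂ • (star (v i) * v j)))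
    have h4 := norm_sub_norm_le (∑ i, ∑ j, ⟪Z (i, a) x, Z (j, a) x⟫_ℂ • (star (v i) * v j))
      (slice x x (X a a))
    rw [norm_sub_rev] at h4
    have h5 := hnear x hx x hx a a
    have h6 := hcX a a x x
    have h7 : ‖Z (i, a) x‖ ^ 2 ≤ ∑ i, ‖Z (i, a) x‖ ^ 2 :=
      Finset.single_le_sum (f := fun i => ‖Z (i, a) x‖ ^ 2) (fun _ _ => sq_nonneg _)
        (Finset.mem_univ i)
    have h8 : η' * ‖x‖ * ‖x‖ ≤ 1 * ‖x‖ * ‖x‖ := by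
      gcongr
      exact min_le_right _ _
    have h9 : δ * ‖Z (i, a) x‖ ^ 2 ≤ 2 * (c + 1) * ‖x‖ ^ 2 := by
      have := mul_le_mul_of_nonneg_left h7 hδ.le
      nlinarith
    refine abs_le_of_sq_le_sq' ?_ (by positivity) |>.2
    rw [mul_pow, Real.sq_sqrt hC0, div_mul_eq_mul_div, le_div_iff₀ hδ]
    linarith
  -- extend the forms from `K` to `H` by the orthogonal projection
  let E := K.starProjection
  have hE : ∀ x, ‖E x‖ ≤ ‖x‖ := K.norm_starProjection_apply_le
  have hEK : ∀ x, E x ∈ K := fun x => by simp [E]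
  refine ⟨fun P R x y => ⟪Z P (E x), Z R (E y)⟫_ℂ, ⟨fun P R x x' y => ?_, fun P R c x y => ?_,
    fun P R x y y' => ?_, fun P R c x y => ?_, fun P R x y => ?_, fun ξ => ?_⟩, ?_⟩
  · rw [map_add, map_add, inner_add_left]
  · rw [map_smul, map_smul, inner_smul_left, Complex.star_def]
  · rw [map_add, map_add, inner_add_right]
  · rw [map_smul, map_smul, inner_smul_right]
  · have h1 := (hbound P _ (hEK x)).trans (mul_le_mul_of_nonneg_left (hE x) (Real.sqrt_nonneg _))
    have h2 := (hbound R _ (hEK y)).trans (mul_le_mul_of_nonneg_left (hE y) (Real.sqrt_nonneg _))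
    calc _ ≤ ‖Z P (E x)‖ * ‖Z R (E y)‖ := norm_inner_le_norm _ _
      _ ≤ (√(2 * (c + 1) / δ) * ‖x‖) * (√(2 * (c + 1) / δ) * ‖y‖) := by gcongr
      _ = √(2 * (c + 1) / δ) ^ 2 * ‖x‖ * ‖y‖ := by ring
      _ = _ := by rw [Real.sq_sqrt hC0]
  · have h : ∑ P, ∑ R, ⟪Z P (E (ξ P)), Z R (E (ξ R))⟫_ℂ =
        ⟪∑ P, Z P (E (ξ P)), ∑ P, Z P (E (ξ P))⟫_ℂ := by
      simp only [sum_inner, inner_sum]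
      exact Finset.sum_comm
    rw [h, inner_self_eq_norm_sq_to_K, ← RCLike.ofReal_pow]
    exact RCLike.ofReal_nonneg.2 (sq_nonneg _)
  · intro x hx y hy a b
    have h1 : E x = x := Submodule.starProjection_eq_self_iff.2 hx
    have h2 : E y = y := Submodule.starProjection_eq_self_iff.2 hy
    simp only [h1, h2]
    refine (hnear x hx y hy a b).trans ?_
    gcongr
    exact min_le_left _ _

/-- A matrix in the minimal cone with polynomial left-hand factors is an exact sum of hermitian
squares with operator coefficients: the coefficient forms on finite-dimensional subspaces converge
along an ultrafilter. -/
theorem mem_preMaxCone_of_mem_minCone {X : Matrix (Fin p) (Fin p) (Unc n ⊗[ℂ] (H →L[ℂ] H))}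
    (hX : X ∈ minCone (Unc n) (H →L[ℂ] H) p)
    (hXd : ∀ a b, X a b ∈ polyTensor n d (H →L[ℂ] H)) :
    X ∈ preMaxCone (Unc n) (H →L[ℂ] H) p := by
  classical
  obtain ⟨N, v, hli, hv⟩ := Unc.exists_basis_polys n (d + 1)
  obtain ⟨C, hC⟩ := exists_isPositiveForm_near hli hv hX hXd
  -- the index `(F, k)` stands for the subspace spanned by `F` and the error `1 / (k + 1)`
  choose q hq hqX using fun l : Finset H × ℕ =>
    hC (Submodule.span ℂ (l.1 : Set H)) (1 / ((l.2 : ℝ) + 1)) (by positivity)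
  let U : Ultrafilter (Finset H × ℕ) := Ultrafilter.of atTop
  have hU : (U : Filter (Finset H × ℕ)) ≤ atTop := Ultrafilter.of_le _
  obtain ⟨q', hq', hlim⟩ := IsPositiveForm.exists_tendsto U hq
  obtain ⟨T, hT, hTq⟩ := hq'.exists_matPos
  have hslice : ∀ x y a b, slice x y (X a b) =
      ∑ i, ∑ j, q' (i, a) (j, b) x y • (star (v i) * v j) := by
    intro x y a b
    have h1 : Tendsto (fun l => ∑ i, ∑ j, q l (i, a) (j, b) x y • (star (v i) * v j)) U
        (𝓝 (∑ i, ∑ j, q' (i, a) (j, b) x y • (star (v i) * v j))) :=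
      tendsto_finsetSum _ fun i _ => tendsto_finsetSum _ fun j _ =>
        (hlim (i, a) (j, b) x y).smul_const _
    refine tendsto_nhds_unique ?_ h1
    rw [tendsto_iff_norm_sub_tendsto_zero]
    have h2 : Tendsto (fun l : Finset H × ℕ => 1 / ((l.2 : ℝ) + 1) * ‖x‖ * ‖y‖) U (𝓝 0) := by
      have h3 : Tendsto (fun l : Finset H × ℕ => l.2) U atTop :=
        (prod_atTop_atTop_eq (α := Finset H) (β := ℕ) ▸ tendsto_snd :
          Tendsto (fun l : Finset H × ℕ => l.2) atTop atTop).mono_left hU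
      have h4 := ((tendsto_one_div_add_atTop_nhds_zero_nat (𝕜 := ℝ)).comp h3).mul_const (‖x‖ * ‖y‖)
      rw [zero_mul] at h4
      refine h4.congr fun l => ?_
      simp [mul_assoc]
    refine squeeze_zero' (Eventually.of_forall fun _ => norm_nonneg _) ?_ h2
    filter_upwards [hU (eventually_ge_atTop (({x, y} : Finset H), 0))] with l hl
    have hx : x ∈ Submodule.span ℂ (l.1 : Set H) := Submodule.subset_span (hl.1 (by simp))
    have hy : y ∈ Submodule.span ℂ (l.1 : Set H) := Submodule.subset_span (hl.1 (by simp))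
    rw [norm_sub_rev]
    exact hqX l x hx y hy a b
  -- `X` is the sum over `i, j` of the Schur product of the Gram matrix of `v` with `T`
  have h := sum_schur_mem_preMaxCone (matPos_gram fun s : Fin p × Fin N => v s.2)
    (hT.submatrix (Prod.swap : Fin p × Fin N → Fin N × Fin p))
  refine Set.mem_of_eq_of_mem ?_ h
  ext1 a b
  refine eq_of_forall_slice_eq fun x y => ?_
  simp only [hslice, Matrix.of_apply, Matrix.submatrix_apply, Prod.swap, map_sum, slice_tmul, hTq]

/-- A polynomial approximation `Y` of `X`, shifted by `ε/2`, is in the minimal cone, hence in the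
maximal one; the error of the approximation takes another `ε/2`. -/
theorem minCone_subset_maxCone (p : ℕ) :
    minCone (Unc n) (H →L[ℂ] H) p ⊆ maxCone (Unc n) (H →L[ℂ] H) p := by
  rintro X ⟨hXs, hX⟩
  refine ⟨hXs, fun ε hε => ?_⟩
  obtain ⟨d, Y, hYs, hYd, h1, h2⟩ := exists_selfAdjoint_polyTensor_approx hXs (ε := ε / 2)
    (by positivity)
  have hY : Y + ((ε / 2 : ℝ) : ℂ) • 1 ∈ minCone (Unc n) (H →L[ℂ] H) p := by
    refine ⟨?_, fun k m φ ψ hφ hψ => ?_⟩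
    · rw [Matrix.conjTranspose_add, hYs, Matrix.conjTranspose_smul, Matrix.conjTranspose_one,
        Complex.star_def, Complex.conj_ofReal]
    · have h3 := MatPos.add (A := CStarMatrix (Fin k × Fin m) (Fin k × Fin m) ℂ)
        (hX k m φ ψ hφ hψ) (matPos_map_tensorToMatrix_of_mem_preMaxCone h2 hφ hψ)
      have h4 : (Y + ((ε / 2 : ℝ) : ℂ) • 1).map (tensorToMatrix φ ψ) =
          X.map (tensorToMatrix φ ψ) +
            (((ε / 2 : ℝ) : ℂ) • 1 + (Y - X)).map (tensorToMatrix φ ψ) := by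
        ext1 a b
        change tensorToMatrix φ ψ _ = tensorToMatrix φ ψ _ + tensorToMatrix φ ψ _
        rw [← map_add]
        congr 1
        simp only [Matrix.add_apply, Matrix.sub_apply]
        abel
      rw [h4]
      exact h3
  have hYd' : ∀ a b, (Y + ((ε / 2 : ℝ) : ℂ) • 1) a b ∈ polyTensor n d (H →L[ℂ] H) := by
    intro a b
    refine add_mem (hYd a b) (Submodule.smul_mem _ _ ?_)
    rw [Matrix.one_apply]
    split_ifs
    · exact Submodule.subset_span ⟨1, Unc.one_mem_polys d, 1, rfl⟩
    · exact Submodule.zero_mem _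
  convert add_mem_preMaxCone h1 (mem_preMaxCone_of_mem_minCone hY hYd') using 1
  push_cast
  module

end MinLeMax

end

theorem mainTheorem5 (n : ℕ) :
    HasLLP.{0, u, v} (Unc n) ∧
      ∀ (H : Type w) [NormedAddCommGroup H] [InnerProductSpace ℂ H] [CompleteSpace H],
        MinTensorEqMaxTensor (Unc n) (H →L[ℂ] H) :=
  ⟨Unc.hasLLP n, fun _ _ _ _ p =>
    Set.Subset.antisymm (minCone_subset_maxCone p) (maxCone_subset_minCone p)⟩
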